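/- All graphs are finite and simple. Let $G$ be a graph on $n\ge 1$ vertices and let $d\ge 0$ be an integer. The \emph{ball} $D_d(v)$ of diameter $d$ around a vertex $v$ is the subgraph of $G$ consisting of those vertices and edges that lie on closed walks of length at most $d$ containing $v$. Its \emph{size} is its number of vertices plus its number of edges, and $R=R(G,d)$ denotes the maximum size of a ball $D_d(v)$, $v\in V(G)$. For vertices $v,w$ of distance at most $d/2$, the \emph{core} is the set of all vertices on shortest $v$-$w$-paths. The \emph{explorer neighbourhood} $Ex_d(v,w)$ is obtained from the disjoint union of copies of $D_d(v)$ and $D_d(w)$ by identifying the two copies of a vertex $u$ whenever a single path is, in each of the two balls, a shortest path from the core to $u$ contained in that ball. A set $\{v,w\}$ of two distinct vertices is a \emph{$d$-local 2-separator} if $v$ and $w$ have distance at most $d/2$ in $G$ and $Ex_d(v,w)-v-w$ is disconnected (has at least two components). Two $d$-local 2-separators $X$ and $Y$ \emph{cross} if there is a cycle of length at most $d$ in $G$ that contains $X\cup Y$ and alternates between $X$ and $Y$, and $X$ and $Y$ locally separate each other, that is, the two vertices of $Y$ lie in different components of the explorer neighbourhood of $X$ minus $X$, and vice versa (vertices on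 such a cycle have unique copies in these explorer neighbourhoods). A $d$-local 2-separator is \emph{totally nested} if it is not crossed by any $d$-local 2-separator. Then all totally nested $d$-local 2-separators of $G$ can be found in time $O(\max(d^2,R)\cdot R\cdot n)$. That is, there are a single program for a unit-cost random-access machine (with addition, truncated subtraction, indirect addressing and zero tests; storage initially zero apart from the input) and an absolute constant $C$ such that, for all $n\ge 1$, all graphs $G$ on $\{0,\dots,n-1\}$ and all $d\ge 0$, the program, started on $n$, $d$ and any adjacency-list representation of $G$, halts after at most $C\cdot\max(d^2,R)\cdot R\cdot n$ steps and outputs a list containing each totally nested $d$-local 2-separator of $G$ exactly once, as a pair of vertices with the smaller one first, and nothing else. -/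

import Mathlib

namespace LocalSep

/-! ### Balls, explorer neighbourhoods and local 2-separators -/

section Graph

variable {V : Type*} (G : SimpleGraph V)

/-- The ball of diameter `d` around `v`: all vertices and edges of `G` lying on closed walks of
length at most `d` that contain `v` (a closed walk containing `v` may be started at `v`). -/
def ball (d : ℕ) (v : V) : G.Subgraph where
  verts := {u | ∃ p : G.Walk v v, p.length ≤ d ∧ u ∈ p.support}
  Adj u w := ∃ p : G.Walk v v, p.length ≤ d ∧ s(u, w) ∈ p.edges
  adj_sub := fun ⟨p, _, h⟩ => p.adj_of_mem_edges h
  edge_vert := fun ⟨p, hp, h⟩ => ⟨p, hp, p.fst_mem_support_of_mem_edges h⟩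
  symm := ⟨fun _ _ ⟨p, hp, h⟩ => ⟨p, hp, Sym2.eq_swap ▸ h⟩⟩

/-- The size of the ball of diameter `d` around `v`: number of vertices plus number of edges. -/
noncomputable def ballSize (d : ℕ) (v : V) : ℕ :=
  (ball G d v).verts.ncard + (ball G d v).edgeSet.ncard

/-- The maximum size of a ball of diameter `d` around a vertex. -/
noncomputable def maxBallSize [Fintype V] (d : ℕ) : ℕ :=
  Finset.univ.sup fun v : V => ballSize G d v

/-- The core: the vertices on shortest paths between `v` and `w`. -/
def core (v w : V) : Set V :=
  {u | ∃ p : G.Walk v w, p.length = G.dist v w ∧ u ∈ p.support}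

/-- The walk `p` from `c` to `u` is a shortest path from the set `K` to `u`
contained in the subgraph `B`. -/
def IsShortestIn {G : SimpleGraph V} (B : G.Subgraph) (K : Set V) {c u : V} (p : G.Walk c u) :
    Prop :=
  c ∈ K ∧ p.toSubgraph ≤ B ∧
    ∀ c' ∈ K, ∀ q : G.Walk c' u, q.toSubgraph ≤ B → p.length ≤ q.length

/-- The copies of `u` in the balls around `v` and `w` have a common label: some shortest path
from the core to `u` is discovered by both explorers. -/
def CommonLabel (d : ℕ) (v w u : V) : Prop :=
  ∃ c, ∃ p : G.Walk c u,
    IsShortestIn (ball G d v) (core G v w) p ∧ IsShortestIn (ball G d w) (core G v w) p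

/-- The vertices of the disjoint union of (copies of) the balls around `v` and `w`. -/
abbrev Copies (d : ℕ) (v w : V) : Type _ := (ball G d v).verts ⊕ (ball G d w).verts

/-- The vertex of `G` of which an element of the disjoint union is a copy. -/
def Copies.orig {G : SimpleGraph V} {d : ℕ} {v w : V} : Copies G d v w → V :=
  Sum.elim Subtype.val Subtype.val

/-- Identify the two copies of a vertex if they have a common label. -/
def copySetoid (d : ℕ) (v w : V) : Setoid (Copies G d v w) where
  r x y := x.orig = y.orig ∧ (x = y ∨ CommonLabel G d v w x.orig)
  iseqv :=
    { refl := fun _ => ⟨rfl, Or.inl rfl⟩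
      symm := fun ⟨h, h'⟩ => ⟨h.symm, h'.imp Eq.symm fun k => h ▸ k⟩
      trans := by
        rintro x y z ⟨h, h'⟩ ⟨k, k'⟩
        refine ⟨h.trans k, ?_⟩
        rcases h' with rfl | h'
        · exact k'
        · exact Or.inr h' }

/-- The vertices of the explorer neighbourhood. -/
def ExVertex (d : ℕ) (v w : V) : Type _ := Quotient (copySetoid G d v w)

/-- The vertex of `G` of which a vertex of the explorer neighbourhood is a copy. -/
def ExVertex.orig {G : SimpleGraph V} {d : ℕ} {v w : V} (a : ExVertex G d v w) : V :=
  Quotient.lift (s := copySetoid G d v w) Copies.orig (fun _ _ h => h.1) a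

/-- Adjacency in the disjoint union of the two balls. -/
def copyAdj (d : ℕ) (v w : V) : Copies G d v w → Copies G d v w → Prop
  | Sum.inl x, Sum.inl y => (ball G d v).Adj x y
  | Sum.inr x, Sum.inr y => (ball G d w).Adj x y
  | _, _ => False

theorem copyAdj_adj {d : ℕ} {v w : V} :
    ∀ {x y : Copies G d v w}, copyAdj G d v w x y → G.Adj x.orig y.orig
  | Sum.inl _, Sum.inl _, h => (ball G d v).adj_sub h
  | Sum.inr _, Sum.inr _, h => (ball G d w).adj_sub h

theorem copyAdj_symm {d : ℕ} {v w : V} :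
    ∀ {x y : Copies G d v w}, copyAdj G d v w x y → copyAdj G d v w y x
  | Sum.inl _, Sum.inl _, h => (ball G d v).symm.symm _ _ h
  | Sum.inr _, Sum.inr _, h => (ball G d w).symm.symm _ _ h

/-- The explorer neighbourhood of diameter `d` with explorers based at `v` and `w`. -/
def explorer (d : ℕ) (v w : V) : SimpleGraph (ExVertex G d v w) where
  Adj a b := ∃ x y : Copies G d v w, Quotient.mk (copySetoid G d v w) x = a ∧
    Quotient.mk (copySetoid G d v w) y = b ∧ copyAdj G d v w x y
  symm := ⟨fun _ _ ⟨x, y, hx, hy, h⟩ => ⟨y, x, hy, hx, copyAdj_symm G h⟩⟩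
  loopless := ⟨by
    rintro a ⟨x, y, hx, hy, h⟩
    have := (Quotient.exact (hx.trans hy.symm)).1
    exact (copyAdj_adj G h).ne this⟩

/-- The vertices of the explorer neighbourhood other than the (copies of the) explorers. -/
def puncturedVerts (d : ℕ) (v w : V) : Set (ExVertex G d v w) :=
  {a | a.orig ≠ v ∧ a.orig ≠ w}

/-- The punctured explorer neighbourhood, with the two explorers deleted. -/
def punctured (d : ℕ) (v w : V) : SimpleGraph (puncturedVerts G d v w) :=
  (explorer G d v w).induce (puncturedVerts G d v w)

/-- `{v, w}` is a `d`-local 2-separator: `v` and `w` are distinct, have distance at most `d / 2`,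
and the punctured explorer neighbourhood is disconnected (has at least two components). -/
def IsLocalSeparator (d : ℕ) (v w : V) : Prop :=
  v ≠ w ∧ G.Reachable v w ∧ 2 * G.dist v w ≤ d ∧ ¬ (punctured G d v w).Preconnected

/-- There is a cycle of length at most `d` that contains `{x₀, x₁}` and `{y₀, y₁}` and alternates
between them: `{x₀, x₁}` splits the cycle in two arcs `p` and `q`, one of which has `y₀` and the
other `y₁` as an interior vertex. -/
def AlternatingCycle (d : ℕ) (x₀ x₁ y₀ y₁ : V) : Prop :=
  ∃ (p : G.Walk x₀ x₁) (q : G.Walk x₁ x₀),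
    (p.append q).IsCycle ∧ (p.append q).length ≤ d ∧ x₀ ≠ x₁ ∧
    y₀ ∈ p.support ∧ y₀ ≠ x₀ ∧ y₀ ≠ x₁ ∧ y₁ ∈ q.support ∧ y₁ ≠ x₀ ∧ y₁ ≠ x₁

/-- `{x₀, x₁}` locally separates `y₀` from `y₁`: copies of `y₀` and `y₁` lie in different
components of the punctured explorer neighbourhood of `x₀` and `x₁`. (If all four vertices are
on a cycle of length at most `d`, then each of `y₀` and `y₁` has exactly one copy.) -/
def LocallySeparates (d : ℕ) (x₀ x₁ y₀ y₁ : V) : Prop :=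
  ∀ a b : puncturedVerts G d x₀ x₁, a.1.orig = y₀ → b.1.orig = y₁ →
    ¬ (punctured G d x₀ x₁).Reachable a b

/-- The `d`-local 2-separators `{x₀, x₁}` and `{y₀, y₁}` cross: there is a cycle of length at most
`d` containing both that alternates between them, and they locally separate each other. -/
def Crosses (d : ℕ) (x₀ x₁ y₀ y₁ : V) : Prop :=
  AlternatingCycle G d x₀ x₁ y₀ y₁ ∧
    LocallySeparates G d x₀ x₁ y₀ y₁ ∧ LocallySeparates G d y₀ y₁ x₀ x₁

/-- `{x₀, x₁}` is a totally nested `d`-local 2-separator. -/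
def IsTotallyNested (d : ℕ) (x₀ x₁ : V) : Prop :=
  IsLocalSeparator G d x₀ x₁ ∧
    ∀ y₀ y₁ : V, IsLocalSeparator G d y₀ y₁ → ¬ Crosses G d y₀ y₁ x₀ x₁

end Graph

/-! ### Random-access machines with unit cost

The storage consists of scalar registers and one-dimensional arrays of registers, each holding a
natural number. The arithmetic is addition and truncated subtraction; there is no multiplication. -/

/-- A storage configuration: scalar registers, and arrays indexed by natural numbers. -/
structure Store where
  var : ℕ → ℕ
  arr : ℕ → ℕ → ℕ

/-- Assign a value to a scalar register. -/
def Store.setVar (s : Store) (x k : ℕ) : Store :=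
  { s with var := Function.update s.var x k }

/-- Assign a value to the entry `i` of the array `a`. -/
def Store.setArr (s : Store) (a i k : ℕ) : Store :=
  { s with arr := Function.update s.arr a (Function.update (s.arr a) i k) }

/-- Programs. Scalar registers and arrays are named by fixed numbers, so a program uses only
finitely many of them; array entries are addressed indirectly, by the content of a register. -/
inductive Prog : Type
  /-- do nothing -/
  | skip
  /-- `x := k` for a constant `k` -/
  | const (x k : ℕ)
  /-- `x := y` -/
  | copy (x y : ℕ)
  /-- `x := y + z` -/
  | add (x y z : ℕ)
  /-- `x := y - z` (truncated) -/
  | sub (x y z : ℕ)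
  /-- `x := a[y]` -/
  | load (x a y : ℕ)
  /-- `a[x] := y` -/
  | store (a x y : ℕ)
  /-- sequential composition -/
  | seq (p q : Prog)
  /-- if `x ≠ 0` then `p` else `q` -/
  | cond (x : ℕ) (p q : Prog)
  /-- while `x ≠ 0` do `p` -/
  | loop (x : ℕ) (p : Prog)

/-- `Run p s s' t`: started in `s`, the program `p` halts in `s'` after exactly `t` steps. Every
elementary instruction and every test is one step. -/
inductive Run : Prog → Store → Store → ℕ → Prop
  | skip (s) : Run .skip s s 1
  | const (s x k) : Run (.const x k) s (s.setVar x k) 1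
  | copy (s x y) : Run (.copy x y) s (s.setVar x (s.var y)) 1
  | add (s x y z) : Run (.add x y z) s (s.setVar x (s.var y + s.var z)) 1
  | sub (s x y z) : Run (.sub x y z) s (s.setVar x (s.var y - s.var z)) 1
  | load (s x a y) : Run (.load x a y) s (s.setVar x (s.arr a (s.var y))) 1
  | store (s a x y) : Run (.store a x y) s (s.setArr a (s.var x) (s.var y)) 1
  | seq {p q s₁ s₂ s₃ t₁ t₂} (h₁ : Run p s₁ s₂ t₁) (h₂ : Run q s₂ s₃ t₂) :
      Run (.seq p q) s₁ s₃ (t₁ + t₂)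
  | cond_true {x p q s s' t} (hx : s.var x ≠ 0) (h : Run p s s' t) :
      Run (.cond x p q) s s' (t + 1)
  | cond_false {x p q s s' t} (hx : s.var x = 0) (h : Run q s s' t) :
      Run (.cond x p q) s s' (t + 1)
  | loop_true {x p s₁ s₂ s₃ t₁ t₂} (hx : s₁.var x ≠ 0) (h₁ : Run p s₁ s₂ t₁)
      (h₂ : Run (.loop x p) s₂ s₃ t₂) : Run (.loop x p) s₁ s₃ (t₁ + t₂ + 1)
  | loop_false {x p s} (hx : s.var x = 0) : Run (.loop x p) s s 1

/-! ### Input and output -/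

/-- `nbrs` is an adjacency-list representation of `G`: the list of `v` contains every neighbour of
`v` exactly once, in arbitrary order. -/
def IsAdjacencyList {n : ℕ} (G : SimpleGraph (Fin n)) (nbrs : Fin n → List (Fin n)) : Prop :=
  ∀ v, (nbrs v).Nodup ∧ ∀ u, u ∈ nbrs v ↔ G.Adj v u

/-- The initial storage. Register 0 holds `n` and register 1 holds `d`. Array 1 holds the adjacency
lists of the vertices `0, …, n - 1`, one after the other, and for `v ≤ n` the entry `v` of array 0
is the total length of the lists of the vertices less than `v`, so that the list of `v` occupies
the positions from `arr 0 v` to `arr 0 (v + 1) - 1`. All other registers are zero. -/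
def inputStore {n : ℕ} (nbrs : Fin n → List (Fin n)) (d : ℕ) : Store where
  var x := if x = 0 then n else if x = 1 then d else 0
  arr a i :=
    if a = 0 then (if i ≤ n then ((List.ofFn nbrs).take i).flatten.length else 0)
    else if a = 1 then ((List.ofFn nbrs).flatten.map Fin.val).getD i 0
    else 0

/-- The storage `s` holds the list `l` of pairs of vertices: register 2 holds its length, and the
entries `i` of the arrays 2 and 3 are the two members of the `i`-th pair. -/
def HoldsPairs {n : ℕ} (s : Store) (l : List (Fin n × Fin n)) : Prop :=
  s.var 2 = l.length ∧
    ∀ (i : ℕ) (hi : i < l.length), s.arr 2 i = (l[i].1 : ℕ) ∧ s.arr 3 i = (l[i].2 : ℕ)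

end LocalSep

namespace LocalSep

open SimpleGraph Relation

/-! ### Balls by distances, and the components of punctured explorer neighbourhoods -/

section Structure

variable {V : Type*} {G : SimpleGraph V} {d : ℕ}

/-! Explorer neighbourhoods identify copies through common shortest paths, which is awkward to
compute with. Their components, however, are determined by distances. Call `u` close to `v` and `w`
if d(v,u) + d(u,w) + d(v,w) ≤ d. The two copies of a close vertex are identified, since a globally
shortest path from the core to it lies in both balls (`Close.commonLabel`). Conversely, if the
copies of some vertex are identified, then the common shortest path can be followed in each ball
back to a close vertex on it, avoiding `v` and `w` (`CommonLabel.rtg`). Hence the punctured explorer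
neighbourhood has the same components as the disjoint union of the two balls without `v` and `w`,
with the copies of close vertices linked (`punctured_reachable_iff`). This graph has size O(R), and
at most nR ordered pairs have distance at most d/2, so once the balls are known, all local
separators and all component labels cost O(R²n).

For the crossing test, fix a separator {v,w}. If `v` and `w` are adjacent, nothing crosses it: the
edge connects them past any candidate. Otherwise take a breadth-first tree from `v` in the ball
around `v` without `w`. Let a₀ be a neighbour of `w` nearest to the root, and a₁ a nearest one among
those in other components than a₀. A crossing pair lies on a cycle of length at most d made of two
v-w-arcs through different components. The tree path through a₀ is no longer than either arc, so
together with one arc it stays within length d and hence in the relevant ball; as the crossing pair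
separates `v` from `w`, it must meet this path. The same holds for a₁, so the crossing pair has one
vertex on each tree path (`isCrossedOnTree_of_crosses`). Conversely, the two tree paths close up to
a cycle on which any such pair alternates with {v,w} (`alternatingCycle_of_tree`). Thus at most d²
pairs are tested per separator, each in constant time from the tables.

Correctness and running time of the program are proved together in the calculus `Wp`. The time of a
search is charged to a potential (`pot`), the weight of the marked vertices. As the storage is
initially zero, each search works in fresh rows and nothing is ever cleared. Finding a ball means
scanning at most R adjacency lists of length at most R, which is R²n for all balls; each of the nR
pairs then costs O(R + d²). For d < 2 there are no separators at all. -/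

theorem exists_nat_of_edist_le {u v : V} {k : ℕ} (h : G.edist u v ≤ k) :
    ∃ a : ℕ, G.edist u v = a ∧ a ≤ k := by
  obtain ⟨a, ha⟩ := ENat.ne_top_iff_exists.1 (ne_top_of_le_ne_top (ENat.natCast_ne_top k) h)
  exact ⟨a, ha.symm, by rw [← ha] at h; exact_mod_cast h⟩

theorem exists_walk_of_edist_le {u v : V} {k : ℕ} (h : G.edist u v ≤ k) :
    ∃ p : G.Walk u v, (p.length : ℕ∞) = G.edist u v ∧ p.length ≤ k := by
  obtain ⟨a, ha, hk⟩ := exists_nat_of_edist_le h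
  obtain ⟨p, hp⟩ := exists_walk_of_edist_eq_coe ha
  exact ⟨p, by rw [ha, hp], hp ▸ hk⟩

theorem edist_add_edist_le_length {u v x : V} (p : G.Walk u v) (hx : x ∈ p.support) :
    G.edist u x + G.edist x v ≤ p.length := by
  classical
  have h : p.length = (p.takeUntil x hx).length + (p.dropUntil x hx).length := by
    rw [← Walk.length_append, Walk.take_spec]
  rw [h]
  push_cast
  exact add_le_add (edist_le _) (edist_le _)

/-- The two alternatives are the two directions in which the walk can run through the edge. -/
theorem edist_add_of_mem_edges {x y a b : V} (p : G.Walk x y) (h : s(a, b) ∈ p.edges) :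
    G.edist x a + 1 + G.edist b y ≤ p.length ∨ G.edist x b + 1 + G.edist a y ≤ p.length := by
  induction p with
  | nil => simp at h
  | @cons u v w h' p ih =>
    rw [Walk.edges_cons, List.mem_cons] at h
    have key : ∀ a b : V, G.edist v a + 1 + G.edist b w ≤ p.length →
        G.edist u a + 1 + G.edist b w ≤ (Walk.cons h' p).length := by
      intro a b hab
      have h1 : G.edist u a ≤ 1 + G.edist v a :=
        G.edist_triangle.trans (by rw [edist_eq_one_iff_adj.2 h'])
      calc G.edist u a + 1 + G.edist b w ≤ (1 + G.edist v a) + 1 + G.edist b w := by gcongr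
        _ = 1 + (G.edist v a + 1 + G.edist b w) := by ring
        _ ≤ 1 + p.length := by gcongr
        _ = _ := by rw [Walk.length_cons]; push_cast; ring
    have one : 1 + G.edist v w ≤ (Walk.cons h' p).length := by
      rw [Walk.length_cons, add_comm]
      push_cast
      gcongr
      exact edist_le p
    rcases h with h | h
    · rcases Sym2.eq_iff.1 h with ⟨rfl, rfl⟩ | ⟨rfl, rfl⟩
      · left; simpa using one
      · right; simpa using one
    · exact (ih h).imp (key a b) (key b a)

/-- A closed walk through `v` and `u` has to go there and back, and a shortest path followed by its
reverse is the best such walk. -/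
theorem mem_ball_iff {v u : V} : u ∈ (ball G d v).verts ↔ 2 * G.edist v u ≤ d := by
  constructor
  · rintro ⟨p, hp, hu⟩
    have h := edist_add_edist_le_length p hu
    rw [edist_comm (u := u)] at h
    rw [two_mul]
    exact h.trans (by exact_mod_cast hp)
  · intro h
    have h0 : G.edist v u ≤ d := le_trans (by rw [two_mul]; exact le_self_add) h
    obtain ⟨p, hp, -⟩ := exists_walk_of_edist_le h0
    rw [← hp] at h
    refine ⟨p.append p.reverse, ?_, by simp⟩
    rw [Walk.length_append, Walk.length_reverse, ← two_mul]
    exact_mod_cast h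

/-- The ball is not an induced subgraph: for even `d`, an edge between two vertices at distance d/2
is missing although both its ends are present. -/
theorem ball_adj_iff {v a b : V} :
    (ball G d v).Adj a b ↔ G.Adj a b ∧ G.edist v a + G.edist v b + 1 ≤ d := by
  constructor
  · rintro ⟨p, hp, h⟩
    refine ⟨p.adj_of_mem_edges h, ?_⟩
    have hp' : (p.length : ℕ∞) ≤ d := by exact_mod_cast hp
    rcases edist_add_of_mem_edges p h with h | h
    · rw [edist_comm (u := b)] at h
      exact le_trans (by rw [add_right_comm]) (h.trans hp')
    · rw [edist_comm (u := a)] at h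
      exact le_trans (le_of_eq (by ring)) (h.trans hp')
  · rintro ⟨hab, h⟩
    have ha : G.edist v a ≤ d := le_trans (by rw [add_assoc]; exact le_self_add) h
    have hb : G.edist v b ≤ d := le_trans (by rw [add_right_comm]; exact le_add_self) h
    obtain ⟨p, hp, -⟩ := exists_walk_of_edist_le ha
    obtain ⟨q, hq, -⟩ := exists_walk_of_edist_le hb
    refine ⟨p.append (Walk.cons hab q.reverse), ?_, by simp⟩
    rw [← hp, ← hq] at h
    have h' : p.length + q.length + 1 ≤ d := by exact_mod_cast h
    simp only [Walk.length_append, Walk.length_cons, Walk.length_reverse]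
    omega

/-- Shortest paths from `x` to both ends of `p` complete it to a closed walk through `x`. -/
theorem toSubgraph_le_ball {x c u : V} (p : G.Walk c u)
    (h : G.edist x c + p.length + G.edist u x ≤ d) : p.toSubgraph ≤ ball G d x := by
  have ha : G.edist x c ≤ d := le_trans (by rw [add_assoc]; exact le_self_add) h
  have hb : G.edist u x ≤ d := le_add_self.trans h
  obtain ⟨r, hr, -⟩ := exists_walk_of_edist_le ha
  obtain ⟨q, hq, -⟩ := exists_walk_of_edist_le hb
  rw [← hr, ← hq] at h
  have h' : r.length + p.length + q.length ≤ d := by exact_mod_cast h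
  have hl : (r.append (p.append q)).length ≤ d := by simp only [Walk.length_append]; omega
  constructor
  · intro y hy
    exact ⟨_, hl, by simp only [Walk.mem_support_append_iff]; right; left; simpa using hy⟩
  · intro y z hyz
    exact ⟨_, hl, by
      simp only [Walk.edges_append, List.mem_append]; right; left
      exact Walk.adj_toSubgraph_iff_mem_edges.1 hyz⟩

/-- The vertices on closed walks of length at most `d` through `v` and `w`. -/
def Close (G : SimpleGraph V) (d : ℕ) (v w u : V) : Prop :=
  G.edist v u + G.edist u w + G.edist v w ≤ d

theorem Close.exists_nat {v w u : V} (h : Close G d v w u) :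
    ∃ a b k : ℕ, G.edist v u = a ∧ G.edist u w = b ∧ G.edist v w = k ∧ a + b + k ≤ d := by
  have h1 : G.edist v u ≤ d := le_trans (by rw [add_assoc]; exact le_self_add) h
  have h2 : G.edist u w ≤ d := le_trans (by rw [add_right_comm]; exact le_add_self) h
  have h3 : G.edist v w ≤ d := le_add_self.trans h
  obtain ⟨a, ha, -⟩ := exists_nat_of_edist_le h1
  obtain ⟨b, hb, -⟩ := exists_nat_of_edist_le h2
  obtain ⟨k, hk, -⟩ := exists_nat_of_edist_le h3
  refine ⟨a, b, k, ha, hb, hk, ?_⟩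
  rw [Close, ha, hb, hk] at h
  exact_mod_cast h

theorem Close.swap {v w u : V} (h : Close G d v w u) : Close G d w v u := by
  unfold Close at *
  rwa [edist_comm (u := w) (v := u), edist_comm (u := u) (v := v), edist_comm (u := w) (v := v),
    add_comm (G.edist u w)]

/-- By the triangle inequality, twice the distance from `v` to `u` is at most the sum that defines
closeness. -/
theorem Close.mem_ball_left {v w u : V} (h : Close G d v w u) : u ∈ (ball G d v).verts := by
  obtain ⟨a, b, k, ha, hb, hk, hd⟩ := h.exists_nat
  rw [mem_ball_iff, ha]
  have := G.edist_triangle (u := v) (v := w) (w := u)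
  rw [edist_comm (u := w), ha, hb, hk] at this
  have : a ≤ k + b := by exact_mod_cast this
  exact_mod_cast (by omega : 2 * a ≤ d)

theorem Close.mem_ball_right {v w u : V} (h : Close G d v w u) : u ∈ (ball G d w).verts :=
  h.swap.mem_ball_left

theorem start_mem_core {v w : V} (h : G.Reachable v w) : v ∈ core G v w := by
  obtain ⟨p, hp⟩ := h.exists_walk_length_eq_dist
  exact ⟨p, hp, p.start_mem_support⟩

theorem end_mem_core {v w : V} (h : G.Reachable v w) : w ∈ core G v w := by
  obtain ⟨p, hp⟩ := h.exists_walk_length_eq_dist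
  exact ⟨p, hp, p.end_mem_support⟩

theorem edist_add_edist_of_mem_core {v w c : V} (h : G.Reachable v w) (hc : c ∈ core G v w) :
    G.edist v c + G.edist c w ≤ G.edist v w := by
  obtain ⟨p, hp, hc⟩ := hc
  have := edist_add_edist_le_length p hc
  rwa [hp, h.coe_dist_eq_edist] at this

/-- A path from the core to `u` that is shortest in all of `G` is also shortest in each subgraph
containing it, so it only remains to see that it lies in both balls. -/
theorem Close.commonLabel {v w u : V} (h : Close G d v w u) : CommonLabel G d v w u := by
  classical
  obtain ⟨a, b, k, ha, hb, hk, hd⟩ := h.exists_nat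
  have hvw : G.Reachable v w := reachable_of_edist_ne_top (by rw [hk]; exact ENat.natCast_ne_top k)
  obtain ⟨pv, hpv⟩ := exists_walk_of_edist_eq_coe ha
  obtain ⟨pw, hpw⟩ := exists_walk_of_edist_eq_coe hb
  have hex : ∃ m, ∃ c ∈ core G v w, ∃ p : G.Walk c u, p.length = m :=
    ⟨_, v, start_mem_core hvw, pv, rfl⟩
  obtain ⟨c, hc, p, hp⟩ := Nat.find_spec hex
  have hmin : ∀ c' ∈ core G v w, ∀ q : G.Walk c' u, p.length ≤ q.length := fun c' hc' q => by
    rw [hp]; exact Nat.find_min' hex ⟨c', hc', q, rfl⟩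
  have hcore := edist_add_edist_of_mem_core hvw hc
  have h1 := hmin v (start_mem_core hvw) pv
  have h2 := hmin w (end_mem_core hvw) pw.reverse
  rw [Walk.length_reverse] at h2
  rw [hk] at hcore
  have hcv : G.edist v c ≤ k := le_self_add.trans hcore
  have hcw : G.edist c w ≤ k := le_add_self.trans hcore
  obtain ⟨x, hx, hxk⟩ := exists_nat_of_edist_le hcv
  obtain ⟨y, hy, hyk⟩ := exists_nat_of_edist_le hcw
  refine ⟨c, p, ⟨hc, toSubgraph_le_ball p ?_, fun c' hc' q _ => hmin c' hc' q⟩,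
    ⟨hc, toSubgraph_le_ball p ?_, fun c' hc' q _ => hmin c' hc' q⟩⟩
  -- Here `x ≤ k` because `c` is in the core, and `p.length ≤ b` because `w` is in the core too; so
  -- the closed walk has length at most `a + b + k`.
  · rw [hx, edist_comm (u := u), ha]
    exact_mod_cast (by omega : x + p.length + a ≤ d)
  · rw [edist_comm (u := w), hy, hb]
    exact_mod_cast (by omega : y + p.length + b ≤ d)

/-- Adjacency on copies `(i, u)`, where `i` tells whether the copy lies in the ball around `v` or in
that around `w`. Only the copies of close vertices are linked. -/
def CopyRel (G : SimpleGraph V) (d : ℕ) (v w : V) (p q : Bool × V) : Prop :=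
  (p.2 ≠ v ∧ p.2 ≠ w ∧ q.2 ≠ v ∧ q.2 ≠ w) ∧
    ((p.1 = q.1 ∧ (ball G d (cond p.1 w v)).Adj p.2 q.2) ∨
      (p.1 ≠ q.1 ∧ p.2 = q.2 ∧ Close G d v w p.2))

theorem CopyRel.symm {v w : V} {p q : Bool × V} (h : CopyRel G d v w p q) :
    CopyRel G d v w q p := by
  obtain ⟨⟨h1, h2, h3, h4⟩, h | h⟩ := h
  · exact ⟨⟨h3, h4, h1, h2⟩, Or.inl ⟨h.1.symm, h.1 ▸ h.2.symm⟩⟩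
  · exact ⟨⟨h3, h4, h1, h2⟩, Or.inr ⟨h.1.symm, h.2.1.symm, h.2.1 ▸ h.2.2⟩⟩

theorem copyRel_rtg_symm {v w : V} {p q : Bool × V}
    (h : ReflTransGen (CopyRel G d v w) p q) : ReflTransGen (CopyRel G d v w) q p := by
  induction h with
  | refl => exact .refl
  | tail _ h ih => exact .head h.symm ih

theorem CopyRel.swap {v w : V} {p q : Bool × V} (h : CopyRel G d v w p q) :
    CopyRel G d w v (!p.1, p.2) (!q.1, q.2) := by
  obtain ⟨⟨h1, h2, h3, h4⟩, h | h⟩ := h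
  · refine ⟨⟨h2, h1, h4, h3⟩, Or.inl ⟨congrArg not h.1, ?_⟩⟩
    rcases p with ⟨_ | _, p⟩ <;> exact h.2
  · refine ⟨⟨h2, h1, h4, h3⟩, Or.inr ⟨fun e => h.1 (by simpa using e), h.2.1, h.2.2.swap⟩⟩

theorem copyRel_rtg_swap {v w : V} {i j : Bool} {x y : V}
    (h : ReflTransGen (CopyRel G d v w) (i, x) (j, y)) :
    ReflTransGen (CopyRel G d w v) (!i, x) (!j, y) :=
  h.lift (fun p : Bool × V => (!p.1, p.2)) (fun _ _ => CopyRel.swap)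

theorem copyRel_rtg_of_walk {v w a b : V} (i : Bool) (p : G.Walk a b)
    (hp : ∀ x y, s(x, y) ∈ p.edges → (ball G d (cond i w v)).Adj x y)
    (hv : v ∉ p.support) (hw : w ∉ p.support) :
    ReflTransGen (CopyRel G d v w) (i, a) (i, b) := by
  induction p with
  | nil => exact .refl
  | @cons x y z h p ih =>
    simp only [Walk.support_cons, List.mem_cons, not_or] at hv hw
    refine ReflTransGen.head (b := (i, y)) ⟨⟨Ne.symm hv.1, Ne.symm hw.1, ?_, ?_⟩, Or.inl ⟨rfl, ?_⟩⟩
      (ih (fun a b hab => hp a b (by simp [hab])) hv.2 hw.2)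
    · rintro rfl; exact hv.2 p.start_mem_support
    · rintro rfl; exact hw.2 p.start_mem_support
    · exact hp x y (by simp)

/-- The common path runs in both balls. After its start it avoids the core, hence `v` and `w`, so it
suffices that one of its vertices outside `{v, w}` is close: then one copy of `u` goes back to that
vertex, over the link, and forward to the other copy of `u`. -/
theorem CommonLabel.rtg {v w u : V} (hr : G.Reachable v w) (hd : 2 * G.edist v w ≤ d)
    (hu : CommonLabel G d v w u) (huv : u ≠ v) (huw : u ≠ w) :
    ReflTransGen (CopyRel G d v w) (false, u) (true, u) := by
  classical
  obtain ⟨c, p, ⟨hc, hpv, hmin⟩, ⟨-, hpw, -⟩⟩ := hu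
  have hv := start_mem_core hr
  have hw := end_mem_core hr
  have hev : ∀ x y, s(x, y) ∈ p.edges → (ball G d v).Adj x y := fun x y h =>
    hpv.2 (Walk.adj_toSubgraph_iff_mem_edges.2 h)
  have hew : ∀ x y, s(x, y) ∈ p.edges → (ball G d w).Adj x y := fun x y h =>
    hpw.2 (Walk.adj_toSubgraph_iff_mem_edges.2 h)
  -- Reduces the claim to finding a close vertex `x` from which a tail of the path avoids `v` and
  -- `w`.
  have finish : ∀ (x : V) (q : G.Walk x u), q.edges ⊆ p.edges → v ∉ q.support → w ∉ q.support →
      Close G d v w x → ReflTransGen (CopyRel G d v w) (false, u) (true, u) := by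
    intro x q hq hvq hwq hx
    have h1 := copyRel_rtg_of_walk (d := d) (v := v) (w := w) false q
      (fun a b hab => hev a b (hq hab)) hvq hwq
    have h2 := copyRel_rtg_of_walk (d := d) (v := v) (w := w) true q
      (fun a b hab => hew a b (hq hab)) hvq hwq
    refine (copyRel_rtg_symm h1).trans (ReflTransGen.head ?_ h2)
    have hxv : x ≠ v := by rintro rfl; exact hvq q.start_mem_support
    have hxw : x ≠ w := by rintro rfl; exact hwq q.start_mem_support
    exact ⟨⟨hxv, hxw, hxv, hxw⟩, Or.inr ⟨by simp, rfl, hx⟩⟩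
  cases p with
  | nil =>
    refine finish u .nil (fun _ h => h) (by simpa using huv.symm) (by simpa using huw.symm) ?_
    exact (add_le_add_left (edist_add_edist_of_mem_core hr hc) _).trans (two_mul (G.edist v w) ▸ hd)
  | @cons _ x _ h p =>
    -- A later vertex in the core would give a shorter path from the core to `u`.
    have hcore : ∀ y ∈ core G v w, y ∉ p.support := by
      intro y hy hyp
      have h1 := hmin y hy (p.dropUntil y hyp) (by
        refine le_trans ?_ hpv
        constructor
        · intro z hz
          simp only [Walk.mem_verts_toSubgraph] at hz ⊢
          exact List.mem_cons_of_mem _ (p.support_dropUntil_subset_support hyp hz)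
        · intro a b hab
          rw [Walk.adj_toSubgraph_iff_mem_edges] at hab ⊢
          exact List.mem_cons_of_mem _ (p.edges_dropUntil_subset_edges hyp hab))
      have h2 := p.length_dropUntil_le_length hyp
      rw [Walk.length_cons] at h1
      omega
    have hsub : p.edges ⊆ (Walk.cons h p).edges := List.subset_cons_self _ _
    have hcx : G.edist c x = 1 := edist_eq_one_iff_adj.2 h
    -- If the path starts at `v`, its second vertex is close, because the first edge belongs to the
    -- ball around `w`; likewise with `v` and `w` exchanged. Any other core vertex is close itself,
    -- as twice the distance of `v` and `w` is at most `d`.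
    by_cases hcv : c = v
    · subst hcv
      refine finish x p hsub (hcore _ hv) (hcore _ hw) ?_
      have := (ball_adj_iff.1 (hew c x (by simp))).2
      rw [Close, hcx, edist_comm (u := x), edist_comm (u := c) (v := w)]
      refine le_trans (le_of_eq ?_) this
      ring
    by_cases hcw : c = w
    · subst hcw
      refine finish x p hsub (hcore _ hv) (hcore _ hw) ?_
      have := (ball_adj_iff.1 (hev c x (by simp))).2
      rw [Close, edist_comm (u := x), hcx]
      refine le_trans (le_of_eq ?_) this
      ring
    refine finish c (Walk.cons h p) (fun _ h => h) ?_ ?_ ?_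
    · simpa [Ne.symm hcv] using hcore _ hv
    · simpa [Ne.symm hcw] using hcore _ hw
    · exact (add_le_add_left (edist_add_edist_of_mem_core hr hc) _).trans
        (two_mul (G.edist v w) ▸ hd)

/-- The side and the original of a copy. -/
def Copies.code {v w : V} : Copies G d v w → Bool × V :=
  Sum.elim (fun x => (false, x.1)) (fun x => (true, x.1))

theorem Copies.code_snd {v w : V} (x : Copies G d v w) : x.code.2 = x.orig := by
  cases x <;> rfl

theorem Copies.code_injective {v w : V} : Function.Injective (Copies.code (G := G) (d := d) (v := v)
    (w := w)) := by
  rintro (⟨x, hx⟩ | ⟨x, hx⟩) (⟨y, hy⟩ | ⟨y, hy⟩) h <;> simp [Copies.code] at h <;> subst h <;> rfl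

theorem Copies.exists_code {v w : V} {i : Bool} {u : V} (h : u ∈ (ball G d (cond i w v)).verts) :
    ∃ x : Copies G d v w, x.code = (i, u) := by
  cases i
  · exact ⟨Sum.inl ⟨u, h⟩, rfl⟩
  · exact ⟨Sum.inr ⟨u, h⟩, rfl⟩

theorem Copies.mem_ball {v w : V} (x : Copies G d v w) :
    x.code.2 ∈ (ball G d (cond x.code.1 w v)).verts := by
  cases x with
  | inl x => exact x.2
  | inr x => exact x.2

theorem rtg_of_setoid {v w : V} (hr : G.Reachable v w) (hd : 2 * G.edist v w ≤ d)
    {x y : Copies G d v w} (h : (copySetoid G d v w) x y) (hv : x.orig ≠ v) (hw : x.orig ≠ w) :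
    ReflTransGen (CopyRel G d v w) x.code y.code := by
  obtain ⟨ho, rfl | hc⟩ := h
  · exact .refl
  · have hx := hc.rtg hr hd hv hw
    have hx' := copyRel_rtg_symm hx
    rcases x with ⟨x, hx1⟩ | ⟨x, hx1⟩ <;> rcases y with ⟨y, hy1⟩ | ⟨y, hy1⟩ <;>
      simp only [Copies.orig, Sum.elim_inl, Sum.elim_inr] at ho <;> subst ho
    · exact .refl
    · exact hx
    · exact hx'
    · exact .refl

/-- An edge of the quotient comes with its own representatives, so each step first passes between
identified copies and then along an edge of one ball. -/
theorem rtg_of_reachable {v w : V} (hr : G.Reachable v w) (hd : 2 * G.edist v w ≤ d)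
    {a b : puncturedVerts G d v w} (h : (punctured G d v w).Reachable a b) :
    ∀ x y : Copies G d v w, Quotient.mk _ x = a.1 → Quotient.mk _ y = b.1 →
      ReflTransGen (CopyRel G d v w) x.code y.code := by
  obtain ⟨p⟩ := h
  induction p with
  | @nil a =>
    intro x y hx hy
    have ha := a.2
    rw [← hx] at ha
    exact rtg_of_setoid hr hd (Quotient.exact (hx.trans hy.symm)) ha.1 ha.2
  | @cons a b c h p ih =>
    intro x y hx hy
    obtain ⟨x', y', hx', hy', hadj⟩ := (h : (explorer G d v w).Adj a.1 b.1)
    replace hx' : Quotient.mk _ x' = a.1 := hx'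
    replace hy' : Quotient.mk _ y' = b.1 := hy'
    have ha := a.2
    rw [← hx] at ha
    have ha' := a.2
    rw [← hx'] at ha'
    have hb := b.2
    rw [← hy'] at hb
    have h1 := rtg_of_setoid hr hd (Quotient.exact (hx.trans hx'.symm)) ha.1 ha.2
    refine h1.trans (ReflTransGen.head ?_ (ih y' y hy' hy))
    rcases x' with x' | x' <;> rcases y' with y' | y'
    · exact ⟨⟨ha'.1, ha'.2, hb.1, hb.2⟩, Or.inl ⟨rfl, hadj⟩⟩
    · exact hadj.elim
    · exact hadj.elim
    · exact ⟨⟨ha'.1, ha'.2, hb.1, hb.2⟩, Or.inl ⟨rfl, hadj⟩⟩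

theorem reachable_of_rtg {v w : V} {x : Copies G d v w}
    (hx : Quotient.mk _ x ∈ puncturedVerts G d v w) {q : Bool × V}
    (h : ReflTransGen (CopyRel G d v w) x.code q) :
    ∃ (y : Copies G d v w) (hy : Quotient.mk _ y ∈ puncturedVerts G d v w), y.code = q ∧
      (punctured G d v w).Reachable ⟨_, hx⟩ ⟨_, hy⟩ := by
  induction h with
  | refl => exact ⟨x, hx, rfl, .refl _⟩
  | @tail p q _ h ih =>
    obtain ⟨y, hy, rfl, hxy⟩ := ih
    obtain ⟨⟨-, -, h3, h4⟩, h | h⟩ := h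
    · have hz : q.2 ∈ (ball G d (cond q.1 w v)).verts := h.1 ▸ (ball G d _).edge_vert h.2.symm
      obtain ⟨z, hzq⟩ := Copies.exists_code hz
      have hz' : z.orig = q.2 := by rw [← Copies.code_snd, hzq]
      have hzp : Quotient.mk _ z ∈ puncturedVerts G d v w :=
        ⟨fun e => h3 (hz'.symm.trans e), fun e => h4 (hz'.symm.trans e)⟩
      refine ⟨z, hzp, hzq, hxy.trans (Adj.reachable ?_)⟩
      refine (show (explorer G d v w).Adj _ _ from ⟨y, z, rfl, rfl, ?_⟩)
      have hzq' : z.code = q := hzq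
      subst hzq'
      rcases y with y | y <;> rcases z with z | z
      · exact h.2
      · exact absurd h.1 (by simp [Copies.code])
      · exact absurd h.1 (by simp [Copies.code])
      · exact h.2
    · have hz : q.2 ∈ (ball G d (cond q.1 w v)).verts := by
        rw [← h.2.1]
        cases q.1
        · exact h.2.2.mem_ball_left
        · exact h.2.2.mem_ball_right
      obtain ⟨z, hzq⟩ := Copies.exists_code hz
      have hz' : z.orig = q.2 := by rw [← Copies.code_snd, hzq]
      have hzp : Quotient.mk _ z ∈ puncturedVerts G d v w :=
        ⟨fun e => h3 (hz'.symm.trans e), fun e => h4 (hz'.symm.trans e)⟩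
      refine ⟨z, hzp, hzq, ?_⟩
      have : (⟨_, hy⟩ : puncturedVerts G d v w) = ⟨_, hzp⟩ := by
        refine Subtype.ext (Quotient.sound ?_)
        have ho : y.orig = z.orig := by rw [hz', ← h.2.1, Copies.code_snd]
        exact ⟨ho, Or.inr (by rw [← Copies.code_snd]; exact h.2.2.commonLabel)⟩
      rw [← this]
      exact hxy

/-- Replaces identification along common paths, which would require comparing paths, by links at
close vertices, which three distances decide. -/
theorem punctured_reachable_iff {v w : V} (hr : G.Reachable v w) (hd : 2 * G.edist v w ≤ d)
    {x y : Copies G d v w} (hx : Quotient.mk _ x ∈ puncturedVerts G d v w)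
    (hy : Quotient.mk _ y ∈ puncturedVerts G d v w) :
    (punctured G d v w).Reachable ⟨_, hx⟩ ⟨_, hy⟩ ↔
      ReflTransGen (CopyRel G d v w) x.code y.code := by
  refine ⟨fun h => rtg_of_reachable hr hd h x y rfl rfl, fun h => ?_⟩
  obtain ⟨z, hz, hzy, h'⟩ := reachable_of_rtg hx h
  obtain rfl := Copies.code_injective hzy
  exact h'

/-- `(i, u)` is a copy of a vertex other than `v` and `w`. -/
def IsCopy (G : SimpleGraph V) (d : ℕ) (v w : V) (p : Bool × V) : Prop :=
  p.2 ∈ (ball G d (cond p.1 w v)).verts ∧ p.2 ≠ v ∧ p.2 ≠ w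

theorem IsCopy.exists_copy {v w : V} {p : Bool × V} (h : IsCopy G d v w p) :
    ∃ x : Copies G d v w, x.code = p ∧ Quotient.mk _ x ∈ puncturedVerts G d v w := by
  obtain ⟨x, hx⟩ := Copies.exists_code h.1
  have hx' : x.orig = p.2 := by rw [← Copies.code_snd, hx]
  exact ⟨x, hx, fun e => h.2.1 (hx'.symm.trans e), fun e => h.2.2 (hx'.symm.trans e)⟩

theorem isCopy_of_mem {v w : V} {x : Copies G d v w}
    (hx : Quotient.mk _ x ∈ puncturedVerts G d v w) : IsCopy G d v w x.code :=
  ⟨x.mem_ball, by rw [Copies.code_snd]; exact hx.1, by rw [Copies.code_snd]; exact hx.2⟩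

/-- `dist` is 0 between vertices in different components, hence the extra reachability; `edist` is
infinite there and needs none. -/
theorem two_mul_dist_le_iff {v w : V} :
    G.Reachable v w ∧ 2 * G.dist v w ≤ d ↔ 2 * G.edist v w ≤ d := by
  constructor
  · rintro ⟨h, h'⟩
    rw [← h.coe_dist_eq_edist]
    exact_mod_cast h'
  · intro h
    have h0 : G.edist v w ≤ d := le_trans (by rw [two_mul]; exact le_self_add) h
    have hr : G.Reachable v w :=
      reachable_of_edist_ne_top (ne_top_of_le_ne_top (ENat.natCast_ne_top d) h0)
    rw [← hr.coe_dist_eq_edist] at h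
    exact ⟨hr, by exact_mod_cast h⟩

theorem isLocalSeparator_iff {v w : V} :
    IsLocalSeparator G d v w ↔ v ≠ w ∧ 2 * G.edist v w ≤ d ∧
      ∃ p q, IsCopy G d v w p ∧ IsCopy G d v w q ∧ ¬ ReflTransGen (CopyRel G d v w) p q := by
  rw [IsLocalSeparator, ← and_assoc (a := G.Reachable v w), two_mul_dist_le_iff]
  refine and_congr_right fun _ => and_congr_right fun hd => ?_
  have hr := (two_mul_dist_le_iff.2 hd).1
  constructor
  · intro h
    simp only [Preconnected, not_forall] at h
    obtain ⟨⟨a, ha⟩, ⟨b, hb⟩, h⟩ := h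
    induction a using Quotient.inductionOn with | _ x
    induction b using Quotient.inductionOn with | _ y
    exact ⟨_, _, isCopy_of_mem ha, isCopy_of_mem hb,
      fun h' => h ((punctured_reachable_iff hr hd ha hb).2 h')⟩
  · rintro ⟨p, q, hp, hq, h⟩ hc
    obtain ⟨x, rfl, hx⟩ := hp.exists_copy
    obtain ⟨y, rfl, hy⟩ := hq.exists_copy
    exact h ((punctured_reachable_iff hr hd hx hy).1 (hc _ _))

theorem IsLocalSeparator.swap {v w : V} (h : IsLocalSeparator G d v w) :
    IsLocalSeparator G d w v := by
  rw [isLocalSeparator_iff] at *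
  obtain ⟨h1, h2, ⟨i, x⟩, ⟨j, y⟩, hp, hq, h⟩ := h
  refine ⟨h1.symm, edist_comm (G := G) (u := v) ▸ h2, (!i, x), (!j, y), ?_, ?_, fun h' => h ?_⟩
  · exact ⟨by cases i <;> exact hp.1, hp.2.2, hp.2.1⟩
  · exact ⟨by cases j <;> exact hq.1, hq.2.2, hq.2.1⟩
  · simpa using copyRel_rtg_swap h'

theorem Close.rtg {v w u : V} (h : Close G d v w u) (hv : u ≠ v) (hw : u ≠ w) (i j : Bool) :
    ReflTransGen (CopyRel G d v w) (i, u) (j, u) := by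
  by_cases hij : i = j
  · subst hij; exact .refl
  · exact .single ⟨⟨hv, hw, hv, hw⟩, Or.inr ⟨hij, rfl, h⟩⟩

/-- The two copies of a close vertex are linked, so it makes no difference which copies are
compared, and the left ones are chosen. -/
theorem locallySeparates_iff {v w x y : V} (hr : G.Reachable v w) (hd : 2 * G.edist v w ≤ d)
    (hx : Close G d v w x) (hxv : x ≠ v) (hxw : x ≠ w)
    (hy : Close G d v w y) (hyv : y ≠ v) (hyw : y ≠ w) :
    LocallySeparates G d v w x y ↔ ¬ ReflTransGen (CopyRel G d v w) (false, x) (false, y) := by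
  constructor
  · intro h h'
    obtain ⟨a, ha, ham⟩ := IsCopy.exists_copy (p := (false, x)) ⟨hx.mem_ball_left, hxv, hxw⟩
    obtain ⟨b, hb, hbm⟩ := IsCopy.exists_copy (p := (false, y)) ⟨hy.mem_ball_left, hyv, hyw⟩
    refine h ⟨_, ham⟩ ⟨_, hbm⟩ ?_ ?_ ((punctured_reachable_iff hr hd ham hbm).2 (ha ▸ hb ▸ h'))
    · exact (Copies.code_snd a).symm.trans (by rw [ha])
    · exact (Copies.code_snd b).symm.trans (by rw [hb])
  · rintro h ⟨a, ha⟩ ⟨b, hb⟩ hax hby hab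
    induction a using Quotient.inductionOn with | _ a
    induction b using Quotient.inductionOn with | _ b
    have h' := (punctured_reachable_iff hr hd ha hb).1 hab
    have hax' : a.code.2 = x := (Copies.code_snd a).trans hax
    have hby' : b.code.2 = y := (Copies.code_snd b).trans hby
    rw [show a.code = (a.code.1, x) from Prod.ext rfl hax',
      show b.code = (b.code.1, y) from Prod.ext rfl hby'] at h'
    exact h (((hx.rtg hxv hxw _ _).trans h').trans (hy.rtg hyv hyw _ _))

end Structure

end LocalSep

namespace LocalSep

open SimpleGraph Relation

/-! ### Crossing pairs lie on two paths of a search tree -/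

section Crossing

variable {V : Type*} {G : SimpleGraph V} {d : ℕ}

theorem AlternatingCycle.flip {x₀ x₁ y₀ y₁ : V} (h : AlternatingCycle G d x₀ x₁ y₀ y₁) :
    AlternatingCycle G d x₀ x₁ y₁ y₀ := by
  obtain ⟨p, q, hc, hl, hx, h1, h2, h3, h4, h5, h6⟩ := h
  refine ⟨q.reverse, p.reverse, ?_, ?_, hx, by simpa using h4, h5, h6, by simpa using h1, h2, h3⟩
  · rw [← Walk.reverse_append]
    exact hc.reverse
  · rwa [← Walk.reverse_append, Walk.length_reverse]

/-- Rotate the cycle to start at `y₀`; this permutes its lists of edges and vertices cyclically. -/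
theorem AlternatingCycle.symm {x₀ x₁ y₀ y₁ : V} (h : AlternatingCycle G d x₀ x₁ y₀ y₁) :
    AlternatingCycle G d y₀ y₁ x₀ x₁ := by
  classical
  obtain ⟨p, q, hc, hl, hx, h1, h2, h3, h4, h5, h6⟩ := h
  -- The two arcs of a cycle share no inner vertices.
  have hy : y₀ ≠ y₁ := by
    rintro rfl
    have hn := hc.support_nodup
    rw [Walk.tail_support_append] at hn
    refine (List.disjoint_of_nodup_append hn) (a := y₀) ?_ ?_
    · rw [Walk.mem_support_iff] at h1
      exact h1.resolve_left h2
    · rw [Walk.mem_support_iff] at h4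
      exact h4.resolve_left h6
  obtain ⟨p₁, p₂, rfl⟩ := Walk.mem_support_iff_exists_append.1 h1
  obtain ⟨q₁, q₂, rfl⟩ := Walk.mem_support_iff_exists_append.1 h4
  have hcyc : ((p₂.append q₁).append (q₂.append p₁)).IsCycle := by
    rw [Walk.isCycle_def, Walk.isTrail_def] at hc ⊢
    obtain ⟨ht, hn, hs⟩ := hc
    have perm : ∀ {α : Type _} (a b c e : List α),
        (((a ++ b) ++ (c ++ e)) : List α).Perm ((b ++ c) ++ (e ++ a)) := by
      intro α a b c e
      rw [List.append_assoc, ← List.append_assoc (b ++ c) e a, List.append_assoc b c e]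
      exact List.perm_append_comm
    refine ⟨?_, ?_, ?_⟩
    · simp only [Walk.edges_append] at ht ⊢
      exact ((perm _ _ _ _).nodup_iff).1 ht
    · intro h0
      have := congrArg Walk.length h0
      simp only [Walk.length_append, Walk.length_nil] at this
      apply h2
      exact (Walk.eq_of_length_eq_zero (p := p₁) (by omega)).symm
    · simp only [Walk.tail_support_append] at hs ⊢
      exact ((perm _ _ _ _).nodup_iff).1 hs
  -- The rotated cycle meets `x₁` first; reversing it puts `x₀` on the arc from `y₀` to `y₁`.
  refine ⟨(q₂.append p₁).reverse, (p₂.append q₁).reverse, ?_, ?_, hy, ?_, h2.symm, h5.symm, ?_,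
    h3.symm, h6.symm⟩
  · rw [← Walk.reverse_append]
    exact hcyc.reverse
  · simp only [Walk.length_append, Walk.length_reverse] at hl ⊢
    omega
  · simp
  · simp

/-- The arc through `y₀` bounds the two distances from `y₀`, and the other arc bounds the distance
of `x₀` and `x₁`. -/
theorem AlternatingCycle.close {x₀ x₁ y₀ y₁ : V} (h : AlternatingCycle G d x₀ x₁ y₀ y₁) :
    Close G d x₀ x₁ y₀ := by
  obtain ⟨p, q, -, hl, -, h1, -⟩ := h
  rw [Walk.length_append] at hl
  have h := edist_add_edist_le_length p h1
  have h' : G.edist x₀ x₁ ≤ q.length := by rw [edist_comm]; exact edist_le q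
  exact (add_le_add h h').trans (by exact_mod_cast hl)

/-- Internally disjoint paths with common ends form a cycle unless both consist of the same single
edge, which `ha` excludes. -/
theorem isCycle_append_reverse {v w : V} {p q : G.Walk v w} (hp : p.IsPath) (hq : q.IsPath)
    (hd : ∀ x ∈ p.support, x ∈ q.support → x = v ∨ x = w) (hvw : v ≠ w) (ha : ¬ G.Adj v w) :
    (p.append q.reverse).IsCycle := by
  cases p with
  | nil => exact absurd rfl hvw
  | @cons _ x _ h p =>
    rw [Walk.cons_isPath_iff] at hp
    have hqr := hq.reverse
    rw [Walk.isPath_def, ← Walk.cons_tail_support, List.nodup_cons] at hqr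
    rw [Walk.cons_append, Walk.cons_isCycle_iff]
    constructor
    · rw [Walk.isPath_def, Walk.support_append, List.nodup_append]
      refine ⟨hp.1.support_nodup, hqr.2, ?_⟩
      rintro a ha b hb rfl
      have haq : a ∈ q.support := by
        have := List.mem_of_mem_tail hb
        simpa using this
      rcases hd a (by simp [ha]) haq with rfl | rfl
      · exact hp.2 (by assumption)
      · exact hqr.1 hb
    · rw [Walk.edges_append, List.mem_append]
      rintro (he | he)
      · exact hp.2 (p.fst_mem_support_of_mem_edges he)
      · rw [Walk.edges_reverse, List.mem_reverse] at he
        rcases hd x (by simp) (q.snd_mem_support_of_mem_edges he) with rfl | rfl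
        · exact h.ne rfl
        · exact ha h

/-- Distances (plus one) from `v` in the ball around `v` without `w`, and predecessors. -/
structure IsTree (G : SimpleGraph V) (d : ℕ) (v w : V) (val : V → ℕ) (par : V → V) : Prop where
  src : val v = 1
  par : ∀ x, x ≠ v → x ≠ w → val x ≠ 0 →
    par x ≠ w ∧ val (par x) ≠ 0 ∧ (ball G d v).Adj (par x) x ∧ val x = val (par x) + 1
  closed : ∀ u x, u ≠ w → x ≠ w → val u ≠ 0 → (ball G d v).Adj u x →
    val x ≠ 0 ∧ val x ≤ val u + 1

variable {v w : V} {val : V → ℕ} {par : V → V}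

theorem IsTree.eq_of_val_le (ht : IsTree G d v w val par) {a : V} (haw : a ≠ w) (h : val a = 1) :
    a = v := by
  by_contra hav
  obtain ⟨-, h2, -, h3⟩ := ht.par a hav haw (by omega)
  omega

/-- Follow the predecessors back to `v`. The values drop by one at each step, so no vertex repeats
and there are exactly `k` edges. -/
theorem IsTree.exists_walk (ht : IsTree G d v w val par) (k : ℕ) (a : V) (haw : a ≠ w)
    (ha : val a = k + 1) :
    ∃ r : G.Walk v a, r.length = k ∧ r.IsPath ∧ w ∉ r.support ∧
      (∀ x ∈ r.support, val x ≤ k + 1) ∧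
      (∀ x ∈ r.support, x = v ∨ ∃ i < k, par^[i] a = x) ∧ (∀ i < k, par^[i] a ∈ r.support) := by
  induction k generalizing a with
  | zero =>
    obtain rfl := ht.eq_of_val_le haw ha
    exact ⟨.nil, rfl, .nil, by simpa using haw.symm, by simp [ha], by simp, by simp⟩
  | succ k ih =>
    have hav : a ≠ v := by
      rintro rfl
      rw [ht.src] at ha
      omega
    obtain ⟨h1, h2, h3, h4⟩ := ht.par a hav haw (by omega)
    obtain ⟨r, hr1, hr2, hr3, hr4, hr5, hr6⟩ := ih (par a) h1 (by omega)
    have har : a ∉ r.support := fun h => by have := hr4 a h; omega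
    refine ⟨r.concat ((ball G d v).adj_sub h3), by simp [hr1], hr2.concat har _, ?_, ?_, ?_, ?_⟩
    · simp [Walk.support_concat, hr3, haw.symm]
    · intro x hx
      rw [Walk.support_concat, List.mem_append] at hx
      rcases hx with hx | hx
      · have := hr4 x hx; omega
      · rw [List.mem_singleton] at hx; subst hx; omega
    · intro x hx
      rw [Walk.support_concat, List.mem_append] at hx
      rcases hx with hx | hx
      · rcases hr5 x hx with h | ⟨i, hi, rfl⟩
        · exact Or.inl h
        · exact Or.inr ⟨i + 1, by omega, rfl⟩
      · rw [List.mem_singleton] at hx; subst hx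
        exact Or.inr ⟨0, by omega, rfl⟩
    · intro i hi
      rw [Walk.support_concat, List.mem_append]
      cases i with
      | zero => right; simp
      | succ i => left; exact hr6 i (by omega)

/-- A tree path without its root avoids both `v` and `w`, so it stays in one component. -/
theorem IsTree.chain (ht : IsTree G d v w val par) {k : ℕ} {a : V} (haw : a ≠ w)
    (ha : val a = k + 1) (i : ℕ) (hi : i < k) :
    par^[i] a ≠ v ∧ par^[i] a ≠ w ∧ val (par^[i] a) = k + 1 - i ∧
      ReflTransGen (CopyRel G d v w) (false, par^[i] a) (false, a) := by
  induction i with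
  | zero =>
    refine ⟨?_, haw, ha, .refl⟩
    rintro rfl
    have := ht.src
    simp only [Function.iterate_zero, id_eq] at this
    omega
  | succ i ih =>
    obtain ⟨h1, h2, h3, h4⟩ := ih (by omega)
    obtain ⟨h5, h6, h7, h8⟩ := ht.par _ h1 h2 (by omega)
    rw [Function.iterate_succ_apply']
    have hv : par (par^[i] a) ≠ v := by
      intro h
      rw [h, ht.src] at h8
      omega
    exact ⟨hv, h5, by omega, .head (b := (false, par^[i] a)) ⟨⟨hv, h5, h1, h2⟩, Or.inl ⟨rfl, h7⟩⟩ h4⟩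

theorem IsTree.val_le_of_walk (ht : IsTree G d v w val par) {u a : V} (r : G.Walk u a)
    (hw : w ∉ r.support) (hb : ∀ x y, s(x, y) ∈ r.edges → (ball G d v).Adj x y)
    (hu : val u ≠ 0) : val a ≠ 0 ∧ val a ≤ val u + r.length := by
  induction r with
  | nil => simp [hu]
  | @cons x y z h r ih =>
    simp only [Walk.support_cons, List.mem_cons, not_or] at hw
    obtain ⟨h1, h2⟩ := ht.closed x y (Ne.symm hw.1)
      (by rintro rfl; exact hw.2 r.start_mem_support) hu (hb x y (by simp))
    have := ih hw.2 (fun a b hab => hb a b (by simp [hab])) h1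
    rw [Walk.length_cons]
    omega

/-- Take for `a` the last vertex before `w`. The arc reaches it after `p.length - 1` edges and
values start at 1 in `v`, whence the bound; the piece from `y` to `a` stays in one component. -/
theorem IsTree.exists_of_arc (ht : IsTree G d v w val par) {p : G.Walk v w} (hp : p.IsPath)
    (hb : ∀ x y, s(x, y) ∈ p.edges → (ball G d v).Adj x y) {y : V} (hy : y ∈ p.support)
    (hyv : y ≠ v) (hyw : y ≠ w) :
    ∃ a, (ball G d v).Adj w a ∧ val a ≠ 0 ∧ val a ≤ p.length ∧ a ≠ v ∧
      ReflTransGen (CopyRel G d v w) (false, y) (false, a) := by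
  classical
  obtain ⟨a, q, h, rfl⟩ : ∃ (a : V) (q : G.Walk v a) (h : G.Adj a w), p = q.concat h := by
    cases p with
    | nil => simp at hy; exact absurd hy hyv
    | cons h p =>
      obtain ⟨a, q, h', e⟩ := Walk.exists_cons_eq_concat h p
      exact ⟨a, q, h', e⟩
  rw [Walk.isPath_def, Walk.support_concat, List.nodup_append] at hp
  obtain ⟨hq, -, hwq⟩ := hp
  have hwq : w ∉ q.support := fun hw => hwq w hw w (by simp) rfl
  have hyq : y ∈ q.support := by
    rw [Walk.support_concat, List.mem_append, List.mem_singleton] at hy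
    exact hy.resolve_right hyw
  have hbq : ∀ x y, s(x, y) ∈ q.edges → (ball G d v).Adj x y := fun x y hxy =>
    hb x y (by rw [Walk.edges_concat, List.concat_eq_append]; exact List.mem_append_left _ hxy)
  obtain ⟨q₁, q₂, rfl⟩ := Walk.mem_support_iff_exists_append.1 hyq
  have hvq : v ∉ q₂.support := by
    rw [Walk.support_append, List.nodup_append] at hq
    intro hv
    rw [Walk.mem_support_iff] at hv
    exact hq.2.2 v q₁.start_mem_support v (hv.resolve_left hyv.symm) rfl
  obtain ⟨h1, h2⟩ := ht.val_le_of_walk _ hwq hbq (by rw [ht.src]; omega)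
  rw [ht.src] at h2
  refine ⟨a, (hb a w (by simp [Walk.edges_concat])).symm, h1, ?_, ?_, ?_⟩
  · rw [Walk.length_concat]; omega
  · rintro rfl; exact hvq q₂.end_mem_support
  · refine copyRel_rtg_of_walk false q₂ (fun x y hxy => hbq x y ?_) hvq ?_
    · rw [Walk.edges_append]; exact List.mem_append_right _ hxy
    · intro h; exact hwq (by rw [Walk.mem_support_append_iff]; exact Or.inr h)

/-- The neighbour `a` of `w` minimizes `val` among those with label other than `L`, if a value of
at most `d` is attained, and the minimum is `m`. -/
def IsBest (G : SimpleGraph V) (d : ℕ) (v w : V) (val lab : V → ℕ) (L m : ℕ) (a : V) : Prop :=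
  m ≤ d + 1 ∧ (m ≤ d → (ball G d v).Adj w a ∧ val a = m ∧ m ≠ 0 ∧ lab a ≠ L) ∧
    ∀ x, (ball G d v).Adj w x → val x ≠ 0 → lab x ≠ L → m ≤ val x

/-- The labels tell the components of the copies in the ball around `v`. -/
def IsLabel (G : SimpleGraph V) (d : ℕ) (v w : V) (lab : V → ℕ) : Prop :=
  (∀ a ∈ (ball G d v).verts, a ≠ v → a ≠ w → lab a ≠ 0) ∧
  ∀ a ∈ (ball G d v).verts, a ≠ v → a ≠ w → ∀ b ∈ (ball G d v).verts, b ≠ v → b ≠ w →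
    (lab a = lab b ↔ ReflTransGen (CopyRel G d v w) (false, a) (false, b))

theorem edges_ball_of_length_le {p q : G.Walk v w} (h : p.length + q.length ≤ d) {x y : V}
    (hxy : s(x, y) ∈ p.edges) : (ball G d v).Adj x y :=
  ⟨p.append q.reverse, by rw [Walk.length_append, Walk.length_reverse]; exact h,
    by rw [Walk.edges_append]; exact List.mem_append_left _ hxy⟩

variable {lab : V → ℕ} {a₀ a₁ : V} {m₀ m₁ : ℕ}

/-- Two vertices `par^[i] a₀` and `par^[j] a₁` on the tree paths to `a₀` and `a₁` form a separator
that separates `v` from `w`. -/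
def IsCrossedOnTree (G : SimpleGraph V) (d : ℕ) (v w : V) (par : V → V) (a₀ a₁ : V) (m₀ m₁ : ℕ) :
    Prop :=
  m₀ + m₁ ≤ d ∧ ∃ i < m₀ - 1, ∃ j < m₁ - 1, IsLocalSeparator G d (par^[i] a₀) (par^[j] a₁) ∧
    ¬ ReflTransGen (CopyRel G d (par^[i] a₀) (par^[j] a₁)) (false, v) (false, w)

/-- The two tree paths lie in different components apart from their root, so they meet only in `v`;
closing both through `w` gives a cycle of length `m₀ + m₁`. -/
theorem alternatingCycle_of_tree (hvw : v ≠ w) (hna : ¬ G.Adj v w) (ht : IsTree G d v w val par)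
    (hl : IsLabel G d v w lab) (h₀ : IsBest G d v w val lab 0 m₀ a₀)
    (h₁ : IsBest G d v w val lab (lab a₀) m₁ a₁) (hm : m₀ + m₁ ≤ d) {i j : ℕ} (hi : i < m₀ - 1)
    (hj : j < m₁ - 1) : AlternatingCycle G d v w (par^[i] a₀) (par^[j] a₁) ∧
      ¬ ReflTransGen (CopyRel G d v w) (false, par^[i] a₀) (false, par^[j] a₁) := by
  obtain ⟨hadj₀, hv₀, h0₀, -⟩ := h₀.2.1 (by omega)
  obtain ⟨hadj₁, hv₁, h0₁, hlab⟩ := h₁.2.1 (by omega)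
  have hG₀ := (ball G d v).adj_sub hadj₀
  have hG₁ := (ball G d v).adj_sub hadj₁
  obtain ⟨r₀, hr₀, hp₀, hw₀, -, hc₀, hm₀⟩ := ht.exists_walk (m₀ - 1) a₀ hG₀.ne' (by omega)
  obtain ⟨r₁, hr₁, hp₁, hw₁, -, hc₁, hm₁⟩ := ht.exists_walk (m₁ - 1) a₁ hG₁.ne' (by omega)
  have chain₀ := ht.chain (k := m₀ - 1) (a := a₀) hG₀.ne' (by omega)
  have chain₁ := ht.chain (k := m₁ - 1) (a := a₁) hG₁.ne' (by omega)
  have hav₀ : a₀ ≠ v := by rintro rfl; exact hna hG₀.symm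
  have hav₁ : a₁ ≠ v := by rintro rfl; exact hna hG₁.symm
  have hb₀ := (ball G d v).edge_vert hadj₀.symm
  have hb₁ := (ball G d v).edge_vert hadj₁.symm
  have hsepa : ¬ ReflTransGen (CopyRel G d v w) (false, a₁) (false, a₀) := fun h =>
    hlab ((hl.2 a₁ hb₁ hav₁ hG₁.ne' a₀ hb₀ hav₀ hG₀.ne').2 h)
  have hdis : ∀ i < m₀ - 1, ∀ j < m₁ - 1,
      ¬ ReflTransGen (CopyRel G d v w) (false, par^[i] a₀) (false, par^[j] a₁) :=
    fun i hi j hj h => hsepa <| (copyRel_rtg_symm (chain₁ j hj).2.2.2).trans <|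
      (copyRel_rtg_symm h).trans (chain₀ i hi).2.2.2
  refine ⟨?_, hdis i hi j hj⟩
  · refine ⟨r₀.concat hG₀.symm, (r₁.concat hG₁.symm).reverse, ?_, ?_, hvw, ?_, (chain₀ i hi).1,
      (chain₀ i hi).2.1, ?_, (chain₁ j hj).1, (chain₁ j hj).2.1⟩
    · refine isCycle_append_reverse (hp₀.concat hw₀ _) (hp₁.concat hw₁ _) ?_ hvw hna
      intro x hx0 hx1
      simp only [Walk.support_concat, List.mem_append,
        List.mem_singleton] at hx0 hx1
      by_cases hxw : x = w
      · exact Or.inr hxw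
      left
      by_contra hxv
      obtain ⟨i', hi', rfl⟩ := (hc₀ x (hx0.resolve_right hxw)).resolve_left hxv
      obtain ⟨j', hj', e⟩ := (hc₁ _ (hx1.resolve_right hxw)).resolve_left hxv
      exact hdis i' hi' j' hj' (e ▸ .refl)
    · simp only [Walk.length_append, Walk.length_concat, Walk.length_reverse]
      omega
    · simp [Walk.support_concat, hm₀ i hi]
    · simp [hm₁ j hj]

theorem exists_crosses_of_isCrossedOnTree (hsep : IsLocalSeparator G d v w) (hna : ¬ G.Adj v w)
    (ht : IsTree G d v w val par) (hl : IsLabel G d v w lab)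
    (h₀ : IsBest G d v w val lab 0 m₀ a₀) (h₁ : IsBest G d v w val lab (lab a₀) m₁ a₁)
    (h : IsCrossedOnTree G d v w par a₀ a₁ m₀ m₁) :
    ∃ y₀ y₁, IsLocalSeparator G d y₀ y₁ ∧ Crosses G d y₀ y₁ v w := by
  obtain ⟨hm, i, hi, j, hj, hy, hs⟩ := h
  obtain ⟨halt, hdis⟩ := alternatingCycle_of_tree hsep.1 hna ht hl h₀ h₁ hm hi hj
  obtain ⟨p, q, -, -, -, -, h0v, h0w, -, h1v, h1w⟩ := id halt
  have halt' := halt.symm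
  have hd := two_mul_dist_le_iff.2 (isLocalSeparator_iff.1 hsep).2.1
  have hdy := two_mul_dist_le_iff.2 (isLocalSeparator_iff.1 hy).2.1
  refine ⟨_, _, hy, halt', ?_, ?_⟩
  · rw [locallySeparates_iff hdy.1 (isLocalSeparator_iff.1 hy).2.1 halt'.close h0v.symm
      h1v.symm halt'.flip.close h0w.symm h1w.symm]
    exact hs
  · rw [locallySeparates_iff hd.1 (isLocalSeparator_iff.1 hsep).2.1 halt.close h0v h0w
      halt.flip.close h1v h1w]
    exact hdis

/-- Together, `r` and `p` form a closed walk of length at most `d` through `y₀`, so `r` lies in the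
ball around `y₀`. This is what forces separating pairs to meet short paths. -/
theorem rtg_of_walk_avoiding {y₀ y₁ : V} (r : G.Walk v w) (h₀ : y₀ ∉ r.support)
    (h₁ : y₁ ∉ r.support) {p : G.Walk v w} (hy : y₀ ∈ p.support) (h : r.length + p.length ≤ d) :
    ReflTransGen (CopyRel G d y₀ y₁) (false, v) (false, w) := by
  have hle : r.toSubgraph ≤ ball G d y₀ := by
    refine toSubgraph_le_ball r ?_
    have h' := edist_add_edist_le_length p hy
    rw [edist_comm (u := y₀) (v := v)]
    rw [edist_comm (u := y₀) (v := w)] at h'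
    calc G.edist v y₀ + r.length + G.edist w y₀ = r.length + (G.edist v y₀ + G.edist w y₀) := by
          ring
      _ ≤ r.length + p.length := by gcongr
      _ ≤ d := by exact_mod_cast h
  exact copyRel_rtg_of_walk false r (fun x y hxy => hle.2 (Walk.adj_toSubgraph_iff_mem_edges.2 hxy))
    h₀ h₁

/-- Once `y₀` is known to be on the first tree path, `a₀` is in the component of `y₀`. The arc
through `y₁` then competes for `a₁`, so the second tree path is no longer than that arc and must
meet the pair as well. -/
theorem isCrossedOnTree_aux (hna : ¬ G.Adj v w) (ht : IsTree G d v w val par)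
    (hl : IsLabel G d v w lab) (h₀ : IsBest G d v w val lab 0 m₀ a₀)
    (h₁ : IsBest G d v w val lab (lab a₀) m₁ a₁) {y₀ y₁ : V} {p q : G.Walk v w} (hp : p.IsPath)
    (hq : q.IsPath) (hlen : p.length + q.length ≤ d) (hyp : y₀ ∈ p.support) (hyq : y₁ ∈ q.support)
    (h0v : y₀ ≠ v) (h0w : y₀ ≠ w) (h1v : y₁ ≠ v) (h1w : y₁ ≠ w)
    (hsepY : IsLocalSeparator G d y₀ y₁)
    (hX : ¬ ReflTransGen (CopyRel G d v w) (false, y₀) (false, y₁))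
    (hY : ¬ ReflTransGen (CopyRel G d y₀ y₁) (false, v) (false, w))
    (hm : m₀ ≤ p.length) {i : ℕ} (hi : i < m₀ - 1) (hyi : par^[i] a₀ = y₀) :
    IsCrossedOnTree G d v w par a₀ a₁ m₀ m₁ := by
  have hlen' : q.length + p.length ≤ d := by omega
  obtain ⟨b, hwb, hb0, hbq, hbv, hbr⟩ := ht.exists_of_arc hq
    (fun x y h => edges_ball_of_length_le hlen' h) hyq h1v h1w
  obtain ⟨hadj₀, hv₀, h0₀, -⟩ := h₀.2.1 (by omega)
  have hG₀ := (ball G d v).adj_sub hadj₀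
  have hav₀ : a₀ ≠ v := by rintro rfl; exact hna hG₀.symm
  have hb₀ := (ball G d v).edge_vert hadj₀.symm
  have hbb := (ball G d v).edge_vert hwb.symm
  have hbw : b ≠ w := ((ball G d v).adj_sub hwb).ne'
  have hr₀ : ReflTransGen (CopyRel G d v w) (false, y₀) (false, a₀) :=
    hyi ▸ (ht.chain (k := m₀ - 1) (a := a₀) hG₀.ne' (by omega) i hi).2.2.2
  -- The arc through `y₁` ends in a neighbour `b` of `w` whose label differs from that of `a₀`,
  -- since otherwise `y₀` and `y₁` would be connected.
  have hm₁ : m₁ ≤ val b := h₁.2.2 b hwb hb0 fun e => hX <|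
    hr₀.trans <| copyRel_rtg_symm <| hbr.trans <|
      (hl.2 b hbb hbv hbw a₀ hb₀ hav₀ hG₀.ne').1 e
  obtain ⟨hadj₁, hv₁, h0₁, hlab⟩ := h₁.2.1 (by omega)
  have hG₁ := (ball G d v).adj_sub hadj₁
  have hav₁ : a₁ ≠ v := by rintro rfl; exact hna hG₁.symm
  have hb₁ := (ball G d v).edge_vert hadj₁.symm
  obtain ⟨r₁, hr₁, hp₁, hw₁, -, hc₁, -⟩ := ht.exists_walk (m₁ - 1) a₁ hG₁.ne' (by omega)
  have key : y₀ ∈ (r₁.concat hG₁.symm).support ∨ y₁ ∈ (r₁.concat hG₁.symm).support := by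
    by_contra hcon
    rw [not_or] at hcon
    refine hY (rtg_of_walk_avoiding _ hcon.1 hcon.2 hyp ?_)
    rw [Walk.length_concat]
    omega
  simp only [Walk.support_concat, List.mem_append,
    List.mem_singleton, h0w, h1w, or_false] at key
  have chain₁ := ht.chain (k := m₁ - 1) (a := a₁) hG₁.ne' (by omega)
  have hy1 : ∃ j < m₁ - 1, par^[j] a₁ = y₁ := by
    rcases key with h | h
    -- The second tree path cannot contain `y₀`, which is in the component of `a₀`.
    · exfalso
      obtain ⟨j, hj, e⟩ := (hc₁ _ h).resolve_left h0v
      have := (chain₁ j hj).2.2.2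
      rw [e] at this
      exact hlab ((hl.2 a₁ hb₁ hav₁ hG₁.ne' a₀ hb₀ hav₀ hG₀.ne').2
        ((copyRel_rtg_symm this).trans hr₀))
    · exact (hc₁ _ h).resolve_left h1v
  obtain ⟨j, hj, e⟩ := hy1
  exact ⟨by omega, i, hi, j, hj, by rw [hyi, e]; exact hsepY, by rw [hyi, e]; exact hY⟩

/-- Both arcs of the crossing cycle compete for `a₀`, so the first tree path is no longer than
either of them. With one arc it forms a closed walk of length at most `d`, so it contains `y₀` or
`y₁`. -/
theorem isCrossedOnTree_of_crosses (hsep : IsLocalSeparator G d v w) (hna : ¬ G.Adj v w)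
    (ht : IsTree G d v w val par) (hl : IsLabel G d v w lab)
    (h₀ : IsBest G d v w val lab 0 m₀ a₀) (h₁ : IsBest G d v w val lab (lab a₀) m₁ a₁)
    {y₀ y₁ : V} (hsepY : IsLocalSeparator G d y₀ y₁) (hc : Crosses G d y₀ y₁ v w) :
    IsCrossedOnTree G d v w par a₀ a₁ m₀ m₁ := by
  obtain ⟨halt', hY, hX⟩ := hc
  have halt := halt'.symm
  have hd := isLocalSeparator_iff.1 hsep
  have hdy := isLocalSeparator_iff.1 hsepY
  obtain ⟨p, q, hcyc, hlen, -, hyp, h0v, h0w, hyq, h1v, h1w⟩ := id halt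
  rw [locallySeparates_iff (two_mul_dist_le_iff.2 hd.2.1).1 hd.2.1 halt.close h0v h0w
    halt.flip.close h1v h1w] at hX
  rw [locallySeparates_iff (two_mul_dist_le_iff.2 hdy.2.1).1 hdy.2.1 halt'.close h0v.symm h1v.symm
    halt'.flip.close h0w.symm h1w.symm] at hY
  have hp : p.IsPath := hcyc.isPath_of_append_left fun h => hd.1 h.eq.symm
  have hq : q.IsPath := hcyc.isPath_of_append_right fun h => hd.1 h.eq
  rw [Walk.length_append] at hlen
  have hlen1 : p.length + q.reverse.length ≤ d := by rwa [Walk.length_reverse]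
  have hlen2 : q.reverse.length + p.length ≤ d := by omega
  have hyq' : y₁ ∈ q.reverse.support := by simpa using hyq
  obtain ⟨a, hwa, ha0, hap, hav, har⟩ := ht.exists_of_arc hp
    (fun x y h => edges_ball_of_length_le hlen1 h) hyp h0v h0w
  obtain ⟨b, hwb, hb0, hbq, hbv, hbr⟩ := ht.exists_of_arc hq.reverse
    (fun x y h => edges_ball_of_length_le hlen2 h) hyq' h1v h1w
  -- Labels of copies are nonzero, so the forbidden label 0 excludes no neighbour of `w` here.
  have hmp : m₀ ≤ p.length := (h₀.2.2 a hwa ha0 (hl.1 a ((ball G d v).edge_vert hwa.symm) hav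
    ((ball G d v).adj_sub hwa).ne')).trans hap
  have hmq : m₀ ≤ q.reverse.length := (h₀.2.2 b hwb hb0 (hl.1 b ((ball G d v).edge_vert hwb.symm)
    hbv ((ball G d v).adj_sub hwb).ne')).trans hbq
  obtain ⟨hadj₀, hv₀, h0₀, -⟩ := h₀.2.1 (by omega)
  have hG₀ := (ball G d v).adj_sub hadj₀
  obtain ⟨r₀, hr₀, hp₀, hw₀, -, hc₀, -⟩ := ht.exists_walk (m₀ - 1) a₀ hG₀.ne' (by omega)
  have key : y₀ ∈ (r₀.concat hG₀.symm).support ∨ y₁ ∈ (r₀.concat hG₀.symm).support := by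
    by_contra hcon
    rw [not_or] at hcon
    refine hY (rtg_of_walk_avoiding _ hcon.1 hcon.2 hyp ?_)
    rw [Walk.length_concat]
    omega
  simp only [Walk.support_concat, List.mem_append,
    List.mem_singleton, h0w, h1w, or_false] at key
  rcases key with h | h
  · obtain ⟨i, hi, e⟩ := (hc₀ _ h).resolve_left h0v
    exact isCrossedOnTree_aux hna ht hl h₀ h₁ hp hq.reverse hlen1 hyp hyq' h0v h0w h1v h1w hsepY hX
      hY hmp hi e
  -- The same argument with `y₀` and `y₁` exchanged. This exchanges the two balls as well, so the
  -- left copies of `v` and `w` are reached through their links.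
  · obtain ⟨i, hi, e⟩ := (hc₀ _ h).resolve_left h1v
    refine isCrossedOnTree_aux hna ht hl h₀ h₁ hq.reverse hp hlen2 hyq' hyp h1v h1w h0v h0w
      hsepY.swap (fun h => hX (copyRel_rtg_symm h)) (fun h => hY ?_) hmq hi e
    exact (halt'.close.rtg h0v.symm h1v.symm _ _).trans
      ((copyRel_rtg_swap h).trans (halt'.flip.close.rtg h0w.symm h1w.symm _ _))

/-- The edge from `v` to `w` avoids the other pair and is no longer than an arc of the cycle, so it
connects `v` and `w` in the other punctured neighbourhood. -/
theorem not_crosses_of_adj {y₀ y₁ : V} (ha : G.Adj v w) (hsepY : IsLocalSeparator G d y₀ y₁) :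
    ¬ Crosses G d y₀ y₁ v w := by
  rintro ⟨halt', hY, -⟩
  have hdy := isLocalSeparator_iff.1 hsepY
  obtain ⟨p, q, hcyc, hlen, -, hyp, h0v, h0w, hyq, h1v, h1w⟩ := halt'.symm
  rw [locallySeparates_iff (two_mul_dist_le_iff.2 hdy.2.1).1 hdy.2.1 halt'.close h0v.symm h1v.symm
    halt'.flip.close h0w.symm h1w.symm] at hY
  have hq : q.length ≠ 0 := fun h => h1w (by
    have := Walk.eq_of_length_eq_zero h
    subst this
    exact absurd ha G.irrefl)
  rw [Walk.length_append] at hlen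
  refine hY (rtg_of_walk_avoiding (Walk.cons ha .nil) (by simp [h0v, h0w]) (by simp [h1v, h1w])
    hyp ?_)
  simp only [Walk.length_cons, Walk.length_nil]
  omega

theorem isTotallyNested_iff (hsep : IsLocalSeparator G d v w) (hna : ¬ G.Adj v w)
    (ht : IsTree G d v w val par) (hl : IsLabel G d v w lab)
    (h₀ : IsBest G d v w val lab 0 m₀ a₀) (h₁ : IsBest G d v w val lab (lab a₀) m₁ a₁) :
    IsTotallyNested G d v w ↔ ¬ IsCrossedOnTree G d v w par a₀ a₁ m₀ m₁ := by
  constructor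
  · intro h hc
    obtain ⟨y₀, y₁, hy, h'⟩ := exists_crosses_of_isCrossedOnTree hsep hna ht hl h₀ h₁ hc
    exact h.2 y₀ y₁ hy h'
  · exact fun h => ⟨hsep, fun y₀ y₁ hy hc =>
      h (isCrossedOnTree_of_crosses hsep hna ht hl h₀ h₁ hy hc)⟩

theorem isTotallyNested_of_adj (hsep : IsLocalSeparator G d v w) (ha : G.Adj v w) :
    IsTotallyNested G d v w :=
  ⟨hsep, fun _ _ => not_crosses_of_adj ha⟩

end Crossing

end LocalSep

namespace LocalSep

/-! ### A program logic with running times -/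

section Machine

/-- Started in `s`, the program `p` halts, and the final storage and the running time satisfy `Q`. -/
def Wp (p : Prog) (s : Store) (Q : Store → ℕ → Prop) : Prop :=
  ∃ s' t, Run p s s' t ∧ Q s' t

theorem Wp.mono {p : Prog} {s : Store} {Q Q' : Store → ℕ → Prop} (h : Wp p s Q)
    (h' : ∀ s' t, Q s' t → Q' s' t) : Wp p s Q' := by
  obtain ⟨s', t, hr, hq⟩ := h
  exact ⟨s', t, hr, h' _ _ hq⟩

theorem wp_skip {s : Store} {Q : Store → ℕ → Prop} : Wp .skip s Q ↔ Q s 1 :=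
  ⟨fun ⟨_, _, h, hq⟩ => by cases h; exact hq, fun h => ⟨_, _, .skip s, h⟩⟩

theorem wp_const {s : Store} {x k : ℕ} {Q : Store → ℕ → Prop} :
    Wp (.const x k) s Q ↔ Q (s.setVar x k) 1 :=
  ⟨fun ⟨_, _, h, hq⟩ => by cases h; exact hq, fun h => ⟨_, _, .const s x k, h⟩⟩

theorem wp_copy {s : Store} {x y : ℕ} {Q : Store → ℕ → Prop} :
    Wp (.copy x y) s Q ↔ Q (s.setVar x (s.var y)) 1 :=
  ⟨fun ⟨_, _, h, hq⟩ => by cases h; exact hq, fun h => ⟨_, _, .copy s x y, h⟩⟩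

theorem wp_add {s : Store} {x y z : ℕ} {Q : Store → ℕ → Prop} :
    Wp (.add x y z) s Q ↔ Q (s.setVar x (s.var y + s.var z)) 1 :=
  ⟨fun ⟨_, _, h, hq⟩ => by cases h; exact hq, fun h => ⟨_, _, .add s x y z, h⟩⟩

theorem wp_sub {s : Store} {x y z : ℕ} {Q : Store → ℕ → Prop} :
    Wp (.sub x y z) s Q ↔ Q (s.setVar x (s.var y - s.var z)) 1 :=
  ⟨fun ⟨_, _, h, hq⟩ => by cases h; exact hq, fun h => ⟨_, _, .sub s x y z, h⟩⟩

theorem wp_load {s : Store} {x a y : ℕ} {Q : Store → ℕ → Prop} :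
    Wp (.load x a y) s Q ↔ Q (s.setVar x (s.arr a (s.var y))) 1 :=
  ⟨fun ⟨_, _, h, hq⟩ => by cases h; exact hq, fun h => ⟨_, _, .load s x a y, h⟩⟩

theorem wp_store {s : Store} {a x y : ℕ} {Q : Store → ℕ → Prop} :
    Wp (.store a x y) s Q ↔ Q (s.setArr a (s.var x) (s.var y)) 1 :=
  ⟨fun ⟨_, _, h, hq⟩ => by cases h; exact hq, fun h => ⟨_, _, .store s a x y, h⟩⟩

theorem wp_seq {s : Store} {p q : Prog} {Q : Store → ℕ → Prop} :
    Wp (.seq p q) s Q ↔ Wp p s fun s' t => Wp q s' fun s'' t' => Q s'' (t + t') := by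
  constructor
  · rintro ⟨_, _, h, hq⟩
    cases h with
    | seq h₁ h₂ => exact ⟨_, _, h₁, _, _, h₂, hq⟩
  · rintro ⟨_, _, h₁, _, _, h₂, hq⟩
    exact ⟨_, _, .seq h₁ h₂, hq⟩

theorem wp_cond {s : Store} {x : ℕ} {p q : Prog} {Q : Store → ℕ → Prop} :
    Wp (.cond x p q) s Q ↔ (s.var x ≠ 0 → Wp p s fun s' t => Q s' (t + 1)) ∧
      (s.var x = 0 → Wp q s fun s' t => Q s' (t + 1)) := by
  constructor
  · rintro ⟨_, _, h, hq⟩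
    cases h with
    | cond_true hx h => exact ⟨fun _ => ⟨_, _, h, hq⟩, fun h0 => absurd h0 hx⟩
    | cond_false hx h => exact ⟨fun h0 => absurd hx h0, fun _ => ⟨_, _, h, hq⟩⟩
  · rintro ⟨h₁, h₂⟩
    by_cases hx : s.var x = 0
    · obtain ⟨_, _, h, hq⟩ := h₂ hx
      exact ⟨_, _, .cond_false hx h, hq⟩
    · obtain ⟨_, _, h, hq⟩ := h₁ hx
      exact ⟨_, _, .cond_true hx h, hq⟩

@[simp] theorem setVar_var {s : Store} {x k y : ℕ} :
    (s.setVar x k).var y = if y = x then k else s.var y := by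
  simp [Store.setVar, Function.update_apply]

@[simp] theorem setVar_arr {s : Store} {x k : ℕ} : (s.setVar x k).arr = s.arr := rfl

@[simp] theorem setArr_var {s : Store} {a i k : ℕ} : (s.setArr a i k).var = s.var := rfl

@[simp] theorem setArr_arr {s : Store} {a i k b : ℕ} :
    (s.setArr a i k).arr b = if b = a then Function.update (s.arr a) i k else s.arr b := by
  simp only [Store.setArr, Function.update_apply]

/-- `x := x + 1`, with the scratch register 26. -/
def incr (x : ℕ) : Prog := .seq (.const 26 1) (.add x x 26)

/-- While `i < hi`, execute `body` and increase `i`, with the scratch register `tmp`. -/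
def forUp (i hi tmp : ℕ) (body : Prog) : Prog :=
  .seq (.sub tmp hi i) (.loop tmp (.seq body (.seq (incr i) (.sub tmp hi i))))

theorem wp_incr {s : Store} {x : ℕ} {Q : Store → ℕ → Prop} :
    Wp (incr x) s Q ↔ Q ((s.setVar 26 1).setVar x ((s.setVar 26 1).var x + 1)) 2 := by
  simp [incr, wp_seq, wp_const, wp_add]

/-- The program does not assign to the scalar register `y`. -/
def Prog.keepsVar : Prog → ℕ → Bool
  | .skip, _ => true
  | .const x _, y => x != y
  | .copy x _, y => x != y
  | .add x _ _, y => x != y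
  | .sub x _ _, y => x != y
  | .load x _ _, y => x != y
  | .store _ _ _, _ => true
  | .seq p q, y => p.keepsVar y && q.keepsVar y
  | .cond _ p q, y => p.keepsVar y && q.keepsVar y
  | .loop _ p, y => p.keepsVar y

/-- The program does not assign to the array `b`. -/
def Prog.keepsArr : Prog → ℕ → Bool
  | .store a _ _, b => a != b
  | .seq p q, b => p.keepsArr b && q.keepsArr b
  | .cond _ p q, b => p.keepsArr b && q.keepsArr b
  | .loop _ p, b => p.keepsArr b
  | _, _ => true

/-- A syntactic check, settled by evaluation, so that loop invariants need not mention registers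
that the loop leaves alone. -/
theorem Run.var_eq {p : Prog} {s s' : Store} {t y : ℕ} (h : Run p s s' t)
    (hy : p.keepsVar y = true) : s'.var y = s.var y := by
  induction h with
  | skip | store | loop_false => rfl
  | const | copy | add | sub | load =>
    rw [setVar_var, if_neg]
    rintro rfl
    simp [Prog.keepsVar] at hy
  | seq _ _ ih₁ ih₂ =>
    simp only [Prog.keepsVar, Bool.and_eq_true] at hy
    rw [ih₂ hy.2, ih₁ hy.1]
  | cond_true _ _ ih =>
    simp only [Prog.keepsVar, Bool.and_eq_true] at hy
    exact ih hy.1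
  | cond_false _ _ ih =>
    simp only [Prog.keepsVar, Bool.and_eq_true] at hy
    exact ih hy.2
  | loop_true _ _ _ ih₁ ih₂ => rw [ih₂ hy, ih₁ hy]

theorem Run.arr_eq {p : Prog} {s s' : Store} {t b : ℕ} (h : Run p s s' t)
    (hb : p.keepsArr b = true) : s'.arr b = s.arr b := by
  induction h with
  | skip | loop_false | const | copy | add | sub | load => rfl
  | store =>
    rw [setArr_arr, if_neg]
    rintro rfl
    simp [Prog.keepsArr] at hb
  | seq _ _ ih₁ ih₂ =>
    simp only [Prog.keepsArr, Bool.and_eq_true] at hb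
    rw [ih₂ hb.2, ih₁ hb.1]
  | cond_true _ _ ih =>
    simp only [Prog.keepsArr, Bool.and_eq_true] at hb
    exact ih hb.1
  | cond_false _ _ ih =>
    simp only [Prog.keepsArr, Bool.and_eq_true] at hb
    exact ih hb.2
  | loop_true _ _ _ ih₁ ih₂ => rw [ih₂ hb, ih₁ hb]

/-- The registers and arrays that `p` does not assign to have the same values in `s` and `s'`. -/
structure Frame (p : Prog) (s s' : Store) : Prop where
  var : ∀ y, p.keepsVar y = true → s'.var y = s.var y
  arr : ∀ b, p.keepsArr b = true → s'.arr b = s.arr b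

theorem Wp.frame {p : Prog} {s : Store} {Q : Store → ℕ → Prop} (h : Wp p s Q) :
    Wp p s fun s' t => Q s' t ∧ Frame p s s' := by
  obtain ⟨s', t, hr, hq⟩ := h
  exact ⟨s', t, hr, hq, fun y hy => hr.var_eq hy, fun b hb => hr.arr_eq hb⟩

/-- The invariant `I s c` of a loop relates the current storage and the time `c` used so far. -/
theorem wp_loop {x : ℕ} {p : Prog} {Q : Store → ℕ → Prop} (I : Store → ℕ → Prop) (m : Store → ℕ)
    {s : Store} (h0 : I s 0)
    (step : ∀ s' c, Frame p s s' → I s' c → s'.var x ≠ 0 →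
      Wp p s' fun s'' t => I s'' (c + t + 1) ∧ m s'' < m s')
    (fin : ∀ s' c, Frame p s s' → I s' c → s'.var x = 0 → Q s' (c + 1)) : Wp (.loop x p) s Q := by
  -- Induction on the measure, with the time `c` already spent as a parameter.
  suffices H : ∀ k s' c, m s' = k → Frame p s s' → I s' c →
      Wp (.loop x p) s' fun s'' t => Q s'' (c + t) by
    simpa using H _ s 0 rfl ⟨fun _ _ => rfl, fun _ _ => rfl⟩ h0
  intro k
  induction k using Nat.strong_induction_on with
  | _ k ih =>
    intro s' c hk hF hI
    by_cases hx : s'.var x = 0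
    · exact ⟨s', 1, .loop_false hx, fin s' c hF hI hx⟩
    · obtain ⟨s'', t, hr, hI', hm⟩ := step s' c hF hI hx
      have hF' : Frame p s s'' := ⟨fun y hy => (hr.var_eq hy).trans (hF.var y hy),
        fun b hb => (hr.arr_eq hb).trans (hF.arr b hb)⟩
      obtain ⟨s₃, t', hr', hq⟩ := ih _ (hk ▸ hm) s'' _ rfl hF' hI'
      refine ⟨s₃, t + t' + 1, .loop_true hx hr hr', ?_⟩
      simpa only [show c + (t + t' + 1) = c + t + 1 + t' by omega] using hq

/-- The storage after the increment at the end of the body of `forUp`. -/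
def Store.next (s : Store) (i hi tmp : ℕ) : Store :=
  ((s.setVar 26 1).setVar i (s.var i + 1)).setVar tmp (s.var hi - (s.var i + 1))

@[simp] theorem next_arr {s : Store} {i hi tmp : ℕ} : (s.next i hi tmp).arr = s.arr := rfl

theorem next_var {s : Store} {i hi tmp y : ℕ} : (s.next i hi tmp).var y =
    if y = tmp then s.var hi - (s.var i + 1) else if y = i then s.var i + 1 else
      if y = 26 then 1 else s.var y := by
  simp [Store.next]

/-- Each round costs four steps besides the body: two for the increment, one for the new difference
and one for the test. The final 2 is the first difference and the last test. -/
theorem wp_forUp {i hi tmp : ℕ} {body : Prog} {Q : Store → ℕ → Prop} (I : ℕ → Store → ℕ → Prop)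
    {s : Store} (hi26 : i ≠ 26) (hh26 : hi ≠ 26) (hih : hi ≠ i) (hti : i ≠ tmp)
    (hth : hi ≠ tmp) (hkh : body.keepsVar hi = true) (hki : body.keepsVar i = true)
    (hle : s.var i ≤ s.var hi)
    (h0 : I (s.var i) (s.setVar tmp (s.var hi - s.var i)) 0)
    (step : ∀ k s' c, s.var i ≤ k → k < s.var hi → s'.var i = k →
      Frame (forUp i hi tmp body) s s' → I k s' c →
      Wp body s' fun s'' t => I (k + 1) (s''.next i hi tmp) (c + t + 4))
    (fin : ∀ s' c, I (s.var hi) s' c → s'.var i = s.var hi → Frame (forUp i hi tmp body) s s' →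
      Q s' (c + 2)) :
    Wp (forUp i hi tmp body) s Q := by
  simp only [forUp, wp_seq, wp_sub]
  have hfr : ∀ s', Frame (.seq body (.seq (incr i) (.sub tmp hi i)))
      (s.setVar tmp (s.var hi - s.var i)) s' → Frame (forUp i hi tmp body) s s' := by
    intro s' hF
    refine ⟨fun y hy => ?_, fun b hb => hF.arr b (by simpa [forUp, Prog.keepsArr] using hb)⟩
    have hy' : y ≠ tmp := by
      rintro rfl
      simp [forUp, Prog.keepsVar] at hy
    rw [hF.var y (by simp [forUp, Prog.keepsVar] at hy ⊢; exact hy.2), setVar_var, if_neg hy']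
  refine wp_loop (fun s' c => s.var i ≤ s'.var i ∧ s'.var i ≤ s.var hi ∧ s'.var hi = s.var hi ∧
    s'.var tmp = s.var hi - s'.var i ∧ I (s'.var i) s' c) (fun s' => s.var hi - s'.var i) ?_ ?_ ?_
  · simpa [hti, hth, hle] using h0
  · rintro s' c hF ⟨h1, h2, h3, h4, h5⟩ h6
    rw [wp_seq]
    refine (step _ s' c h1 (by omega) rfl (hfr s' hF) h5).frame.mono ?_
    rintro s'' t ⟨h7, h8⟩
    have e1 := h8.var i hki
    have e2 := h8.var hi hkh
    have e0 : (s''.setVar 26 1).var i = s''.var i := by simp [hi26]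
    rw [wp_seq, wp_incr, wp_sub, e0]
    have e : (((s''.setVar 26 1).setVar i (s''.var i + 1)).setVar tmp
        (((s''.setVar 26 1).setVar i (s''.var i + 1)).var hi -
          ((s''.setVar 26 1).setVar i (s''.var i + 1)).var i)) = s''.next i hi tmp := by
      simp [Store.next, hih, hh26]
    rw [e]
    have e3 : (s''.next i hi tmp).var i = s'.var i + 1 := by simp [next_var, hti, e1]
    refine ⟨⟨?_, ?_, ?_, ?_, ?_⟩, ?_⟩
    · omega
    · omega
    · rw [next_var, if_neg hth, if_neg hih, if_neg hh26, e2, h3]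
    · rw [e3, next_var, if_pos rfl, e1, e2, h3]
    · rw [e3]; exact h7
    · rw [e3]; omega
  · rintro s' c hF ⟨h1, h2, h3, h4, h5⟩ h6
    have e : s'.var i = s.var hi := by omega
    rw [show 1 + (c + 1) = c + 2 by omega]
    exact fin s' c (e ▸ h5) e (hfr s' hF)

end Machine

end LocalSep

namespace LocalSep

open Relation

/-! ### Breadth-first search with amortised running time -/

section Search

/-- The invariant of a breadth-first search. The queue is `q` on the interval from `q0` to `tl`, and
`c` is the position of the front. -/
structure BfsCore (nb : ℕ → ℕ → Prop) (U : ℕ → Prop) (len : ℕ → ℕ) (W : ℕ) (val0 val par q : ℕ → ℕ)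
    (src v0 inc b1 q0 c tl : ℕ) : Prop where
  q0_lt : q0 < tl
  q0_le : q0 ≤ c
  le_tl : c ≤ tl
  q_src : q q0 = src
  val_src : val src = v0
  mem : ∀ j, q0 ≤ j → j < tl → U (q j) ∧ val0 (q j) = 0 ∧ val (q j) ≠ 0
  inj : ∀ i j, q0 ≤ i → i < tl → q0 ≤ j → j < tl → q i = q j → i = j
  out : ∀ x, (∀ j, q0 ≤ j → j < tl → q j ≠ x) → val x = val0 x
  par : ∀ j, q0 < j → j < tl → ∃ i, q0 ≤ i ∧ i < j ∧ par (q j) = q i ∧ nb (q i) (q j) ∧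
    val (q j) = val (q i) + inc ∧ 2 * val (q j) < b1
  mono : ∀ i j, q0 ≤ i → i ≤ j → j < tl → val (q i) ≤ val (q j)
  front : c < tl → ∀ j, q0 ≤ j → j < tl → val (q j) ≤ val (q c) + inc
  pot : (∑ x ∈ Finset.range W, if val x ≠ 0 then len x + 1 else 0) =
    (∑ x ∈ Finset.range W, if val0 x ≠ 0 then len x + 1 else 0) +
      ∑ j ∈ Finset.Ico q0 tl, (len (q j) + 1)

variable {nb : ℕ → ℕ → Prop} {U : ℕ → Prop} {len : ℕ → ℕ} {W : ℕ} {val0 val par q : ℕ → ℕ}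
  {src v0 inc b1 q0 c tl : ℕ}

/-- Marking a vertex raises the potential by its list length plus one, which is what expanding it
will cost up to a constant factor. -/
theorem sum_update_pot (len val : ℕ → ℕ) {W x k : ℕ} (hx : x < W) (h0 : val x = 0) (hk : k ≠ 0) :
    (∑ y ∈ Finset.range W, if Function.update val x k y ≠ 0 then len y + 1 else 0) =
      (∑ y ∈ Finset.range W, if val y ≠ 0 then len y + 1 else 0) + (len x + 1) := by
  have hx' : x ∈ Finset.range W := Finset.mem_range.2 hx
  rw [← Finset.add_sum_erase _ _ hx', ← Finset.add_sum_erase _ _ hx', add_comm]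
  simp only [Function.update_self, ne_eq, hk, not_false_eq_true, if_true, h0, not_true, if_false,
    zero_add]
  congr 1
  refine Finset.sum_congr rfl fun y hy => ?_
  rw [Function.update_of_ne (Finset.ne_of_mem_erase hy)]

theorem BfsCore.init {q : ℕ → ℕ} (hU : U src) (hW : src < W) (h0 : val0 src = 0) (hv : v0 ≠ 0) :
    BfsCore nb U len W val0 (Function.update val0 src v0) par (Function.update q q0 src) src v0 inc
      b1 q0 q0 (q0 + 1) where
  q0_lt := by omega
  q0_le := le_rfl
  le_tl := by omega
  q_src := by simp
  val_src := by simp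
  mem j h1 h2 := by
    obtain rfl : j = q0 := by omega
    simp [hU, h0, hv]
  inj i j _ _ _ _ _ := by omega
  out x hx := by
    have := hx q0 le_rfl (by omega)
    rw [Function.update_self] at this
    rw [Function.update_of_ne this.symm]
  par j h1 h2 := by omega
  mono i j h1 h2 h3 := by
    obtain rfl : j = i := by omega
    exact le_rfl
  front _ j h1 h2 := by
    obtain rfl : j = q0 := by omega
    omega
  pot := by rw [sum_update_pot len val0 hW h0 hv]; simp

theorem BfsCore.val0_of_val (h : BfsCore nb U len W val0 val par q src v0 inc b1 q0 c tl) {x : ℕ}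
    (hx : val x = 0) : val0 x = 0 ∧ ∀ j, q0 ≤ j → j < tl → q j ≠ x := by
  have hq : ∀ j, q0 ≤ j → j < tl → q j ≠ x := by
    rintro j h1 h2 rfl
    exact (h.mem j h1 h2).2.2 hx
  exact ⟨(h.out x hq).symm.trans hx, hq⟩

theorem BfsCore.exists_of_val (h : BfsCore nb U len W val0 val par q src v0 inc b1 q0 c tl) {x : ℕ}
    (hx : val x ≠ 0) (h0 : val0 x = 0) : ∃ j, q0 ≤ j ∧ j < tl ∧ q j = x := by
  by_contra hc
  push Not at hc
  exact hx ((h.out x hc).trans h0)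

/-- The new mark is that of the front plus `inc`, which `front` shows to be at least every mark in
the queue; so the queue stays sorted. -/
theorem BfsCore.push (h : BfsCore nb U len W val0 val par q src v0 inc b1 q0 c tl) (hc : c < tl)
    {x : ℕ} (hn : nb (q c) x) (hU : U x) (hW : x < W) (hx : val x = 0)
    (hb : 2 * (val (q c) + inc) < b1) :
    BfsCore nb U len W val0 (Function.update val x (val (q c) + inc))
      (Function.update par x (q c)) (Function.update q tl x) src v0 inc b1 q0 c (tl + 1) := by
  obtain ⟨h0, hq⟩ := h.val0_of_val hx
  have hnv : val (q c) + inc ≠ 0 := by have := (h.mem c h.q0_le hc).2.2; omega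
  have eq : ∀ j, j < tl → Function.update q tl x j = q j := fun j hj =>
    Function.update_of_ne hj.ne _ _
  have ev : ∀ j, q0 ≤ j → j < tl → Function.update val x (val (q c) + inc) (q j) = val (q j) :=
    fun j h1 h2 => Function.update_of_ne (hq j h1 h2) _ _
  have ep : ∀ j, q0 ≤ j → j < tl → Function.update par x (q c) (q j) = par (q j) :=
    fun j h1 h2 => Function.update_of_ne (hq j h1 h2) _ _
  have etl : Function.update q tl x tl = x := Function.update_self _ _ _
  have evx : Function.update val x (val (q c) + inc) x = val (q c) + inc := Function.update_self _ _ _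
  have h1 := h.q0_lt
  have h2 := h.q0_le
  exact
  { q0_lt := by omega
    q0_le := h.q0_le
    le_tl := by omega
    q_src := by rw [eq _ h1, h.q_src]
    val_src := by
      rw [Function.update_of_ne, h.val_src]
      rw [← h.q_src]
      exact hq q0 le_rfl h1
    mem := fun j h3 h4 => by
      rcases Nat.lt_succ_iff_lt_or_eq.1 h4 with h4 | rfl
      · rw [eq j h4, ev j h3 h4]
        exact h.mem j h3 h4
      · rw [etl, evx]
        exact ⟨hU, h0, hnv⟩
    inj := fun i j h3 h4 h5 h6 => by
      rcases Nat.lt_succ_iff_lt_or_eq.1 h4 with h4 | rfl <;>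
        rcases Nat.lt_succ_iff_lt_or_eq.1 h6 with h6 | rfl
      · rw [eq i h4, eq j h6]
        exact h.inj i j h3 h4 h5 h6
      · rw [eq i h4, etl]
        exact fun e => absurd e (hq i h3 h4)
      · rw [eq j h6, etl]
        exact fun e => absurd e.symm (hq j h5 h6)
      · exact fun _ => rfl
    out := fun y hy => by
      have hyx : x ≠ y := by have := hy tl (by omega) (by omega); rwa [etl] at this
      rw [Function.update_of_ne hyx.symm]
      exact h.out y fun j h3 h4 => by
        have := hy j h3 (by omega)
        rwa [eq j h4] at this
    par := fun j h3 h4 => by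
      rcases Nat.lt_succ_iff_lt_or_eq.1 h4 with h4 | rfl
      · obtain ⟨i, a1, a2, a3, a4, a5, a6⟩ := h.par j h3 h4
        refine ⟨i, a1, a2, ?_⟩
        rw [eq j h4, eq i (by omega), ep j h3.le h4, ev j h3.le h4, ev i a1 (by omega)]
        exact ⟨a3, a4, a5, a6⟩
      · refine ⟨c, h2, hc, ?_⟩
        rw [etl, eq c hc, evx, Function.update_self, ev c h2 hc]
        exact ⟨rfl, hn, rfl, hb⟩
    mono := fun i j h3 h4 h5 => by
      rcases Nat.lt_succ_iff_lt_or_eq.1 h5 with h5 | rfl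
      · rw [eq i (by omega), eq j h5, ev i h3 (by omega), ev j (by omega) h5]
        exact h.mono i j h3 h4 h5
      · rcases h4.lt_or_eq with h4 | rfl
        · rw [etl, evx, eq i h4, ev i h3 h4]
          exact h.front hc i h3 h4
        · exact le_rfl
    front := fun _ j h3 h4 => by
      rw [eq c hc, ev c h2 hc]
      rcases Nat.lt_succ_iff_lt_or_eq.1 h4 with h4 | rfl
      · rw [eq j h4, ev j h3 h4]
        exact h.front hc j h3 h4
      · rw [etl, evx]
    pot := by
      rw [sum_update_pot len val hW hx hnv, h.pot, Finset.sum_Ico_succ_top (by omega), etl,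
        add_assoc]
      congr 2
      exact Finset.sum_congr rfl fun j hj => by rw [eq j (Finset.mem_Ico.1 hj).2] }

/-- The queue is sorted, so the next front has at least the mark of the old one and the bound
`front` survives. -/
theorem BfsCore.advance (h : BfsCore nb U len W val0 val par q src v0 inc b1 q0 c tl)
    (hc : c < tl) : BfsCore nb U len W val0 val par q src v0 inc b1 q0 (c + 1) tl :=
  { h with
    q0_le := h.q0_le.trans (Nat.le_succ c)
    le_tl := hc
    front := fun h1 j h2 h3 => (h.front hc j h2 h3).trans
      (Nat.add_le_add_right (h.mono c (c + 1) h.q0_le (Nat.le_succ c) h1) inc) }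

/-- The queue has no repetitions and every entry weighs at least one. This bound is what makes the
search terminate. -/
theorem BfsCore.tl_le (h : BfsCore nb U len W val0 val par q src v0 inc b1 q0 c tl) :
    tl ≤ q0 + ∑ x ∈ Finset.range W, (len x + 1) := by
  have h1 : ∑ j ∈ Finset.Ico q0 tl, 1 ≤ ∑ j ∈ Finset.Ico q0 tl, (len (q j) + 1) :=
    Finset.sum_le_sum fun j _ => by omega
  have h2 : (∑ x ∈ Finset.range W, if val x ≠ 0 then len x + 1 else 0) ≤
      ∑ x ∈ Finset.range W, (len x + 1) :=
    Finset.sum_le_sum fun x _ => by split <;> omega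
  have h3 := h.pot
  simp only [Finset.sum_const, Nat.card_Ico, smul_eq_mul, mul_one] at h1
  omega

/-- The vertices before position `c` have been expanded. -/
def Expanded (nb : ℕ → ℕ → Prop) (val0 val q : ℕ → ℕ) (inc b1 q0 c : ℕ) : Prop :=
  ∀ j, q0 ≤ j → j < c → 2 * (val (q j) + inc) < b1 → ∀ x, nb (q j) x →
    val x ≠ 0 ∧ (val0 x = 0 → val x ≤ val (q j) + inc)

/-- Row `g` of the arrays 4 and 5 delimits adjacency lists in array 1: `x` is in the list of `u`. -/
def Nb (s : Store) (g u x : ℕ) : Prop :=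
  ∃ e, s.arr 4 (g + u) ≤ e ∧ e < s.arr 5 (g + u) ∧ s.arr 1 e = x

/-- The length of the adjacency list of `u`. -/
def rowLen (s : Store) (g u : ℕ) : ℕ := s.arr 5 (g + u) - s.arr 4 (g + u)

/-- The number of marked vertices plus the total length of their adjacency lists. -/
def pot (s : Store) (g h W : ℕ) : ℕ :=
  ∑ x ∈ Finset.range W, if s.arr 6 (h + x) ≠ 0 then rowLen s g x + 1 else 0

/-- Visit the vertex in register 21. -/
def bfsEdge : Prog :=
  .seq (.load 21 1 18) <| .seq (.add 24 11 21) <| .seq (.load 25 6 24) <|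
    .cond 25 .skip <| .seq (.store 6 24 20) <| .seq (.store 7 24 17) <|
      .seq (.store 8 6 21) (incr 6)

/-- Expand the front of the queue. -/
def bfsStep : Prog :=
  .seq (.load 17 8 16) <| .seq (incr 16) <| .seq (.add 24 10 17) <| .seq (.load 18 4 24) <|
    .seq (.load 19 5 24) <| .seq (.add 24 11 17) <| .seq (.load 20 6 24) <|
      .seq (.add 20 20 14) <| .seq (.add 24 20 20) <| .seq (.sub 24 15 24) <|
        .cond 24 (forUp 18 19 23 bfsEdge) .skip

/-- Breadth-first search from the vertex in register 12 in the graph with row 10. Marks are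
written to the row 11 of array 6 and predecessors to that of array 7. The queue is appended to array
8, whose end is in register 6. The source receives the mark in register 13, and marks increase by
the content of register 14 along edges, as long as twice the mark is less than register 15. -/
def bfs : Prog :=
  .seq (.add 24 11 12) <| .seq (.store 6 24 13) <| .seq (.store 8 6 12) <| .seq (.copy 16 6) <|
    .seq (incr 6) <| .seq (.sub 22 6 16) <| .loop 22 <| .seq bfsStep (.sub 22 6 16)

/-- The invariant of `bfs`, started in `s0`, when the front is at position `c`. -/
structure BfsInv (s0 : Store) (U : ℕ → Prop) (W : ℕ) (s : Store) (c : ℕ) : Prop where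
  core : BfsCore (Nb s0 (s0.var 10)) U (rowLen s0 (s0.var 10)) W (fun x => s0.arr 6 (s0.var 11 + x))
    (fun x => s.arr 6 (s0.var 11 + x)) (fun x => s.arr 7 (s0.var 11 + x)) (s.arr 8)
    (s0.var 12) (s0.var 13) (s0.var 14) (s0.var 15) (s0.var 6) c (s.var 6)
  out : ∀ i, i < s0.var 11 ∨ s0.var 11 + W ≤ i →
    s.arr 6 i = s0.arr 6 i ∧ s.arr 7 i = s0.arr 7 i
  old : ∀ j < s0.var 6, s.arr 8 j = s0.arr 8 j

theorem update_add_left (f : ℕ → ℕ) (h x k : ℕ) :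
    (fun y => Function.update f (h + x) k (h + y)) = Function.update (fun y => f (h + y)) x k := by
  funext y
  simp [Function.update_apply]

theorem BfsInv.push {s0 s : Store} {U : ℕ → Prop} {W c : ℕ} (h : BfsInv s0 U W s c)
    (hc : c < s.var 6) {x : ℕ} (hn : Nb s0 (s0.var 10) (s.arr 8 c) x) (hU : U x) (hW : x < W)
    (hx : s.arr 6 (s0.var 11 + x) = 0)
    (hb : 2 * (s.arr 6 (s0.var 11 + s.arr 8 c) + s0.var 14) < s0.var 15) {s' : Store}
    (e6 : s'.arr 6 = Function.update (s.arr 6) (s0.var 11 + x)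
      (s.arr 6 (s0.var 11 + s.arr 8 c) + s0.var 14))
    (e7 : s'.arr 7 = Function.update (s.arr 7) (s0.var 11 + x) (s.arr 8 c))
    (e8 : s'.arr 8 = Function.update (s.arr 8) (s.var 6) x) (e : s'.var 6 = s.var 6 + 1) :
    BfsInv s0 U W s' c where
  core := by
    rw [e6, e7, e8, e, update_add_left, update_add_left]
    exact h.core.push hc hn hU hW hx hb
  out i hi := by
    have hne : i ≠ s0.var 11 + x := by omega
    rw [e6, e7, Function.update_of_ne hne, Function.update_of_ne hne]
    exact h.out i hi
  old j hj := by
    have := h.core.q0_lt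
    rw [e8, Function.update_of_ne (by omega)]
    exact h.old j hj

/-- What `bfs` achieves. The set of visited vertices is the new part of the queue. -/
structure BfsPost (s : Store) (U : ℕ → Prop) (W : ℕ) (s' : Store) : Prop where
  lt : s.var 6 < s'.var 6
  old : ∀ j < s.var 6, s'.arr 8 j = s.arr 8 j
  out : ∀ i, i < s.var 11 ∨ s.var 11 + W ≤ i →
    s'.arr 6 i = s.arr 6 i ∧ s'.arr 7 i = s.arr 7 i
  inj : Set.InjOn (s'.arr 8) (Set.Ico (s.var 6) (s'.var 6))
  mem : ∀ j ∈ Set.Ico (s.var 6) (s'.var 6), U (s'.arr 8 j) ∧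
    s.arr 6 (s.var 11 + s'.arr 8 j) = 0 ∧ s'.arr 6 (s.var 11 + s'.arr 8 j) ≠ 0
  unmarked : ∀ x, (∀ j ∈ Set.Ico (s.var 6) (s'.var 6), s'.arr 8 j ≠ x) →
    s'.arr 6 (s.var 11 + x) = s.arr 6 (s.var 11 + x)
  src : s'.arr 8 (s.var 6) = s.var 12 ∧ s'.arr 6 (s.var 11 + s.var 12) = s.var 13
  par : ∀ j ∈ Set.Ioo (s.var 6) (s'.var 6), ∃ i ∈ Set.Ico (s.var 6) (s'.var 6),
    i < j ∧ s'.arr 7 (s.var 11 + s'.arr 8 j) = s'.arr 8 i ∧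
    Nb s (s.var 10) (s'.arr 8 i) (s'.arr 8 j) ∧
    s'.arr 6 (s.var 11 + s'.arr 8 j) = s'.arr 6 (s.var 11 + s'.arr 8 i) + s.var 14 ∧
    2 * s'.arr 6 (s.var 11 + s'.arr 8 j) < s.var 15
  closed : ∀ j ∈ Set.Ico (s.var 6) (s'.var 6),
    2 * (s'.arr 6 (s.var 11 + s'.arr 8 j) + s.var 14) < s.var 15 →
    ∀ x, Nb s (s.var 10) (s'.arr 8 j) x → s'.arr 6 (s.var 11 + x) ≠ 0 ∧
      (s.arr 6 (s.var 11 + x) = 0 →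
        s'.arr 6 (s.var 11 + x) ≤ s'.arr 6 (s.var 11 + s'.arr 8 j) + s.var 14)

/-- Marked vertices are skipped, so marks never change once they are nonzero. -/
theorem wp_bfsEdges {s0 s : Store} {U : ℕ → Prop} {W c : ℕ} (hUW : ∀ u, U u → u < W)
    (hUn : ∀ u x, U u → Nb s0 (s0.var 10) u x → U x) (hI : BfsInv s0 U W s c) (hc : c < s.var 6)
    (e1 : s.arr 1 = s0.arr 1) (e11 : s.var 11 = s0.var 11)
    (e17 : s.var 17 = s.arr 8 c) (e18 : s.var 18 = s0.arr 4 (s0.var 10 + s.arr 8 c))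
    (e19 : s.var 19 = s0.arr 5 (s0.var 10 + s.arr 8 c))
    (e20 : s.var 20 = s.arr 6 (s0.var 11 + s.arr 8 c) + s0.var 14)
    (hb : 2 * (s.arr 6 (s0.var 11 + s.arr 8 c) + s0.var 14) < s0.var 15) :
    s.var 18 ≤ s.var 19 → Wp (forUp 18 19 23 bfsEdge) s fun s' t => BfsInv s0 U W s' c ∧
      s.var 6 ≤ s'.var 6 ∧
      (∀ x, s.arr 6 (s0.var 11 + x) ≠ 0 →
        s'.arr 6 (s0.var 11 + x) = s.arr 6 (s0.var 11 + x)) ∧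
      (∀ j < s.var 6, s'.arr 8 j = s.arr 8 j) ∧
      (∀ x, Nb s0 (s0.var 10) (s.arr 8 c) x → s'.arr 6 (s0.var 11 + x) ≠ 0) ∧
      t ≤ 20 * rowLen s0 (s0.var 10) (s.arr 8 c) + 2 := by
  intro hle
  refine wp_forUp (fun e s' t => BfsInv s0 U W s' c ∧
      s.var 6 ≤ s'.var 6 ∧
      (∀ x, s.arr 6 (s0.var 11 + x) ≠ 0 →
        s'.arr 6 (s0.var 11 + x) = s.arr 6 (s0.var 11 + x)) ∧
      (∀ j < s.var 6, s'.arr 8 j = s.arr 8 j) ∧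
      (∀ e', s.var 18 ≤ e' → e' < e → s'.arr 6 (s0.var 11 + s0.arr 1 e') ≠ 0) ∧
      t ≤ 20 * (e - s.var 18)) (by decide) (by decide) (by decide) (by decide) (by decide) rfl rfl
      hle ?_ ?_ ?_
  · refine ⟨⟨hI.core, hI.out, hI.old⟩, le_rfl, fun _ _ => rfl, fun _ _ => rfl, ?_, by simp⟩
    intro e' h1 h2
    omega
  · rintro k s' t hk1 hk2 hk hF ⟨hI', h1, h2, h3, h4, h5⟩
    have f1 : s'.arr 1 = s0.arr 1 := (hF.arr 1 rfl).trans e1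
    have f11 : s'.var 11 = s0.var 11 := (hF.var 11 rfl).trans e11
    have f17 : s'.var 17 = s.arr 8 c := (hF.var 17 rfl).trans e17
    have f20 : s'.var 20 = s.arr 6 (s0.var 11 + s.arr 8 c) + s0.var 14 := (hF.var 20 rfl).trans e20
    have hUc := (hI.core.mem c hI.core.q0_le hc)
    have hnb : Nb s0 (s0.var 10) (s.arr 8 c) (s0.arr 1 k) := ⟨k, by omega, by omega, rfl⟩
    have hUx := hUn _ _ hUc.1 hnb
    simp only [bfsEdge, wp_seq, wp_load, wp_add, wp_cond, wp_skip, wp_store, wp_incr, setVar_var,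
      setVar_arr, setArr_arr, setArr_var, next_arr]
    simp only [hk, f1, f11, f17, f20]
    norm_num
    have h8 : s'.arr 8 c = s.arr 8 c := h3 c hc
    have h6 : s'.arr 6 (s0.var 11 + s.arr 8 c) = s.arr 6 (s0.var 11 + s.arr 8 c) := h2 _ hUc.2.2
    refine ⟨fun hx => ⟨?_, ?_, ?_, ?_, ?_, by omega⟩, fun hx => ⟨?_, ?_, ?_, ?_, ?_, by omega⟩⟩
    · refine ⟨?_, hI'.out, hI'.old⟩
      simpa [next_var] using hI'.core
    · simpa [next_var] using h1
    · exact h2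
    · exact h3
    · intro e' h7 h8
      rcases h8.lt_or_eq with h8 | rfl
      · exact h4 e' h7 h8
      · exact hx
    · refine hI'.push (by omega) (x := s0.arr 1 k) (h8 ▸ hnb) hUx (hUW _ hUx) hx
        (by rw [h8, h6]; exact hb) ?_ ?_ ?_ ?_
      · simp [h8, h6]
      · simp [h8]
      · simp
      · simp [next_var]
    · simp [next_var]; omega
    · intro x hx'
      rw [Function.update_of_ne, h2 x hx']
      intro e
      rw [Nat.add_left_cancel e] at hx'
      rw [← h2 _ hx'] at hx'
      exact hx' hx
    · intro j hj
      rw [Function.update_of_ne (by omega), h3 j hj]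
    · intro e' h7 h8
      rw [Function.update_apply]
      split
      · omega
      · rename_i hne
        rcases h8.lt_or_eq with h8 | rfl
        · exact h4 e' h7 h8
        · exact absurd rfl hne
  · rintro s' t ⟨hI', h1, h2, h3, h4, h5⟩ - -
    refine ⟨hI', h1, h2, h3, ?_, ?_⟩
    · rintro x ⟨e, a1, a2, rfl⟩
      exact h4 e (by omega) (by omega)
    · rw [rowLen]; omega

theorem BfsInv.congr {s0 s s' : Store} {U : ℕ → Prop} {W c : ℕ} (h : BfsInv s0 U W s c)
    (ha : s'.arr = s.arr) (hv : s'.var 6 = s.var 6) : BfsInv s0 U W s' c :=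
  ⟨by rw [ha, hv]; exact h.core, by rw [ha]; exact h.out, by rw [ha]; exact h.old⟩

theorem Expanded.step {s0 s s' : Store} {U : ℕ → Prop} {W c : ℕ}
    (he : Expanded (Nb s0 (s0.var 10)) (fun x => s0.arr 6 (s0.var 11 + x))
      (fun x => s.arr 6 (s0.var 11 + x)) (s.arr 8) (s0.var 14) (s0.var 15) (s0.var 6) c)
    (hI : BfsInv s0 U W s c) (hI' : BfsInv s0 U W s' c) (hc : c < s.var 6)
    (hle : s.var 6 ≤ s'.var 6)
    (h6 : ∀ x, s.arr 6 (s0.var 11 + x) ≠ 0 → s'.arr 6 (s0.var 11 + x) = s.arr 6 (s0.var 11 + x))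
    (h8 : ∀ j < s.var 6, s'.arr 8 j = s.arr 8 j)
    (hn : 2 * (s.arr 6 (s0.var 11 + s.arr 8 c) + s0.var 14) < s0.var 15 →
      ∀ x, Nb s0 (s0.var 10) (s.arr 8 c) x → s'.arr 6 (s0.var 11 + x) ≠ 0) :
    Expanded (Nb s0 (s0.var 10)) (fun x => s0.arr 6 (s0.var 11 + x))
      (fun x => s'.arr 6 (s0.var 11 + x)) (s'.arr 8) (s0.var 14) (s0.var 15) (s0.var 6)
      (c + 1) := by
  intro j h1 h2 hb x hx
  have hj : j < s.var 6 := by omega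
  have hm := (hI.core.mem j h1 hj).2.2
  simp only [h8 j hj, h6 _ hm] at hb hx ⊢
  rcases Nat.lt_succ_iff_lt_or_eq.1 h2 with h2 | h2
  · obtain ⟨a1, a2⟩ := he j h1 (by omega) hb x hx
    rw [h6 x a1]
    exact ⟨a1, a2⟩
  · obtain rfl : j = c := by omega
    refine ⟨hn hb x hx, fun h0 => ?_⟩
    -- A neighbour marked during this search is in the queue, where no mark exceeds that of the
    -- front by more than the increment.
    obtain ⟨i, b1, b2, rfl⟩ := hI'.core.exists_of_val (hn hb x hx) h0
    have := hI'.core.front (by omega) i b1 b2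
    simpa only [h8 j hj, h6 _ hm] using this

theorem wp_bfsStep {s0 s : Store} {U : ℕ → Prop} {W : ℕ} (hUW : ∀ u, U u → u < W)
    (hUn : ∀ u x, U u → Nb s0 (s0.var 10) u x → U x)
    (hst : ∀ u, U u → s0.arr 4 (s0.var 10 + u) ≤ s0.arr 5 (s0.var 10 + u))
    (hI : BfsInv s0 U W s (s.var 16)) (hc : s.var 16 < s.var 6)
    (he : Expanded (Nb s0 (s0.var 10)) (fun x => s0.arr 6 (s0.var 11 + x))
      (fun x => s.arr 6 (s0.var 11 + x)) (s.arr 8) (s0.var 14) (s0.var 15) (s0.var 6) (s.var 16))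
    (e1 : s.arr 1 = s0.arr 1) (e4 : s.arr 4 = s0.arr 4) (e5 : s.arr 5 = s0.arr 5)
    (e10 : s.var 10 = s0.var 10) (e11 : s.var 11 = s0.var 11) (e14 : s.var 14 = s0.var 14)
    (e15 : s.var 15 = s0.var 15) :
    Wp bfsStep s fun s' t => BfsInv s0 U W s' (s.var 16 + 1) ∧ s'.var 16 = s.var 16 + 1 ∧
      Expanded (Nb s0 (s0.var 10)) (fun x => s0.arr 6 (s0.var 11 + x))
        (fun x => s'.arr 6 (s0.var 11 + x)) (s'.arr 8) (s0.var 14) (s0.var 15) (s0.var 6)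
        (s.var 16 + 1) ∧ (∀ j < s.var 6, s'.arr 8 j = s.arr 8 j) ∧
      t ≤ 20 * rowLen s0 (s0.var 10) (s.arr 8 (s.var 16)) + 16 := by
  simp only [bfsStep, wp_seq, wp_load, wp_incr, wp_add, wp_sub, wp_cond, wp_skip, setVar_var,
    setVar_arr]
  norm_num
  simp only [e10, e11, e14, e15, e4, e5]
  have hUc := (hI.core.mem _ hI.core.q0_le hc)
  refine ⟨fun hb => ?_, fun hb => ?_⟩
  · refine Wp.mono (Wp.frame (wp_bfsEdges hUW hUn (hI.congr rfl (by simp)) (by simpa using hc) e1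
      (by simpa using e11) (by simp) (by simp) (by simp) (by simp) (by simp only [setVar_arr]; omega)
      (by simpa using hst _ hUc.1))) ?_
    rintro s' t ⟨⟨h1, h2, h3, h4, h5, h6⟩, hF⟩
    simp only [setVar_var, setVar_arr] at h2 h3 h4 h5 h6
    norm_num at h2 h4
    have h16 := hF.var 16 rfl
    simp only [setVar_var] at h16
    norm_num at h16
    refine ⟨⟨h1.core.advance (by omega), h1.out, h1.old⟩, h16,
      he.step hI h1 hc h2 h3 h4 (fun _ => h5), h4, by omega⟩
  · have h1 : BfsInv s0 U W s (s.var 16 + 1) := ⟨hI.core.advance (by omega), hI.out, hI.old⟩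
    exact ⟨h1.congr rfl (by simp),
      he.step hI hI hc le_rfl (fun _ _ => rfl) (fun _ _ => rfl) (fun h => by omega)⟩

theorem BfsInv.post {s0 s : Store} {U : ℕ → Prop} {W c : ℕ} (h : BfsInv s0 U W s c)
    (hc : s.var 6 ≤ c)
    (he : Expanded (Nb s0 (s0.var 10)) (fun x => s0.arr 6 (s0.var 11 + x))
      (fun x => s.arr 6 (s0.var 11 + x)) (s.arr 8) (s0.var 14) (s0.var 15) (s0.var 6) c) :
    BfsPost s0 U W s where
  lt := h.core.q0_lt
  old := h.old
  out := h.out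
  inj i hi j hj e := h.core.inj i j hi.1 hi.2 hj.1 hj.2 e
  mem j hj := h.core.mem j hj.1 hj.2
  unmarked x hx := h.core.out x fun j h1 h2 => hx j ⟨h1, h2⟩
  src := ⟨h.core.q_src, h.core.val_src⟩
  par j hj := by
    obtain ⟨i, h1, h2, h3⟩ := h.core.par j hj.1 hj.2
    exact ⟨i, ⟨h1, h2.trans hj.2⟩, h2, h3⟩
  closed j hj hb x hx := he j hj.1 (hj.2.trans_le hc) hb x hx

/-- Vertices marked beforehand act as barriers. With increment 1 the marks are distances from the
source, with increment 0 a common label of all that is reached. Charging the time to the growth of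
`pot` lets the bounds of successive searches in one row telescope. -/
theorem wp_bfs {s : Store} {U : ℕ → Prop} {W : ℕ} (hUW : ∀ u, U u → u < W)
    (hUn : ∀ u x, U u → Nb s (s.var 10) u x → U x)
    (hst : ∀ u, U u → s.arr 4 (s.var 10 + u) ≤ s.arr 5 (s.var 10 + u))
    (hsrc : U (s.var 12)) (h0 : s.arr 6 (s.var 11 + s.var 12) = 0) (hv : s.var 13 ≠ 0) :
    Wp bfs s fun s' t => BfsPost s U W s' ∧
      t + 20 * pot s (s.var 10) (s.var 11) W ≤ 20 * pot s' (s.var 10) (s.var 11) W + 20 := by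
  simp only [bfs, wp_seq, wp_incr, wp_add, wp_sub, wp_store, wp_copy, setVar_var,
    setArr_var]
  norm_num
  refine wp_loop (fun s' t => BfsInv s U W s' (s'.var 16) ∧
      Expanded (Nb s (s.var 10)) (fun x => s.arr 6 (s.var 11 + x))
        (fun x => s'.arr 6 (s.var 11 + x)) (s'.arr 8) (s.var 14) (s.var 15) (s.var 6)
        (s'.var 16) ∧ s'.var 22 = s'.var 6 - s'.var 16 ∧
      t ≤ 20 * ∑ j ∈ Finset.Ico (s.var 6) (s'.var 16), (rowLen s (s.var 10) (s'.arr 8 j) + 1))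
    -- The front advances in every round and cannot pass the bound of `BfsCore.tl_le`.
    (fun s' => s.var 6 + ∑ x ∈ Finset.range W, (rowLen s (s.var 10) x + 1) - s'.var 16) ?_ ?_ ?_
  · simp only [setVar_var, setVar_arr, setArr_var, setArr_arr]
    norm_num
    refine ⟨⟨?_, ?_, ?_⟩, ?_⟩
    · simp only [setVar_var, setVar_arr, setArr_var, setArr_arr]
      norm_num
      rw [update_add_left]
      exact BfsCore.init hsrc (hUW _ hsrc) h0 hv
    · intro i hi
      have := hUW _ hsrc
      simp only [setVar_arr, setArr_arr]
      norm_num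
      rw [Function.update_of_ne (by omega)]
    · intro j hj
      simp only [setVar_arr, setArr_arr]
      norm_num
      rw [Function.update_of_ne (by omega)]
    · intro j h1 h2
      omega
  · rintro s' t hF ⟨hI, he, h22, ht⟩ hne
    rw [wp_seq]
    have hc : s'.var 16 < s'.var 6 := by omega
    have e1 := hF.arr 1 rfl
    have e4 := hF.arr 4 rfl
    have e5 := hF.arr 5 rfl
    have e10 := hF.var 10 rfl
    have e11 := hF.var 11 rfl
    have e14 := hF.var 14 rfl
    have e15 := hF.var 15 rfl
    simp only [setVar_var, setVar_arr, setArr_var, setArr_arr] at e1 e4 e5 e10 e11 e14 e15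
    norm_num at e1 e4 e5 e10 e11 e14 e15
    refine (wp_bfsStep hUW hUn hst hI hc he e1 e4 e5 e10 e11 e14 e15).mono ?_
    rintro s'' t' ⟨h1, h2, h3, h4, h5⟩
    rw [wp_sub]
    have htl := h1.core.tl_le
    have hle := h1.core.le_tl
    have hq := hI.core.q0_le
    refine ⟨⟨?_, ?_, ?_, ?_⟩, ?_⟩
    · simp only [setVar_var]
      norm_num
      rw [h2]
      exact h1.congr rfl (by simp)
    · simp only [setVar_var, setVar_arr]
      norm_num
      rw [h2]
      exact h3
    · simp
    · simp only [setVar_var, setVar_arr]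
      norm_num
      rw [h2, Finset.sum_Ico_succ_top hq, h4 _ hc, Finset.sum_congr rfl fun j hj => by
        rw [h4 j (by have := (Finset.mem_Ico.1 hj).2; omega)]]
      omega
    · simp only [setVar_var]
      norm_num
      omega
  · rintro s' t hF ⟨hI, he, h22, ht⟩ h0'
    have hle := hI.core.le_tl
    have e16 : s'.var 16 = s'.var 6 := by omega
    refine ⟨hI.post e16.ge he, ?_⟩
    have hp := hI.core.pot
    have e4 := hF.arr 4 rfl
    have e5 := hF.arr 5 rfl
    simp only [setVar_arr, setArr_arr] at e4 e5
    norm_num at e4 e5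
    have hr : rowLen s' (s.var 10) = rowLen s (s.var 10) := by
      funext u
      simp only [rowLen, e4, e5]
    rw [e16] at ht
    simp only [pot, hr]
    omega

end Search
end LocalSep

namespace LocalSep

open Relation

/-! ### Writing adjacency lists of balls and of linked copies -/

section Build

theorem nb_congr {s s' : Store} {g g' u u' p : ℕ} (h4 : s'.arr 4 (g' + u') = s.arr 4 (g + u))
    (h5 : s'.arr 5 (g' + u') = s.arr 5 (g + u)) (hp : s.arr 5 (g + u) ≤ p)
    (h1 : ∀ i < p, s'.arr 1 i = s.arr 1 i) (x : ℕ) : Nb s' g' u' x ↔ Nb s g u x := by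
  simp only [Nb, h4, h5]
  exact exists_congr fun e => and_congr_right fun _ => and_congr_right fun h => by
    rw [h1 e (by omega)]

/-- Copy the neighbour at position 42 if it satisfies the distance condition. -/
def buildEdge : Prog :=
  .seq (.load 44 1 42) <| .seq (.add 47 36 44) <| .seq (.load 47 6 47) <|
    .cond 47 (.seq (.add 47 47 40) <| .seq (.const 48 2) <| .seq (.add 48 48 1) <|
      .seq (.sub 48 48 47) <|
      .cond 48 (.seq (.add 47 33 44) <| .seq (.store 1 4 47) (incr 4)) .skip) .skip

/-- Append the link between the two copies of the vertex in register 39 if it is close. -/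
def buildLink : Prog :=
  .seq (.add 47 37 39) <| .seq (.load 47 6 47) <|
    .cond 47 (.seq (.add 47 47 40) <| .seq (.add 47 47 38) <| .seq (.const 48 4) <|
      .seq (.add 48 48 1) <| .seq (.sub 48 48 47) <|
      .cond 48 (.seq (.add 47 34 39) <| .seq (.store 1 4 47) (incr 4)) .skip) .skip

/-- Write the adjacency list of the vertex at position 30 of array 8. -/
def buildStep : Prog :=
  .seq (.load 39 8 30) <| .seq (.add 47 36 39) <| .seq (.load 40 6 47) <|
    .seq (.add 41 35 33) <| .seq (.add 41 41 39) <| .seq (.add 47 32 39) <|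
    .seq (.load 42 4 47) <| .seq (.load 43 5 47) <| .seq (.store 4 41 4) <|
    .seq (forUp 42 43 46 buildEdge) <| .seq buildLink (.store 5 41 4)

/-- For every vertex `u` in the positions from 30 to 31 of array 8, write an adjacency list of the
vertex `o + u` to the row 35, where `o` is in register 33. It consists of the neighbours of `u`
in the row 32 that satisfy a distance condition with respect to the row 36 of array 6, shifted by `o`,
and possibly of `o' + u`, where `o'` is in register 34. -/
def build : Prog := forUp 30 31 45 buildStep

/-- An edge to `x` from a vertex with mark `m` is in the ball whose marks are in row `r`. -/
abbrev InBall (s : Store) (r m x : ℕ) : Prop :=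
  s.arr 6 (r + x) ≠ 0 ∧ s.arr 6 (r + x) + m < s.var 1 + 2

/-- The vertex `u` with mark `m` in one ball and a mark in row `r` for another ball with mark `k` for
the distance between the centres is close to the two centres. -/
abbrev IsLinked (s : Store) (r m k u : ℕ) : Prop :=
  s.arr 6 (r + u) ≠ 0 ∧ s.arr 6 (r + u) + m + k < s.var 1 + 4

/-- Register 4 is the first free position of array 1. New lists are only appended, so the lists
already written below it remain valid. -/
theorem wp_buildEdges {s : Store} (h18 : s.var 42 ≤ s.var 43) (hp : s.var 43 ≤ s.var 4) :
    Wp (forUp 42 43 46 buildEdge) s fun s' t =>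
      s'.var 4 = s.var 4 + (∑ e ∈ Finset.Ico (s.var 42) (s.var 43),
        if InBall s (s.var 36) (s.var 40) (s.arr 1 e) then 1 else 0) ∧
      (∀ i < s.var 4, s'.arr 1 i = s.arr 1 i) ∧
      (∀ y, (∃ i, s.var 4 ≤ i ∧ i < s'.var 4 ∧ s'.arr 1 i = y) ↔
        ∃ e, s.var 42 ≤ e ∧ e < s.var 43 ∧ InBall s (s.var 36) (s.var 40) (s.arr 1 e) ∧
          y = s.var 33 + s.arr 1 e) ∧
      t ≤ 20 * (s.var 43 - s.var 42) + 2 := by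
  refine wp_forUp (fun k s' t => s'.var 4 = s.var 4 + (∑ e ∈ Finset.Ico (s.var 42) k,
        if InBall s (s.var 36) (s.var 40) (s.arr 1 e) then 1 else 0) ∧
      (∀ i < s.var 4, s'.arr 1 i = s.arr 1 i) ∧
      (∀ y, (∃ i, s.var 4 ≤ i ∧ i < s'.var 4 ∧ s'.arr 1 i = y) ↔
        ∃ e, s.var 42 ≤ e ∧ e < k ∧ InBall s (s.var 36) (s.var 40) (s.arr 1 e) ∧
          y = s.var 33 + s.arr 1 e) ∧
      t ≤ 20 * (k - s.var 42)) (by decide) (by decide) (by decide) (by decide) (by decide) rfl rfl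
      h18 ?_ ?_ ?_
  · refine ⟨by simp, fun _ _ => rfl, fun y => ?_, by simp⟩
    constructor
    · rintro ⟨i, h1, h2, -⟩
      simp at h2
      omega
    · rintro ⟨i, h1, h2, -⟩
      omega
  · rintro k s' t hk1 hk2 hk hF ⟨h1, h2, h3, h4⟩
    have f6 := hF.arr 6 rfl
    have f36 := hF.var 36 rfl
    have f40 := hF.var 40 rfl
    have f33 := hF.var 33 rfl
    have f1 := hF.var 1 rfl
    have fe : s'.arr 1 k = s.arr 1 k := h2 k (by omega)
    simp only [buildEdge, wp_seq, wp_load, wp_add, wp_const, wp_sub, wp_cond, wp_skip, wp_store,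
      wp_incr, setVar_var, Nat.reduceEqDiff, ↓reduceIte, setVar_arr, setArr_arr, setArr_var, next_arr, next_var]
    simp only [hk, f6, f36, f40, f33, f1, fe]
    have hno : ¬ InBall s (s.var 36) (s.var 40) (s.arr 1 k) → ∀ y,
        ((∃ e, s.var 42 ≤ e ∧ e < k + 1 ∧ InBall s (s.var 36) (s.var 40) (s.arr 1 e) ∧
          y = s.var 33 + s.arr 1 e) ↔ ∃ e, s.var 42 ≤ e ∧ e < k ∧
          InBall s (s.var 36) (s.var 40) (s.arr 1 e) ∧ y = s.var 33 + s.arr 1 e) := by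
      intro hn y
      constructor
      · rintro ⟨e, a1, a2, a3, a4⟩
        refine ⟨e, a1, ?_, a3, a4⟩
        rcases Nat.lt_succ_iff_lt_or_eq.1 a2 with a2 | rfl
        · exact a2
        · exact absurd a3 hn
      · rintro ⟨e, a1, a2, a3, a4⟩
        exact ⟨e, a1, by omega, a3, a4⟩
    refine ⟨fun hx => ⟨fun hx' => ?_, fun hx' => ?_⟩, fun hx => ?_⟩
    · have hin : InBall s (s.var 36) (s.var 40) (s.arr 1 k) := ⟨hx, by omega⟩
      refine ⟨?_, ?_, ?_, by omega⟩
      · rw [Finset.sum_Ico_succ_top hk1, if_pos hin, h1]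
        rfl
      · intro i hi
        rw [Function.update_of_ne (by omega), h2 i hi]
      · intro y
        constructor
        · rintro ⟨i, a1, a2, a3⟩
          rcases Nat.lt_succ_iff_lt_or_eq.1 a2 with a2 | rfl
          · rw [Function.update_of_ne (by omega)] at a3
            obtain ⟨e, b1, b2, b3⟩ := (h3 y).1 ⟨i, a1, a2, a3⟩
            exact ⟨e, b1, by omega, b3⟩
          · rw [Function.update_self] at a3
            exact ⟨k, hk1, by omega, hin, a3.symm⟩
        · rintro ⟨e, a1, a2, a3, a4⟩
          rcases Nat.lt_succ_iff_lt_or_eq.1 a2 with a2 | rfl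
          · obtain ⟨i, b1, b2, b3⟩ := (h3 y).2 ⟨e, a1, a2, a3, a4⟩
            exact ⟨i, b1, by omega, by rw [Function.update_of_ne (by omega), b3]⟩
          · exact ⟨s'.var 4, by omega, by omega, by rw [Function.update_self, a4]⟩
    · have hin : ¬ InBall s (s.var 36) (s.var 40) (s.arr 1 k) := fun h => by have := h.2; omega
      refine ⟨?_, h2, fun y => (h3 y).trans (hno hin y).symm, by omega⟩
      rw [Finset.sum_Ico_succ_top hk1, if_neg hin, h1]
      rfl
    · have hin : ¬ InBall s (s.var 36) (s.var 40) (s.arr 1 k) := fun h => h.1 hx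
      refine ⟨?_, h2, fun y => (h3 y).trans (hno hin y).symm, by omega⟩
      rw [Finset.sum_Ico_succ_top hk1, if_neg hin, h1]
      rfl
  · rintro s' t ⟨h1, h2, h3, h4⟩ - -
    exact ⟨h1, h2, h3, by omega⟩

theorem wp_buildLink {s : Store} :
    Wp buildLink s fun s' t =>
      s'.var 4 = s.var 4 + (if IsLinked s (s.var 37) (s.var 40) (s.var 38) (s.var 39)
        then 1 else 0) ∧
      (∀ i < s.var 4, s'.arr 1 i = s.arr 1 i) ∧
      (IsLinked s (s.var 37) (s.var 40) (s.var 38) (s.var 39) →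
        s'.arr 1 (s.var 4) = s.var 34 + s.var 39) ∧ t ≤ 14 := by
  simp only [buildLink, wp_seq, wp_load, wp_add, wp_const, wp_sub, wp_cond, wp_skip, wp_store,
      wp_incr, setVar_var, Nat.reduceEqDiff, ↓reduceIte, setVar_arr, setArr_arr, setArr_var]
  refine ⟨fun hx => ⟨fun hx' => ?_, fun hx' => ?_⟩, fun hx => ?_⟩
  · rw [if_pos ⟨hx, by omega⟩]
    exact ⟨rfl, fun i hi => Function.update_of_ne (by omega) _ _, fun _ => Function.update_self _ _ _,
      by omega⟩
  · have : ¬ IsLinked s (s.var 37) (s.var 40) (s.var 38) (s.var 39) := fun h => by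
      have := h.2; omega
    rw [if_neg this]
    exact ⟨rfl, fun _ _ => trivial, fun h => absurd h this, by omega⟩
  · rw [if_neg fun h => h.1 hx]
    exact ⟨rfl, fun _ _ => trivial, fun h => absurd hx h.1, by omega⟩

/-- Row `h + o` at `u` of the storage `s'` holds the adjacency list that `build`, started in `s`,
writes for `u`. -/
structure BuiltRow (s s' : Store) (u : ℕ) : Prop where
  le : s'.arr 4 (s.var 35 + s.var 33 + u) ≤ s'.arr 5 (s.var 35 + s.var 33 + u)
  le_ptr : s'.arr 5 (s.var 35 + s.var 33 + u) ≤ s'.var 4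
  nb : ∀ y, Nb s' (s.var 35 + s.var 33) u y ↔
    (∃ x, Nb s (s.var 32) u x ∧ InBall s (s.var 36) (s.arr 6 (s.var 36 + u)) x ∧
      y = s.var 33 + x) ∨
    (IsLinked s (s.var 37) (s.arr 6 (s.var 36 + u)) (s.var 38) u ∧ y = s.var 34 + u)
  len : rowLen s' (s.var 35 + s.var 33) u ≤
    (∑ e ∈ Finset.Ico (s.arr 4 (s.var 32 + u)) (s.arr 5 (s.var 32 + u)),
      if InBall s (s.var 36) (s.arr 6 (s.var 36 + u)) (s.arr 1 e) then 1 else 0) +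
    if IsLinked s (s.var 37) (s.arr 6 (s.var 36 + u)) (s.var 38) u then 1 else 0

theorem BuiltRow.congr {s s' s'' : Store} {u : ℕ} (h : BuiltRow s s' u)
    (h4 : s''.arr 4 (s.var 35 + s.var 33 + u) = s'.arr 4 (s.var 35 + s.var 33 + u))
    (h5 : s''.arr 5 (s.var 35 + s.var 33 + u) = s'.arr 5 (s.var 35 + s.var 33 + u))
    (h1 : ∀ i < s'.var 4, s''.arr 1 i = s'.arr 1 i) (hp : s'.var 4 ≤ s''.var 4) :
    BuiltRow s s'' u where
  le := by rw [h4, h5]; exact h.le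
  le_ptr := by rw [h5]; exact h.le_ptr.trans hp
  nb y := (nb_congr h4 h5 h.le_ptr h1 y).trans (h.nb y)
  len := by rw [rowLen, h4, h5]; exact h.len

theorem wp_buildStep {s : Store}
    (hle : s.arr 4 (s.var 32 + s.arr 8 (s.var 30)) ≤ s.arr 5 (s.var 32 + s.arr 8 (s.var 30)))
    (hp : s.arr 5 (s.var 32 + s.arr 8 (s.var 30)) ≤ s.var 4) :
    Wp buildStep s fun s' t => BuiltRow s s' (s.arr 8 (s.var 30)) ∧ s.var 4 ≤ s'.var 4 ∧
      (∀ i < s.var 4, s'.arr 1 i = s.arr 1 i) ∧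
      (∀ i ≠ s.var 35 + s.var 33 + s.arr 8 (s.var 30),
        s'.arr 4 i = s.arr 4 i ∧ s'.arr 5 i = s.arr 5 i) ∧
      t ≤ 20 * rowLen s (s.var 32) (s.arr 8 (s.var 30)) + 26 := by
  simp only [buildStep, wp_seq, wp_load, wp_add, wp_store, setVar_var, Nat.reduceEqDiff, ↓reduceIte, setVar_arr, setArr_arr,
    setArr_var]
  refine Wp.mono (Wp.frame (wp_buildEdges (by simpa using hle) (by simpa using hp))) ?_
  rintro s₁ t₁ ⟨⟨h1, h2, h3, h4⟩, hF⟩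
  refine Wp.mono (Wp.frame wp_buildLink) ?_
  rintro s₂ t₂ ⟨⟨k1, k2, k3, k4⟩, kF⟩
  have f1 := hF.var 1 rfl
  have f34 := hF.var 34 rfl
  have f37 := hF.var 37 rfl
  have f38 := hF.var 38 rfl
  have f39 := hF.var 39 rfl
  have f40 := hF.var 40 rfl
  have f41 := (kF.var 41 rfl).trans (hF.var 41 rfl)
  have f6 := hF.arr 6 rfl
  have f4 := (kF.arr 4 rfl).trans (hF.arr 4 rfl)
  have f5 := (kF.arr 5 rfl).trans (hF.arr 5 rfl)
  simp only [setVar_var, Nat.reduceEqDiff, ↓reduceIte, setVar_arr, setArr_arr, setArr_var] at f1 f34 f37 f38 f39 f40 f41 f6 f4 f5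
  simp only [setVar_var, Nat.reduceEqDiff, ↓reduceIte, setVar_arr, setArr_arr, setArr_var, InBall] at h1 h2 h3 h4
  simp only [IsLinked, f1, f34, f37, f38, f39, f40, f6] at k1 k2 k3
  have e4 : ((s₂.setArr 5 (s₂.var 41) (s₂.var 4)).arr 4) (s.var 35 + s.var 33 +
      s.arr 8 (s.var 30)) = s.var 4 := by simp [f4]
  have e5 : ((s₂.setArr 5 (s₂.var 41) (s₂.var 4)).arr 5) (s.var 35 + s.var 33 +
      s.arr 8 (s.var 30)) = s₂.var 4 := by simp [f41]
  have e1 : (s₂.setArr 5 (s₂.var 41) (s₂.var 4)).arr 1 = s₂.arr 1 := by simp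
  refine ⟨⟨?_, ?_, ?_, ?_⟩, ?_, ?_, ?_, ?_⟩
  · rw [e4, e5]; omega
  · rw [e5, setArr_var]
  · intro y
    simp only [Nb, e4, e5, e1]
    have hold : (∃ i, s.var 4 ≤ i ∧ i < s₁.var 4 ∧ s₂.arr 1 i = y) ↔
        ∃ i, s.var 4 ≤ i ∧ i < s₁.var 4 ∧ s₁.arr 1 i = y :=
      exists_congr fun i => and_congr_right fun _ => and_congr_right fun h => by rw [k2 i h]
    -- The link, if there is one, is the last entry of the new list.
    have hsplit : (∃ i, s.var 4 ≤ i ∧ i < s₂.var 4 ∧ s₂.arr 1 i = y) ↔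
        (∃ i, s.var 4 ≤ i ∧ i < s₁.var 4 ∧ s₂.arr 1 i = y) ∨
          (IsLinked s (s.var 37) (s.arr 6 (s.var 36 + s.arr 8 (s.var 30))) (s.var 38)
            (s.arr 8 (s.var 30)) ∧ y = s.var 34 + s.arr 8 (s.var 30)) := by
      constructor
      · rintro ⟨i, a1, a2, a3⟩
        by_cases hi : i < s₁.var 4
        · exact Or.inl ⟨i, a1, hi, a3⟩
        · right
          split at k1
          · rename_i hl
            obtain rfl : i = s₁.var 4 := by omega
            exact ⟨hl, by rw [← a3, k3 hl]⟩
          · omega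
      · rintro (⟨i, a1, a2, a3⟩ | ⟨hl, rfl⟩)
        · exact ⟨i, a1, by omega, a3⟩
        · rw [if_pos hl] at k1
          exact ⟨s₁.var 4, by omega, by omega, k3 hl⟩
    rw [hsplit, hold, h3 y]
    refine or_congr_left ?_
    constructor
    · rintro ⟨e, a1, a2, a3, a4⟩
      exact ⟨s.arr 1 e, ⟨e, a1, a2, rfl⟩, a3, a4⟩
    · rintro ⟨x, ⟨e, a1, a2, rfl⟩, a3, a4⟩
      exact ⟨e, a1, a2, a3, a4⟩
  · rw [rowLen, e4, e5, k1, h1]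
    simp only [InBall, IsLinked]
    omega
  · omega
  · intro i hi
    rw [k2 i (by omega), h2 i hi]
  · intro i hi
    rw [f4, f5, f41, Function.update_of_ne hi, Function.update_of_ne hi]
    exact ⟨rfl, rfl⟩
  · rw [rowLen]; omega

/-- What `build` achieves. -/
structure BuildPost (s s' : Store) : Prop where
  row : ∀ j ∈ Set.Ico (s.var 30) (s.var 31), BuiltRow s s' (s.arr 8 j)
  ptr_le : s.var 4 ≤ s'.var 4
  old : ∀ i < s.var 4, s'.arr 1 i = s.arr 1 i
  out : ∀ i, (∀ j ∈ Set.Ico (s.var 30) (s.var 31), i ≠ s.var 35 + s.var 33 + s.arr 8 j) →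
    s'.arr 4 i = s.arr 4 i ∧ s'.arr 5 i = s.arr 5 i

/-- The rows read lie below the rows written, and the vertices listed are distinct, so no row is
overwritten before it is read and none is written twice. -/
theorem wp_build {s : Store} (hlh : s.var 30 ≤ s.var 31)
    (hinj : Set.InjOn (s.arr 8) (Set.Ico (s.var 30) (s.var 31)))
    (hrow : ∀ j ∈ Set.Ico (s.var 30) (s.var 31), s.var 32 + s.arr 8 j < s.var 35 ∧
      s.arr 4 (s.var 32 + s.arr 8 j) ≤ s.arr 5 (s.var 32 + s.arr 8 j) ∧
      s.arr 5 (s.var 32 + s.arr 8 j) ≤ s.var 4) :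
    Wp build s fun s' t => BuildPost s s' ∧
      t ≤ 30 * (∑ j ∈ Finset.Ico (s.var 30) (s.var 31), (rowLen s (s.var 32) (s.arr 8 j) + 1)) + 2 := by
  refine wp_forUp (fun k s' t =>
      (∀ j ∈ Set.Ico (s.var 30) k, BuiltRow s s' (s.arr 8 j)) ∧ s.var 4 ≤ s'.var 4 ∧
      (∀ i < s.var 4, s'.arr 1 i = s.arr 1 i) ∧
      (∀ i, (∀ j ∈ Set.Ico (s.var 30) k, i ≠ s.var 35 + s.var 33 + s.arr 8 j) →
        s'.arr 4 i = s.arr 4 i ∧ s'.arr 5 i = s.arr 5 i) ∧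
      t ≤ 30 * (∑ j ∈ Finset.Ico (s.var 30) k, (rowLen s (s.var 32) (s.arr 8 j) + 1)))
      (by decide) (by decide) (by decide) (by decide) (by decide) rfl rfl hlh ?_ ?_ ?_
  · refine ⟨fun j hj => absurd hj.1 (not_le.2 hj.2), by simp, fun _ _ => rfl, fun _ _ => ⟨rfl, rfl⟩,
      by simp⟩
  · rintro k s' t hk1 hk2 hk hF ⟨h1, h2, h3, h4, h5⟩
    have f1 := hF.var 1 rfl
    have f32 := hF.var 32 rfl
    have f33 := hF.var 33 rfl
    have f34 := hF.var 34 rfl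
    have f35 := hF.var 35 rfl
    have f36 := hF.var 36 rfl
    have f37 := hF.var 37 rfl
    have f38 := hF.var 38 rfl
    have f6 := hF.arr 6 rfl
    have f8 := hF.arr 8 rfl
    obtain ⟨r1, r2, r3⟩ := hrow k ⟨hk1, hk2⟩
    -- The source row lies below row 35, where all writing takes place.
    have hst : s'.arr 4 (s.var 32 + s.arr 8 k) = s.arr 4 (s.var 32 + s.arr 8 k) ∧
        s'.arr 5 (s.var 32 + s.arr 8 k) = s.arr 5 (s.var 32 + s.arr 8 k) :=
      h4 _ fun j hj => by omega
    refine Wp.mono (Wp.frame (wp_buildStep (by rw [hk, f32, f8, hst.1, hst.2]; exact r2)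
      (by rw [hk, f32, f8, hst.2]; omega))) ?_
    rintro s'' t' ⟨⟨k1, k2, k3, k4, k5⟩, kF⟩
    have hrl : rowLen s' (s.var 32) (s.arr 8 k) = rowLen s (s.var 32) (s.arr 8 k) := by
      rw [rowLen, rowLen, hst.1, hst.2]
    simp only [hk, f8, f35, f33, f32, hrl] at k1 k4 k5
    have e4 : (s''.next 30 31 45).var 4 = s''.var 4 := by simp [next_var]
    refine ⟨?_, ?_, ?_, ?_, ?_⟩
    · intro j hj
      rcases Nat.lt_succ_iff_lt_or_eq.1 hj.2 with hjk | rfl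
      · have hne : s.arr 8 j ≠ s.arr 8 k := fun e =>
          hjk.ne (hinj ⟨hj.1, by omega⟩ ⟨hk1, hk2⟩ e)
        obtain ⟨a1, a2⟩ := k4 (s.var 35 + s.var 33 + s.arr 8 j) (by omega)
        exact (h1 j ⟨hj.1, hjk⟩).congr a1 a2 k3 (by omega)
      · obtain ⟨b1, b2, b3, b4⟩ := k1
        have hnb : ∀ x, Nb s' (s.var 32) (s.arr 8 j) x ↔ Nb s (s.var 32) (s.arr 8 j) x :=
          nb_congr hst.1 hst.2 r3 h3
        have hsum : (∑ e ∈ Finset.Ico (s.arr 4 (s.var 32 + s.arr 8 j))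
            (s.arr 5 (s.var 32 + s.arr 8 j)),
            if InBall s (s.var 36) (s.arr 6 (s.var 36 + s.arr 8 j)) (s'.arr 1 e) then 1 else 0) =
            ∑ e ∈ Finset.Ico (s.arr 4 (s.var 32 + s.arr 8 j)) (s.arr 5 (s.var 32 + s.arr 8 j)),
            if InBall s (s.var 36) (s.arr 6 (s.var 36 + s.arr 8 j)) (s.arr 1 e) then 1 else 0 :=
          Finset.sum_congr rfl fun e he => by
            rw [h3 e (by have := (Finset.mem_Ico.1 he).2; omega)]
        simp only [f32, f33, f34, f35, f36, f37, f38, InBall, IsLinked, f1, f6, hnb, hst] at b1 b2 b3 b4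
        simp only [InBall] at hsum
        rw [hsum] at b4
        exact ⟨b1, by rw [e4]; exact b2, b3, b4⟩
    · omega
    · intro i hi
      rw [next_arr, k3 i (by omega), h3 i hi]
    · intro i hi
      obtain ⟨a1, a2⟩ := k4 i (hi k ⟨hk1, by omega⟩)
      obtain ⟨a3, a4⟩ := h4 i fun j hj => hi j ⟨hj.1, by have := hj.2; omega⟩
      exact ⟨a1.trans a3, a2.trans a4⟩
    · rw [Finset.sum_Ico_succ_top hk1]
      omega
  · rintro s' t ⟨h1, h2, h3, h4, h5⟩ - -
    exact ⟨⟨h1, h2, h3, h4⟩, by omega⟩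

end Build
end LocalSep

namespace LocalSep

open SimpleGraph Relation

/-! ### Distances as stored marks, and sizes of balls -/

section Marks

variable {V : Type*} (G : SimpleGraph V) (d : ℕ)

open Classical in
/-- The distance plus one from `v` to a vertex `u` of its ball, and 0 for other vertices. -/
noncomputable def mark (v u : V) : ℕ := if 2 * G.edist v u ≤ d then G.dist v u + 1 else 0

variable {G d}

theorem mark_ne_zero {v u : V} : mark G d v u ≠ 0 ↔ u ∈ (ball G d v).verts := by
  rw [mem_ball_iff, mark]
  split <;> simp_all

theorem edist_of_mark {v u : V} (h : mark G d v u ≠ 0) : G.edist v u = (mark G d v u - 1 : ℕ) := by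
  rw [mark_ne_zero, mem_ball_iff] at h
  rw [mark, if_pos h, Nat.add_sub_cancel, (two_mul_dist_le_iff.2 h).1.coe_dist_eq_edist]

theorem mark_comm (v u : V) : mark G d v u = mark G d u v := by
  rw [mark, mark, edist_comm, dist_comm]

theorem mark_self (v : V) : mark G d v v = 1 := by simp [mark]

theorem two_mul_mark_le (v u : V) : 2 * mark G d v u ≤ d + 2 := by
  by_cases h : mark G d v u = 0
  · omega
  · have h1 := edist_of_mark h
    have h2 := mem_ball_iff.1 (mark_ne_zero.1 h)
    rw [h1] at h2
    have : 2 * (mark G d v u - 1) ≤ d := by exact_mod_cast h2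
    omega

theorem mark_ne_zero_of_edist {v u : V} {k : ℕ} (h : G.edist v u ≤ k) (hk : 2 * k ≤ d) :
    mark G d v u ≠ 0 := by
  rw [mark_ne_zero, mem_ball_iff]
  exact (mul_le_mul_right h 2).trans (by exact_mod_cast hk)

/-- Each mark is a distance plus one, so the bound `d` for two distances plus one becomes a strict
bound `d + 2` for two marks. -/
theorem ball_adj_iff_mark {v a b : V} (ha : mark G d v a ≠ 0) :
    (ball G d v).Adj a b ↔
      G.Adj a b ∧ mark G d v b ≠ 0 ∧ mark G d v b + mark G d v a < d + 2 := by
  have key : ∀ b, mark G d v b ≠ 0 →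
      (G.edist v a + G.edist v b + 1 ≤ d ↔ mark G d v b + mark G d v a < d + 2) := by
    intro b hb
    rw [edist_of_mark ha, edist_of_mark hb]
    norm_cast
    omega
  constructor
  · intro h
    have hb := mark_ne_zero.2 ((ball G d v).edge_vert h.symm)
    exact ⟨(ball_adj_iff.1 h).1, hb, (key b hb).1 (ball_adj_iff.1 h).2⟩
  · rintro ⟨h1, h2, h3⟩
    exact ball_adj_iff.2 ⟨h1, (key b h2).2 h3⟩

/-- Three marks exceed the three distances by 3 in total, which turns `≤ d` into `< d + 4`. -/
theorem close_iff_mark {v w u : V} (hu : mark G d v u ≠ 0) (hw : mark G d v w ≠ 0) :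
    Close G d v w u ↔
      mark G d w u ≠ 0 ∧ mark G d w u + mark G d v u + mark G d v w < d + 4 := by
  have key : mark G d w u ≠ 0 →
      (Close G d v w u ↔ mark G d w u + mark G d v u + mark G d v w < d + 4) := by
    intro h
    rw [Close, edist_comm (u := u), edist_of_mark hu, edist_of_mark hw, edist_of_mark h]
    norm_cast
    omega
  constructor
  · intro h
    have h' := mark_ne_zero.2 h.mem_ball_right
    exact ⟨h', (key h').1 h⟩
  · rintro ⟨h1, h2⟩
    exact (key h1).2 h2

/-- For `d < 2` this fails: the ball is then just its centre, and the mark of a neighbour is 0. -/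
theorem mark_eq_two_iff {v w : V} (hd : 2 ≤ d) : mark G d v w = 2 ↔ G.Adj v w := by
  rw [← edist_eq_one_iff_adj]
  constructor
  · intro h
    have h0 : mark G d v w ≠ 0 := by omega
    rw [edist_of_mark h0, h]
    rfl
  · intro h
    have h0 : mark G d v w ≠ 0 := mark_ne_zero_of_edist (k := 1) (by rw [h]; rfl) hd
    have := edist_of_mark h0
    rw [h] at this
    have : 1 = mark G d v w - 1 := by exact_mod_cast this
    omega

end Marks

section Sizes

variable {n : ℕ} (G : SimpleGraph (Fin n)) (d : ℕ)

open Classical in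
/-- The vertices of the ball around `v`. -/
noncomputable def ballFin (v : Fin n) : Finset (Fin n) := {u | mark G d v u ≠ 0}

open Classical in
/-- The degree of `u` in the ball around `v`. -/
noncomputable def ballDegree (v u : Fin n) : ℕ := (Finset.univ.filter ((ball G d v).Adj u)).card

open Classical in
/-- The degree of `u`. -/
noncomputable def outDegree (u : Fin n) : ℕ := (Finset.univ.filter (G.Adj u)).card

variable {G d}

theorem mem_ballFin {v u : Fin n} : u ∈ ballFin G d v ↔ mark G d v u ≠ 0 := by
  simp [ballFin]

theorem ballSize_le (v : Fin n) : ballSize G d v ≤ maxBallSize G d :=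
  Finset.le_sup (f := fun v => ballSize G d v) (Finset.mem_univ v)

theorem card_ballFin (v : Fin n) : (ballFin G d v).card = (ball G d v).verts.ncard := by
  classical
  rw [← Set.ncard_coe_finset]
  congr 1
  ext u
  simp [mem_ballFin, mark_ne_zero]

theorem card_ballFin_le (v : Fin n) : (ballFin G d v).card ≤ maxBallSize G d := by
  rw [card_ballFin]
  exact (Nat.le_add_right _ _).trans (ballSize_le v)

theorem sum_ballDegree (v : Fin n) :
    ∑ u, ballDegree G d v u = 2 * (ball G d v).edgeSet.ncard := by
  classical
  have h := (ball G d v).spanningCoe.sum_degrees_eq_twice_card_edges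
  rw [← Set.ncard_coe_finset, coe_edgeFinset, Subgraph.edgeSet_spanningCoe] at h
  rw [← h]
  refine Finset.sum_congr rfl fun u _ => ?_
  rw [ballDegree, ← card_neighborFinset_eq_degree]
  congr 1
  ext x
  simp

/-- The degrees sum to twice the number of edges. So a linear scan of a tabulated ball is linear in
its size. -/
theorem sum_ballDegree_le (v : Fin n) :
    ∑ u ∈ ballFin G d v, (ballDegree G d v u + 1) ≤ 2 * maxBallSize G d := by
  have h1 : ∑ u ∈ ballFin G d v, ballDegree G d v u ≤ ∑ u, ballDegree G d v u :=
    Finset.sum_le_sum_of_subset (Finset.subset_univ _)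
  have h2 := ballSize_le (G := G) (d := d) v
  rw [ballSize, ← card_ballFin] at h2
  rw [sum_ballDegree] at h1
  rw [Finset.sum_add_distrib, Finset.sum_const, smul_eq_mul, mul_one]
  omega

/-- For `d ≥ 2` a ball contains all neighbours of its centre. This bounds the cost of scanning lists
of the whole graph. -/
theorem outDegree_le (hd : 2 ≤ d) (u : Fin n) : outDegree G u ≤ maxBallSize G d := by
  refine le_trans (Finset.card_le_card ?_) (card_ballFin_le u)
  intro x hx
  rw [mem_ballFin]
  exact mark_ne_zero_of_edist (k := 1)
    (by rw [edist_eq_one_iff_adj.2 (by simpa using hx)]; rfl) hd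

theorem one_le_maxBallSize (v : Fin n) : 1 ≤ maxBallSize G d :=
  le_trans (Finset.card_pos.2 ⟨v, mem_ballFin.2 (by rw [mark_self]; exact one_ne_zero)⟩)
    (card_ballFin_le v)

theorem ballDegree_le (v u : Fin n) (hu : u ∈ ballFin G d v) :
    ballDegree G d v u ≤ 2 * maxBallSize G d := by
  have h := Finset.single_le_sum (f := fun u => ballDegree G d v u + 1) (fun _ _ => Nat.zero_le _) hu
  exact (Nat.le_succ _).trans (h.trans (sum_ballDegree_le v))

end Sizes
end LocalSep

namespace LocalSep

open SimpleGraph Relation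

/-! ### Reading the graph -/

section Input

variable {n : ℕ} {G : SimpleGraph (Fin n)} {d : ℕ}

/-- Row 0 of the arrays 4 and 5 represents the graph. -/
structure GraphTab (G : SimpleGraph (Fin n)) (s : Store) : Prop where
  row : ∀ u : Fin n, s.arr 4 (0 + u) ≤ s.arr 5 (0 + u) ∧ s.arr 5 (0 + u) ≤ s.var 4
  nb : ∀ (u : Fin n) (y : ℕ), Nb s 0 u y ↔ ∃ x : Fin n, G.Adj u x ∧ y = x
  inj : ∀ u : Fin n, Set.InjOn (s.arr 1) (Set.Ico (s.arr 4 (0 + u)) (s.arr 5 (0 + u)))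

/-- Used to bound the length of a filtered list by a degree: the entries of the list are distinct.
-/
theorem sum_ite_le_card {f : ℕ → ℕ} {lo hi : ℕ} (hf : Set.InjOn f (Set.Ico lo hi)) (P : ℕ → Prop)
    [DecidablePred P] (T : Finset (Fin n))
    (hT : ∀ e ∈ Set.Ico lo hi, P (f e) → ∃ x ∈ T, f e = (x : ℕ)) :
    (∑ e ∈ Finset.Ico lo hi, if P (f e) then 1 else 0) ≤ T.card := by
  rw [← Finset.card_filter, ← Finset.card_map (s := T) Fin.valEmbedding]
  refine Finset.card_le_card_of_injOn f ?_ ?_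
  · intro e he
    simp only [Finset.coe_filter, Finset.mem_Ico, Set.mem_ofPred_eq] at he
    obtain ⟨x, hx, e'⟩ := hT e he.1 he.2
    simp only [Finset.coe_map, Set.mem_image]
    exact ⟨x, hx, e'.symm⟩
  · intro e he e' he' h
    simp only [Finset.coe_filter, Finset.mem_Ico, Set.mem_ofPred_eq] at he he'
    exact hf he.1 he'.1 h

theorem GraphTab.rowLen_le {s : Store} (h : GraphTab G s) (u : Fin n) :
    rowLen s 0 u ≤ outDegree G u := by
  classical
  have := sum_ite_le_card (n := n) (h.inj u) (fun _ => True) (Finset.univ.filter (G.Adj u)) (by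
    intro e he _
    obtain ⟨x, hx, e'⟩ := (h.nb u _).1 ⟨e, he.1, he.2, rfl⟩
    exact ⟨x, by simpa using hx, e'⟩)
  simp only [if_true, Finset.sum_const, Nat.card_Ico, smul_eq_mul, mul_one] at this
  exact this

/-- Delimit the adjacency lists of the graph in row 0, and initialize the pointers to free space. -/
def loadGraph : Prog :=
  .seq (.add 3 0 0) <| .seq (.load 4 0 0) <| .seq (.copy 5 3) <| .seq (.const 50 0) <|
    forUp 50 0 52 <| .seq (.load 51 0 50) <| .seq (.store 4 50 51) <| .seq (.copy 53 50) <|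
      .seq (incr 53) <| .seq (.load 51 0 53) (.store 5 50 51)

theorem wp_loadGraph (s : Store) :
    Wp loadGraph s fun s' t => s'.var 3 = s.var 0 + s.var 0 ∧ s'.var 4 = s.arr 0 (s.var 0) ∧
      s'.var 5 = s.var 0 + s.var 0 ∧
      (∀ u < s.var 0, s'.arr 4 u = s.arr 0 u ∧ s'.arr 5 u = s.arr 0 (u + 1)) ∧
      t ≤ 20 * s.var 0 + 10 := by
  simp only [loadGraph, wp_seq, wp_load, wp_add, wp_copy, wp_const, setVar_var, Nat.reduceEqDiff,
    ↓reduceIte, setVar_arr]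
  refine wp_forUp (fun k s' t => (∀ u < k, s'.arr 4 u = s.arr 0 u ∧ s'.arr 5 u = s.arr 0 (u + 1)) ∧
      t ≤ 20 * k) (by decide) (by decide) (by decide) (by decide) (by decide) rfl rfl ?_ ?_ ?_ ?_
  · simp
  · simp
  · rintro k s' t hk1 hk2 hk hF ⟨h1, h2⟩
    have f0 := hF.arr 0 rfl
    simp only [wp_seq, wp_load, wp_copy, wp_store, wp_incr, setVar_var, Nat.reduceEqDiff,
      ↓reduceIte, setVar_arr, setArr_arr, setArr_var, next_arr, hk]
    simp only [setVar_arr] at f0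
    refine ⟨fun u hu => ?_, by omega⟩
    rcases Nat.lt_succ_iff_lt_or_eq.1 hu with hu | rfl
    · rw [Function.update_of_ne hu.ne, Function.update_of_ne hu.ne]
      exact h1 u hu
    · rw [Function.update_self, Function.update_self, f0]
      exact ⟨rfl, rfl⟩
  · rintro s' t ⟨h1, h2⟩ - hF
    have f3 := hF.var 3 rfl
    have f4 := hF.var 4 rfl
    have f5 := hF.var 5 rfl
    simp only [setVar_var, Nat.reduceEqDiff, ↓reduceIte] at f3 f4 f5 h1 h2
    exact ⟨f3, f4, f5, h1, by omega⟩

theorem length_flatten_take_succ {α : Type*} (L : List (List α)) {k : ℕ} (hk : k < L.length) :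
    (L.take (k + 1)).flatten.length = (L.take k).flatten.length + L[k].length := by
  rw [List.take_succ_eq_append_getElem hk, List.flatten_append, List.length_append,
    List.flatten_singleton]

theorem getD_flatten {α : Type*} (L : List (List α)) (f : α → ℕ) {k i : ℕ} (hk : k < L.length)
    (hi : i < L[k].length) :
    (L.flatten.map f).getD ((L.take k).flatten.length + i) 0 = f (L[k][i]) := by
  have h : L.flatten = (L.take k).flatten ++ (L[k] ++ (L.drop (k + 1)).flatten) := by
    conv_lhs => rw [← List.take_append_drop k L]
    rw [List.flatten_append, List.drop_eq_getElem_cons hk, List.flatten_cons]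
  conv_lhs => rw [h]
  rw [List.map_append, List.map_append, List.getD_append_right _ _ _ _ (by rw [List.length_map]; exact Nat.le_add_right _ _),
    List.length_map, Nat.add_sub_cancel_left, List.getD_append _ _ _ _ (by simpa using hi)]
  rw [List.getD_eq_getElem _ _ (by simpa using hi), List.getElem_map]

/-- The list of `u` starts where the lists of all smaller vertices end, at the prefix sum stored in
the input. -/
theorem graphTab_of_load {nbrs : Fin n → List (Fin n)} (hnb : IsAdjacencyList G nbrs) {s : Store}
    (h1 : s.arr 1 = (inputStore nbrs d).arr 1) (hp : s.var 4 = (inputStore nbrs d).arr 0 n)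
    (h4 : ∀ u < n, s.arr 4 u = (inputStore nbrs d).arr 0 u ∧
      s.arr 5 u = (inputStore nbrs d).arr 0 (u + 1)) : GraphTab G s := by
  have a0 : ∀ i ≤ n, (inputStore nbrs d).arr 0 i = ((List.ofFn nbrs).take i).flatten.length := by
    intro i hi
    simp [inputStore, hi]
  have e4 : ∀ u : Fin n, s.arr 4 (0 + u) = ((List.ofFn nbrs).take u).flatten.length := fun u => by
    rw [zero_add, (h4 u u.2).1, a0 u u.2.le]
  have e5 : ∀ u : Fin n, s.arr 5 (0 + u) = s.arr 4 (0 + u) + (nbrs u).length := fun u => by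
    rw [e4, zero_add, (h4 u u.2).2, a0 _ u.2, length_flatten_take_succ _ (by simp)]
    simp
  have e1 : ∀ (u : Fin n) (i : ℕ) (hi : i < (nbrs u).length),
      s.arr 1 (s.arr 4 (0 + u) + i) = (nbrs u)[i] := by
    intro u i hi
    rw [e4, h1]
    have := getD_flatten (List.ofFn nbrs) Fin.val (k := u) (i := i) (by simp) (by simpa using hi)
    simpa [inputStore] using this
  refine ⟨fun u => ⟨by rw [e5]; omega, ?_⟩, fun u y => ?_, fun u => ?_⟩
  · rw [zero_add, (h4 u u.2).2, hp, a0 _ u.2, a0 _ le_rfl]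
    have hl : ∀ i, ((List.ofFn nbrs).take i).flatten.length ≤ (List.ofFn nbrs).flatten.length := by
      intro i
      conv_rhs => rw [← List.take_append_drop i (List.ofFn nbrs), List.flatten_append,
        List.length_append]
      exact Nat.le_add_right _ _
    rw [List.take_of_length_le (i := n) (by simp)]
    exact hl _
  · simp only [Nb, e5]
    constructor
    · rintro ⟨e, h2, h3, rfl⟩
      obtain ⟨i, rfl⟩ := Nat.exists_eq_add_of_le h2
      have hi : i < (nbrs u).length := by omega
      exact ⟨(nbrs u)[i], ((hnb u).2 _).1 (List.getElem_mem hi), e1 u i hi⟩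
    · rintro ⟨x, hx, rfl⟩
      obtain ⟨i, hi, rfl⟩ := List.getElem_of_mem (((hnb u).2 x).2 hx)
      exact ⟨_, by omega, by omega, e1 u i hi⟩
  · rw [e5]
    intro e he e' he' h
    obtain ⟨i, rfl⟩ := Nat.exists_eq_add_of_le he.1
    obtain ⟨j, rfl⟩ := Nat.exists_eq_add_of_le he'.1
    have hi : i < (nbrs u).length := by have := he.2; omega
    have hj : j < (nbrs u).length := by have := he'.2; omega
    rw [e1 u i hi, e1 u j hj] at h
    rw [(hnb u).1.getElem_inj_iff.1 (Fin.ext h)]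

end Input

/-! ### Tabulating all balls -/

section Balls

variable {n : ℕ} {G : SimpleGraph (Fin n)} {d : ℕ}

/-- The row reserved for the ball around `v`. -/
def ballRow (n v : ℕ) : ℕ := (v + 1) * (n + n)

/-- Rows are `n + n` apart and hence disjoint. They are reached by repeated addition, as there is no
multiplication. -/
theorem ballRow_lt {n v w : ℕ} (h : v < w) : ballRow n v + (n + n) ≤ ballRow n w := by
  unfold ballRow
  calc (v + 1) * (n + n) + (n + n) = (v + 1 + 1) * (n + n) := by ring
    _ ≤ (w + 1) * (n + n) := Nat.mul_le_mul_right _ (by omega)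

theorem ballRow_succ (n v : ℕ) : ballRow n v + (n + n) = ballRow n (v + 1) := by
  unfold ballRow
  ring

theorem le_ballRow (n v : ℕ) : n + n ≤ ballRow n v :=
  Nat.le_mul_of_pos_left _ v.succ_pos

attribute [irreducible] ballRow

/-- The ball around `v` and the distances in it are tabulated. -/
structure BallTab (G : SimpleGraph (Fin n)) (d : ℕ) (s : Store) (v : Fin n) : Prop where
  handle : s.arr 9 v = ballRow n v
  lo_le : s.arr 10 v ≤ s.arr 11 v
  hi_le : s.arr 11 v ≤ s.var 6
  inj : Set.InjOn (s.arr 8) (Set.Ico (s.arr 10 v) (s.arr 11 v))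
  mem : ∀ y, (∃ j ∈ Set.Ico (s.arr 10 v) (s.arr 11 v), s.arr 8 j = y) ↔
    ∃ u ∈ ballFin G d v, y = (u : ℕ)
  val : ∀ u : Fin n, s.arr 6 (ballRow n v + u) = mark G d v u
  row : ∀ u ∈ ballFin G d v, s.arr 4 (ballRow n v + u) ≤ s.arr 5 (ballRow n v + u) ∧
    s.arr 5 (ballRow n v + u) ≤ s.var 4
  nb : ∀ u ∈ ballFin G d v, ∀ y, Nb s (ballRow n v) u y ↔ ∃ x : Fin n, (ball G d v).Adj u x ∧ y = x
  len : ∀ u ∈ ballFin G d v, rowLen s (ballRow n v) u ≤ ballDegree G d v u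

/-- The tables of `s` outside the rows from `b` on are still valid in `s'`. -/
structure Ext (b : ℕ) (s s' : Store) : Prop where
  ptr_le : s.var 4 ≤ s'.var 4
  tail_le : s.var 6 ≤ s'.var 6
  edges : ∀ i < s.var 4, s'.arr 1 i = s.arr 1 i
  queue : ∀ i < s.var 6, s'.arr 8 i = s.arr 8 i
  start : ∀ i < b, s'.arr 4 i = s.arr 4 i
  rowEnd : ∀ i < b, s'.arr 5 i = s.arr 5 i
  val : ∀ i < b, s'.arr 6 i = s.arr 6 i

theorem Ext.trans {b : ℕ} {s s' s'' : Store} (h : Ext b s s') (h' : Ext b s' s'') :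
    Ext b s s'' where
  ptr_le := h.ptr_le.trans h'.ptr_le
  tail_le := h.tail_le.trans h'.tail_le
  edges i hi := (h'.edges i (hi.trans_le h.ptr_le)).trans (h.edges i hi)
  queue i hi := (h'.queue i (hi.trans_le h.tail_le)).trans (h.queue i hi)
  start i hi := (h'.start i hi).trans (h.start i hi)
  rowEnd i hi := (h'.rowEnd i hi).trans (h.rowEnd i hi)
  val i hi := (h'.val i hi).trans (h.val i hi)

theorem Ext.mono {b c : ℕ} {s s' : Store} (h : Ext b s s') (hc : c ≤ b) : Ext c s s' :=
  { h with
    start := fun i hi => h.start i (hi.trans_le hc)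
    rowEnd := fun i hi => h.rowEnd i (hi.trans_le hc)
    val := fun i hi => h.val i (hi.trans_le hc) }

theorem GraphTab.ext {b : ℕ} {s s' : Store} (h : GraphTab G s) (hE : Ext b s s') (hb : n ≤ b) :
    GraphTab G s' := by
  have h4 : ∀ u : Fin n, s'.arr 4 (0 + u) = s.arr 4 (0 + u) := fun u => hE.start _ (by omega)
  have h5 : ∀ u : Fin n, s'.arr 5 (0 + u) = s.arr 5 (0 + u) := fun u => hE.rowEnd _ (by omega)
  refine ⟨fun u => ?_, fun u y => ?_, fun u => ?_⟩
  · rw [h4, h5]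
    exact ⟨(h.row u).1, (h.row u).2.trans hE.ptr_le⟩
  · exact (nb_congr (h4 u) (h5 u) (h.row u).2 hE.edges y).trans (h.nb u y)
  · rw [h4, h5]
    exact (h.inj u).congr fun e he => (hE.edges e (he.2.trans_le (h.row u).2)).symm

/-- A table refers only to its own row and to parts of arrays 1 and 8 already in use, none of which
an extension touches. -/
theorem BallTab.ext {b : ℕ} {s s' : Store} {v : Fin n} (h : BallTab G d s v) (hE : Ext b s s')
    (hb : ballRow n v + n ≤ b) (h9 : s'.arr 9 v = s.arr 9 v) (h10 : s'.arr 10 v = s.arr 10 v)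
    (h11 : s'.arr 11 v = s.arr 11 v) : BallTab G d s' v := by
  have h4 : ∀ u : Fin n, s'.arr 4 (ballRow n v + u) = s.arr 4 (ballRow n v + u) :=
    fun u => hE.start _ (by omega)
  have h5 : ∀ u : Fin n, s'.arr 5 (ballRow n v + u) = s.arr 5 (ballRow n v + u) :=
    fun u => hE.rowEnd _ (by omega)
  have h8 : ∀ j ∈ Set.Ico (s.arr 10 v) (s.arr 11 v), s'.arr 8 j = s.arr 8 j :=
    fun j hj => hE.queue j (hj.2.trans_le h.hi_le)
  refine ⟨h9.trans h.handle, ?_, ?_, ?_, ?_, ?_, ?_, ?_, ?_⟩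
  · rw [h10, h11]; exact h.lo_le
  · rw [h11]; exact h.hi_le.trans hE.tail_le
  · rw [h10, h11]
    exact h.inj.congr fun j hj => (h8 j hj).symm
  · intro y
    rw [h10, h11, ← h.mem y]
    exact exists_congr fun j => and_congr_right fun hj => by rw [h8 j hj]
  · intro u
    rw [hE.val _ (by omega), h.val]
  · intro u hu
    rw [h4, h5]
    exact ⟨(h.row u hu).1, (h.row u hu).2.trans hE.ptr_le⟩
  · exact fun u hu y => (nb_congr (h4 u) (h5 u) (h.row u hu).2 hE.edges y).trans (h.nb u hu y)
  · intro u hu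
    rw [rowLen, h4, h5]
    exact h.len u hu

theorem BfsPost.ext {s s' : Store} {U : ℕ → Prop} {W : ℕ} (h : BfsPost s U W s')
    (hF : Frame bfs s s') : Ext (s.var 11) s s' where
  ptr_le := (hF.var 4 rfl).ge
  tail_le := h.lt.le
  edges i _ := by rw [hF.arr 1 rfl]
  queue := h.old
  start i _ := by rw [hF.arr 4 rfl]
  rowEnd i _ := by rw [hF.arr 5 rfl]
  val i hi := (h.out i (Or.inl hi)).1

theorem BuildPost.ext {s s' : Store} (h : BuildPost s s') (hF : Frame build s s') :
    Ext (s.var 35) s s' where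
  ptr_le := h.ptr_le
  tail_le := (hF.var 6 rfl).ge
  edges := h.old
  queue i _ := by rw [hF.arr 8 rfl]
  start i hi := (h.out i fun j _ => by omega).1
  rowEnd i hi := (h.out i fun j _ => by omega).2
  val i _ := by rw [hF.arr 6 rfl]

theorem pot_le {s : Store} {g h W : ℕ} (F : Finset ℕ) (hF : ∀ x < W, s.arr 6 (h + x) ≠ 0 → x ∈ F) :
    pot s g h W ≤ ∑ x ∈ F, (rowLen s g x + 1) := by
  rw [pot, ← Finset.sum_filter]
  refine Finset.sum_le_sum_of_subset fun x hx => ?_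
  rw [Finset.mem_filter, Finset.mem_range] at hx
  exact hF x hx.1 hx.2

end Balls
end LocalSep

namespace LocalSep

open SimpleGraph Relation

section Balls

variable {n : ℕ} {G : SimpleGraph (Fin n)} {d : ℕ}

/-- Turns sums over queue positions into sums over the vertices of a ball. -/
theorem sum_list {q : ℕ → ℕ} {lo hi : ℕ} {F : Finset (Fin n)} (hq : Set.InjOn q (Set.Ico lo hi))
    (hm : ∀ y, (∃ j ∈ Set.Ico lo hi, q j = y) ↔ ∃ u ∈ F, y = (u : ℕ)) (f : ℕ → ℕ) :
    ∑ j ∈ Finset.Ico lo hi, f (q j) = ∑ u ∈ F, f u := by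
  rw [← Finset.sum_image (f := f) (g := q) (by rwa [Finset.coe_Ico]),
    show ∑ u ∈ F, f u = ∑ u ∈ F, f (Fin.valEmbedding u) from rfl, ← Finset.sum_map]
  congr 1
  ext y
  simp only [Finset.mem_image, Finset.mem_map, Finset.mem_Ico]
  exact (hm y).trans ⟨fun ⟨u, h1, h2⟩ => ⟨u, h1, h2.symm⟩, fun ⟨u, h1, h2⟩ => ⟨u, h1, h2.symm⟩⟩

theorem BfsPost.marked {s s' : Store} {U : ℕ → Prop} {W : ℕ} (h : BfsPost s U W s') {x : ℕ}
    (h0 : s.arr 6 (s.var 11 + x) = 0) :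
    (∃ j ∈ Set.Ico (s.var 6) (s'.var 6), s'.arr 8 j = x) ↔ s'.arr 6 (s.var 11 + x) ≠ 0 := by
  constructor
  · rintro ⟨j, hj, rfl⟩
    exact (h.mem j hj).2.2
  · intro hx
    by_contra hc
    push Not at hc
    exact hx ((h.unmarked x hc).trans h0)

/-- The limit `d + 3` admits exactly the marks whose distance is at most d/2, since twice the
distance plus 2 has to stay below it. -/
theorem BfsPost.val_eq_mark {s s' : Store} {U : ℕ → Prop} {W : ℕ} (h : BfsPost s U W s')
    {v : Fin n} (hv : s.var 12 = v) (h13 : s.var 13 = 1) (h14 : s.var 14 = 1)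
    (h15 : s.var 15 = d + 3)
    (h0 : ∀ u : Fin n, s.arr 6 (s.var 11 + u) = 0)
    (hnb : ∀ (u : Fin n) (y : ℕ), Nb s (s.var 10) u y ↔ ∃ x : Fin n, G.Adj u x ∧ y = x)
    (hU : ∀ u, U u → u < n) (u : Fin n) : s'.arr 6 (s.var 11 + u) = mark G d v u := by
  have hsrc := h.src
  have hpar := h.par
  have hcl := h.closed
  simp only [hv, h13, h14, h15] at hsrc hpar hcl
  -- Marks are not too small: predecessors, traced through the queue, give a walk of the length the
  -- mark claims.
  have hA : ∀ j, s.var 6 ≤ j → j < s'.var 6 → ∀ u : Fin n, s'.arr 8 j = u →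
      2 * s'.arr 6 (s.var 11 + u) < d + 3 ∧
        G.edist v u ≤ (s'.arr 6 (s.var 11 + u) - 1 : ℕ) := by
    intro j
    induction j using Nat.strong_induction_on with
    | _ j ih =>
      intro hj1 hj2 u hu
      rcases hj1.eq_or_lt with rfl | hj1
      · obtain rfl : v = u := Fin.ext (hsrc.1.symm.trans hu)
        rw [hsrc.2]
        simp
      · obtain ⟨i, hi, hij, -, hn, hval, hb⟩ := hpar j ⟨hj1, hj2⟩
        have hx := hU _ (h.mem i hi).1
        obtain ⟨y, hy⟩ : ∃ y : Fin n, s'.arr 8 i = y := ⟨⟨_, hx⟩, rfl⟩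
        rw [hy, hu, hnb] at hn
        obtain ⟨u', hadj, hu'⟩ := hn
        obtain rfl := Fin.ext hu'
        rw [hu] at hval hb
        rw [hy] at hval
        have hm := (h.mem i hi).2.2
        rw [hy] at hm
        refine ⟨hb, ?_⟩
        have h1 := (ih i hij hi.1 hi.2 y hy).2
        calc G.edist v u ≤ G.edist v y + G.edist y u := SimpleGraph.edist_triangle
          _ ≤ (s'.arr 6 (s.var 11 + y) - 1 : ℕ) + 1 := by
            gcongr
            exact (edist_eq_one_iff_adj.2 hadj).le
          _ = (s'.arr 6 (s.var 11 + u) - 1 : ℕ) := by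
            norm_cast
            omega
  -- Marks are not too large: along a walk ending in `v` of length at most d/2, every vertex gets
  -- expanded in time to mark the one before it.
  have hB : ∀ {a b : Fin n} (p : G.Walk a b), b = v → 2 * p.length ≤ d →
      s'.arr 6 (s.var 11 + a) ≠ 0 ∧ s'.arr 6 (s.var 11 + a) ≤ p.length + 1 := by
    intro a b p
    induction p with
    | nil =>
      rintro rfl -
      rw [hsrc.2]
      simp
    | @cons a x b hadj p ih =>
      rintro rfl hl
      rw [Walk.length_cons] at hl ⊢
      obtain ⟨h1, h2⟩ := ih rfl (by omega)
      obtain ⟨j, hj, hjx⟩ := (h.marked (h0 x)).2 h1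
      have h3 := hcl j hj
      rw [hjx] at h3
      obtain ⟨h4, h5⟩ := h3 (by omega) a ((hnb x a).2 ⟨a, hadj.symm, rfl⟩)
      have := h5 (h0 a)
      exact ⟨h4, by omega⟩
  by_cases hm : mark G d v u = 0
  · rw [hm]
    by_contra hne
    obtain ⟨j, hj, hju⟩ := (h.marked (h0 u)).2 hne
    obtain ⟨h1, h2⟩ := hA j hj.1 hj.2 u hju
    exact mark_ne_zero_of_edist h2 (by omega) hm
  · have h1 := two_mul_mark_le (G := G) (d := d) v u
    obtain ⟨p, hp⟩ := exists_walk_of_edist_ne_top (u := v) (v := u) (by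
      rw [edist_of_mark hm]; exact ENat.natCast_ne_top _ : G.edist v u ≠ ⊤)
    rw [edist_of_mark hm] at hp
    have hp' : p.length = mark G d v u - 1 := by exact_mod_cast hp
    obtain ⟨h2, h3⟩ := hB p.reverse rfl (by rw [Walk.length_reverse]; omega)
    rw [Walk.length_reverse, hp'] at h3
    obtain ⟨j, hj, hju⟩ := (h.marked (h0 u)).2 h2
    obtain ⟨h4, h5⟩ := hA j hj.1 hj.2 u hju
    rw [edist_of_mark hm] at h5
    have h6 : mark G d v u - 1 ≤ s'.arr 6 (s.var 11 + u) - 1 := by exact_mod_cast h5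
    omega

/-- Tabulate the ball around the vertex in register 50. -/
def ballStep : Prog :=
  .seq (.store 9 50 5) <| .seq (.store 10 50 6) <| .seq (.copy 11 5) <| .seq (.copy 35 5) <|
    .seq (.copy 36 5) <| .seq (.const 10 0) <| .seq (.copy 12 50) <| .seq (.const 13 1) <|
    .seq (.const 14 1) <| .seq (.const 15 3) <| .seq (.add 15 15 1) <| .seq (.copy 30 6) <|
    .seq bfs <| .seq (.copy 31 6) <| .seq (.store 11 50 6) <| .seq (.const 32 0) <|
    .seq (.const 33 0) <| .seq (.const 34 0) <| .seq (.const 37 0) <| .seq (.const 38 0) <|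
    .seq build (.add 5 5 3)

/-- The storage when the balls around the vertices less than `k` are tabulated. -/
structure BallsReady (G : SimpleGraph (Fin n)) (d k : ℕ) (s : Store) : Prop where
  var0 : s.var 0 = n
  var1 : s.var 1 = d
  var3 : s.var 3 = n + n
  var5 : s.var 5 = ballRow n k
  graph : GraphTab G s
  ball : ∀ v : Fin n, (v : ℕ) < k → BallTab G d s v
  zero : ∀ i, i < n + n ∨ ballRow n k ≤ i → s.arr 6 i = 0

-- The search scans full adjacency lists, at most R of them and each of length at most R. The lists
-- written afterwards keep only the edges of the ball, so that later searches in it cost O(R).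
set_option maxHeartbeats 400000 in
theorem wp_ballStep (hd : 2 ≤ d) {s : Store} {v : Fin n} (h : BallsReady G d v s)
    (hv : s.var 50 = v) :
    Wp ballStep s fun s' t => BallsReady G d (v + 1) s' ∧
      t ≤ 300 * (maxBallSize G d * maxBallSize G d) := by
  have hR := one_le_maxBallSize (G := G) (d := d) v
  set R := maxBallSize G d with hRdef
  have hrow : n + n ≤ ballRow n v := le_ballRow n v
  have hnb : n ≤ ballRow n v := (Nat.le_add_right n n).trans hrow
  have hu2 : ∀ u : Fin n, 0 + (u : ℕ) < n + n := fun u => by omega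
  have hrow' : ballRow n v + (n + n) = ballRow n (v + 1) := ballRow_succ n v
  simp only [ballStep, wp_seq, wp_copy, wp_const, wp_store, wp_add, setVar_var, Nat.reduceEqDiff,
    ↓reduceIte, setArr_var]
  refine Wp.mono (Wp.frame (wp_bfs (U := fun u => u < n) (W := n) (fun _ h => h) ?_ ?_ ?_ ?_ ?_)) ?_
  all_goals simp only [setVar_var, Nat.reduceEqDiff, ↓reduceIte, setVar_arr, setArr_arr,
    h.var5, hv, h.var1]
  · intro u x hu hx
    obtain ⟨y, -, rfl⟩ := (h.graph.nb ⟨u, hu⟩ x).1 hx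
    exact y.2
  · exact fun u hu => (h.graph.row ⟨u, hu⟩).1
  · exact v.2
  · exact h.zero _ (Or.inr (by omega))
  · exact one_ne_zero
  rintro s2 t2 ⟨⟨hb, ht⟩, hF⟩
  generalize hs1 : Store.setVar _ 30 _ = s1 at hb hF ht
  have a9 : s1.arr 9 = Function.update (s.arr 9) v (ballRow n v) := by
    rw [← hs1]; simp
  have a10 : s1.arr 10 = Function.update (s.arr 10) v (s.var 6) := by
    rw [← hs1]; simp
  have a11 : s1.arr 11 = s.arr 11 := by rw [← hs1]; simp
  have a1 : s1.arr 1 = s.arr 1 := by rw [← hs1]; simp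
  have a4 : s1.arr 4 = s.arr 4 := by rw [← hs1]; simp
  have a5 : s1.arr 5 = s.arr 5 := by rw [← hs1]; simp
  have a6 : s1.arr 6 = s.arr 6 := by rw [← hs1]; simp
  have a8 : s1.arr 8 = s.arr 8 := by rw [← hs1]; simp
  obtain ⟨v0, v1, v3, v4, v5, v6, v10, v11, v12, v13, v14, v15, v30, v35, v36, v50⟩ :
      s1.var 0 = n ∧ s1.var 1 = d ∧ s1.var 3 = n + n ∧ s1.var 4 = s.var 4 ∧ s1.var 5 = ballRow n v ∧
      s1.var 6 = s.var 6 ∧ s1.var 10 = 0 ∧ s1.var 11 = ballRow n v ∧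
      s1.var 12 = v ∧ s1.var 13 = 1 ∧ s1.var 14 = 1 ∧ s1.var 15 = d + 3 ∧ s1.var 30 = s.var 6 ∧
      s1.var 35 = ballRow n v ∧ s1.var 36 = ballRow n v ∧ s1.var 50 = v := by
    rw [← hs1]
    simp [h.var0, h.var1, h.var3, h.var5, hv, Nat.add_comm]
  clear hs1
  generalize pot s1 _ _ _ = p1 at ht
  have hE1 : Ext (ballRow n v) s s1 := by
    constructor <;> intros <;> simp only [v4, v6, a1, a8, a4, a5, a6, le_refl]
  have hE2 : Ext (ballRow n v) s s2 := hE1.trans (v11 ▸ hb.ext hF)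
  have hG2 := h.graph.ext hE2 hnb
  have z : ∀ u : Fin n, s1.arr 6 (s1.var 11 + u) = 0 := fun u => by
    rw [a6, v11]; exact h.zero _ (Or.inr (Nat.le_add_right _ _))
  have hG1 := h.graph.ext hE1 hnb
  have hval := hb.val_eq_mark v12 v13 v14 v15 z (by rw [v10]; exact hG1.nb) (fun _ h => h)
  rw [v11] at hval
  have hmem : ∀ y, (∃ j ∈ Set.Ico (s.var 6) (s2.var 6), s2.arr 8 j = y) ↔
      ∃ u ∈ ballFin G d v, y = (u : ℕ) := by
    intro y
    constructor
    · rintro ⟨j, hj, rfl⟩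
      rw [← v6] at hj
      have := hb.mem j hj
      refine ⟨⟨_, this.1⟩, ?_, rfl⟩
      rw [mem_ballFin, ← hval, ← v11]
      exact this.2.2
    · rintro ⟨u, hu, rfl⟩
      rw [← v6]
      exact (hb.marked (z u)).2 (by rw [v11, hval]; exact mem_ballFin.1 hu)
  have hinj : Set.InjOn (s2.arr 8) (Set.Ico (s.var 6) (s2.var 6)) := v6 ▸ hb.inj
  -- This is the use of `d ≥ 2`: degrees in `G` are bounded by the maximum ball size.
  have hlen : ∀ u ∈ ballFin G d v, rowLen s2 0 u + 1 ≤ 2 * R := fun u hu => by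
    have := (hG2.rowLen_le u).trans (outDegree_le hd u)
    omega
  have hsum : ∑ u ∈ ballFin G d v, (rowLen s2 0 u + 1) ≤ 2 * (R * R) := by
    refine (Finset.sum_le_sum hlen).trans ?_
    rw [Finset.sum_const, smul_eq_mul, show 2 * (R * R) = R * (2 * R) by ring]
    exact Nat.mul_le_mul_right _ (card_ballFin_le v)
  replace ht : t2 ≤ 20 * (2 * (R * R)) + 20 := by
    refine (Nat.le_add_right _ _).trans (ht.trans ?_)
    refine Nat.add_le_add_right (Nat.mul_le_mul_left 20 (le_trans ?_ hsum)) 20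
    rw [show ∑ u ∈ ballFin G d v, (rowLen s2 0 u + 1) =
      ∑ u ∈ ballFin G d v, (rowLen s2 0 (Fin.valEmbedding u) + 1) from rfl,
      ← Finset.sum_map _ _ fun u => rowLen s2 0 u + 1]
    refine pot_le _ fun x hx hne => ?_
    rw [Finset.mem_map]
    refine ⟨⟨x, hx⟩, ?_, rfl⟩
    rw [mem_ballFin, ← hval]
    exact hne
  have hsum' : ∑ j ∈ Finset.Ico (s.var 6) (s2.var 6), (rowLen s2 0 (s2.arr 8 j) + 1) ≤ 2 * (R * R) :=
    (sum_list hinj hmem fun u => rowLen s2 0 u + 1).le.trans hsum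
  have hz2 : ∀ i, i < n + n ∨ ballRow n (v + 1) ≤ i → s2.arr 6 i = 0 := by
    intro i hi
    have h1 : i < ballRow n v ∨ ballRow n v + n ≤ i := by clear * - hi hrow hrow'; omega
    have h2 : i < n + n ∨ ballRow n v ≤ i := by clear * - hi hrow hrow'; omega
    rw [(hb.out i (v11 ▸ h1)).1, a6]
    exact h.zero i h2
  have g1 := (hF.var 1 rfl).trans v1
  have g3 := (hF.var 3 rfl).trans v3
  have g5 := (hF.var 5 rfl).trans v5
  have g0 := (hF.var 0 rfl).trans v0
  have g30 := (hF.var 30 rfl).trans v30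
  have g35 := (hF.var 35 rfl).trans v35
  have g36 := (hF.var 36 rfl).trans v36
  have g50 := (hF.var 50 rfl).trans v50
  have b9 := (hF.arr 9 rfl).trans a9
  have b10 := (hF.arr 10 rfl).trans a10
  have b11 := (hF.arr 11 rfl).trans a11
  refine Wp.mono (Wp.frame (wp_build ?_ ?_ ?_)) ?_
  all_goals simp only [setVar_var, Nat.reduceEqDiff, ↓reduceIte, setVar_arr, setArr_arr, setArr_var,
    g30, g35, g50]
  · rw [← v6]; exact hb.lt.le
  · exact hinj
  · intro j hj
    obtain ⟨u, hu, e⟩ := (hmem _).1 ⟨j, hj, rfl⟩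
    rw [e]
    exact ⟨(hu2 u).trans_le hrow, hG2.row u⟩
  rintro s4 t4 ⟨⟨hB, ht'⟩, hF'⟩
  replace ht' : t4 ≤ 30 * (2 * (R * R)) + 2 :=
    ht'.trans (Nat.add_le_add_right (Nat.mul_le_mul_left 30 hsum') 2)
  clear hsum hsum'
  generalize hs3 : Store.setVar _ 38 _ = s3 at hB hF'
  have c9 : s3.arr 9 = Function.update (s.arr 9) v (ballRow n v) := by
    rw [← hs3]; simp [b9]
  have c10 : s3.arr 10 = Function.update (s.arr 10) v (s.var 6) := by
    rw [← hs3]; simp [b10]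
  have c11 : s3.arr 11 = Function.update (s.arr 11) v (s2.var 6) := by
    rw [← hs3]; simp [b11]
  have c1 : s3.arr 1 = s2.arr 1 := by rw [← hs3]; simp
  have c4 : s3.arr 4 = s2.arr 4 := by rw [← hs3]; simp
  have c5 : s3.arr 5 = s2.arr 5 := by rw [← hs3]; simp
  have c6 : s3.arr 6 = s2.arr 6 := by rw [← hs3]; simp
  have c8 : s3.arr 8 = s2.arr 8 := by rw [← hs3]; simp
  obtain ⟨w0, w1, w3, w4, w5, w6, w30, w31, w32, w33, w34, w35, w36, w37, w38⟩ :
      s3.var 0 = n ∧ s3.var 1 = d ∧ s3.var 3 = n + n ∧ s3.var 4 = s2.var 4 ∧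
      s3.var 5 = ballRow n v ∧
      s3.var 6 = s2.var 6 ∧ s3.var 30 = s.var 6 ∧ s3.var 31 = s2.var 6 ∧ s3.var 32 = 0 ∧
      s3.var 33 = 0 ∧ s3.var 34 = 0 ∧ s3.var 35 = ballRow n v ∧ s3.var 36 = ballRow n v ∧
      s3.var 37 = 0 ∧ s3.var 38 = 0 := by
    rw [← hs3]
    simp [g0, g1, g3, g5, g30, g35, g36]
  clear hs3
  have hE3 : Ext (ballRow n v) s2 s3 := by
    constructor <;> intros <;> simp only [w4, w6, c1, c8, c4, c5, c6, le_refl]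
  have hE4 : Ext (ballRow n v) s s4 := hE2.trans (hE3.trans (w35 ▸ hB.ext hF'))
  have hG3 := hG2.ext hE3 hnb
  have k0 := (hF'.var 0 rfl).trans w0
  have k1 := (hF'.var 1 rfl).trans w1
  have k3 := (hF'.var 3 rfl).trans w3
  have k5 := (hF'.var 5 rfl).trans w5
  have k6 := (hF'.var 6 rfl).trans w6
  have m6 := (hF'.arr 6 rfl).trans c6
  have m8 := (hF'.arr 8 rfl).trans c8
  have m9 := (hF'.arr 9 rfl).trans c9
  have m10 := (hF'.arr 10 rfl).trans c10
  have m11 := (hF'.arr 11 rfl).trans c11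
  have hrowv : ∀ u ∈ ballFin G d v, BuiltRow s3 s4 u := by
    intro u hu
    obtain ⟨j, hj, e⟩ := (hmem u).2 ⟨u, hu, rfl⟩
    have := hB.row j (by rw [w30, w31]; exact hj)
    rwa [c8, e] at this
  have hin : ∀ u ∈ ballFin G d v, ∀ x : Fin n, G.Adj u x →
      (InBall s3 (s3.var 36) (s3.arr 6 (s3.var 36 + u)) x ↔ (ball G d v).Adj u x) := by
    intro u hu x hx
    rw [ball_adj_iff_mark (mem_ballFin.1 hu), InBall, c6, w36, w1, hval, hval]
    exact ⟨fun h => ⟨hx, h⟩, fun h => h.2⟩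
  -- Row 0 of array 6 is never marked, so pointing register 37 to it switches the links off.
  have hlink : ∀ u : Fin n, ∀ m k, ¬ IsLinked s3 (s3.var 37) m k u := by
    intro u m k hl
    rw [IsLinked, c6, w37, hz2 _ (Or.inl (hu2 u))] at hl
    exact hl.1 rfl
  have hbt : BallTab G d s4 v := by
    refine ⟨?_, ?_, ?_, ?_, ?_, ?_, ?_, ?_, ?_⟩
    · rw [m9, Function.update_self]
    · rw [m10, m11, Function.update_self, Function.update_self, ← v6]; exact hb.lt.le
    · rw [m11, Function.update_self, k6]
    · rw [m10, m11, Function.update_self, Function.update_self, m8]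
      exact hinj
    · rw [m10, m11, Function.update_self, Function.update_self, m8]
      exact hmem
    · rw [m6]; exact hval
    · intro u hu
      have := hrowv u hu
      have h1 := this.le
      have h2 := this.le_ptr
      rw [w35, w33] at h1 h2
      exact ⟨h1, h2⟩
    · intro u hu y
      have h1 := (hrowv u hu).nb y
      rw [w35, w33, add_zero] at h1
      rw [h1, or_iff_left fun h => hlink _ _ _ h.1]
      constructor
      · rintro ⟨x, hx, hi, rfl⟩
        rw [w32] at hx
        obtain ⟨x, hadj, rfl⟩ := (hG3.nb u _).1 hx
        exact ⟨x, (hin u hu x hadj).1 hi, zero_add _⟩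
      · rintro ⟨x, hx, rfl⟩
        rw [w32]
        exact ⟨x, (hG3.nb u _).2 ⟨x, hx.adj_sub, rfl⟩, (hin u hu x hx.adj_sub).2 hx, (zero_add _).symm⟩
    · intro u hu
      classical
      have h1 := (hrowv u hu).len
      rw [w35, w33, add_zero, if_neg (hlink _ _ _), add_zero, w32] at h1
      refine h1.trans (sum_ite_le_card (hG3.inj u) (InBall s3 (s3.var 36) (s3.arr 6 (s3.var 36 + u))) _ ?_)
      intro e he hi
      obtain ⟨x, hx, e'⟩ := (hG3.nb u _).1 ⟨e, he.1, he.2, rfl⟩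
      rw [e'] at hi
      exact ⟨x, by simpa using (hin u hu x hx).1 hi, e'⟩
  refine ⟨⟨?_, ?_, ?_, ?_, ?_, ?_, ?_⟩, ?_⟩
  · simp [k0]
  · simp [k1]
  · simp [k3]
  · simp [k5, k3, hrow']
  · exact (h.graph.ext hE4 hnb).ext (b := n)
      (by constructor <;> intros <;> simp) le_rfl
  · intro u hu
    have hE5 : Ext (ballRow n u + n) s4 (s4.setVar 5 (s4.var 5 + s4.var 3)) := by
      constructor <;> intros <;> simp
    rcases Nat.lt_succ_iff_lt_or_eq.1 hu with hu | hu
    · have := ballRow_lt (n := n) hu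
      refine ((h.ball u hu).ext hE4 (by omega) ?_ ?_ ?_).ext hE5 le_rfl rfl rfl rfl
      · rw [m9, Function.update_of_ne hu.ne]
      · rw [m10, Function.update_of_ne hu.ne]
      · rw [m11, Function.update_of_ne hu.ne]
    · obtain rfl := Fin.ext hu
      exact hbt.ext hE5 le_rfl rfl rfl rfl
  · intro i hi
    rw [setVar_arr, m6]
    exact hz2 i hi
  · have h4 : 1 ≤ R * R := Nat.mul_pos hR hR
    ring_nf at h4 ht ht' ⊢
    clear * - h4 ht ht'
    omega

/-- Tabulate all balls. -/
def ballPhase : Prog := .seq (.const 50 0) (forUp 50 0 52 ballStep)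

theorem BallsReady.congr {k : ℕ} {s s' : Store} (h : BallsReady G d k s) (ha : s'.arr = s.arr)
    (h0 : s'.var 0 = s.var 0) (h1 : s'.var 1 = s.var 1) (h3 : s'.var 3 = s.var 3)
    (h4 : s'.var 4 = s.var 4) (h5 : s'.var 5 = s.var 5) (h6 : s'.var 6 = s.var 6) :
    BallsReady G d k s' := by
  have hE : ∀ b, Ext b s s' := fun b => by
    constructor <;> intros <;> simp only [h4, h6, ha, le_refl]
  exact
  { var0 := h0.trans h.var0
    var1 := h1.trans h.var1
    var3 := h3.trans h.var3
    var5 := h5.trans h.var5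
    graph := h.graph.ext (hE n) le_rfl
    ball := fun v hv => (h.ball v hv).ext (hE _) le_rfl (by rw [ha]) (by rw [ha]) (by rw [ha])
    zero := by rw [ha]; exact h.zero }

theorem wp_ballPhase (hd : 2 ≤ d) {s : Store} (h : BallsReady G d 0 s) :
    Wp ballPhase s fun s' t => BallsReady G d n s' ∧
      t ≤ 304 * (maxBallSize G d * maxBallSize G d * n) + 3 := by
  simp only [ballPhase, wp_seq, wp_const]
  refine wp_forUp (fun k s' t => BallsReady G d k s' ∧
    t ≤ 304 * (maxBallSize G d * maxBallSize G d * k)) (by decide) (by decide) (by decide)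
    (by decide) (by decide) rfl rfl ?_ ?_ ?_ ?_
  · simp
  · simp only [setVar_var, ↓reduceIte]
    exact ⟨h.congr rfl (by simp) (by simp) (by simp) (by simp) (by simp) (by simp), by simp⟩
  · rintro k s' t - hk hk' - ⟨h1, h2⟩
    simp only [setVar_var, Nat.reduceEqDiff, ↓reduceIte, h.var0] at hk
    refine Wp.mono (wp_ballStep (v := ⟨k, hk⟩) hd h1 hk') ?_
    rintro s'' t' ⟨h3, h4⟩
    refine ⟨h3.congr rfl ?_ ?_ ?_ ?_ ?_ ?_, ?_⟩
    iterate 6 simp [next_var]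
    have := one_le_maxBallSize (G := G) (d := d) ⟨k, hk⟩
    have h5 : 1 ≤ maxBallSize G d * maxBallSize G d := Nat.mul_pos this this
    rw [Nat.mul_add, Nat.mul_one, Nat.mul_add]
    omega
  · rintro s' t ⟨h1, h2⟩ - -
    simp only [setVar_var, Nat.reduceEqDiff, ↓reduceIte, h.var0] at h1 h2
    exact ⟨h1, by omega⟩

end Balls
end LocalSep

namespace LocalSep

open SimpleGraph Relation

/-! ### Iterating over all pairs at small distance -/

section Pairs

variable {n : ℕ} {G : SimpleGraph (Fin n)} {d : ℕ}

/-- All balls are tabulated, and register 5 points to free rows. -/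
structure Tables (G : SimpleGraph (Fin n)) (d : ℕ) (s : Store) : Prop where
  var0 : s.var 0 = n
  var1 : s.var 1 = d
  var3 : s.var 3 = n + n
  ball : ∀ v : Fin n, BallTab G d s v
  free : ballRow n n ≤ s.var 5
  zero : ∀ i, s.var 5 ≤ i → s.arr 6 i = 0

theorem BallsReady.tables {s : Store} (h : BallsReady G d n s) : Tables G d s where
  var0 := h.var0
  var1 := h.var1
  var3 := h.var3
  ball v := h.ball v v.2
  free := h.var5.ge
  zero i hi := h.zero i (Or.inr (h.var5 ▸ hi))

theorem ballRow_le (v : Fin n) : ballRow n v + (n + n) ≤ ballRow n n := ballRow_lt v.2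

theorem Tables.step {s s' : Store} (h : Tables G d s) (hE : Ext (ballRow n n) s s')
    (h0 : s'.var 0 = s.var 0) (h1 : s'.var 1 = s.var 1) (h3 : s'.var 3 = s.var 3)
    (h9 : s'.arr 9 = s.arr 9) (h10 : s'.arr 10 = s.arr 10) (h11 : s'.arr 11 = s.arr 11)
    (h5 : s.var 5 ≤ s'.var 5) (hz : ∀ i, s'.var 5 ≤ i → s'.arr 6 i = 0) : Tables G d s' where
  var0 := h0.trans h.var0
  var1 := h1.trans h.var1
  var3 := h3.trans h.var3
  ball v := (h.ball v).ext hE (by have := ballRow_le v; omega) (by rw [h9]) (by rw [h10])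
    (by rw [h11])
  free := h.free.trans h5
  zero := hz

theorem Ext.of_eq {b : ℕ} {s s' : Store} (ha : s'.arr = s.arr) (h4 : s'.var 4 = s.var 4)
    (h6 : s'.var 6 = s.var 6) : Ext b s s' := by
  constructor <;> intros <;> simp only [h4, h6, ha, le_refl]

theorem Tables.congr {s s' : Store} (h : Tables G d s) (ha : s'.arr = s.arr)
    (hv : ∀ y < 26, s'.var y = s.var y) : Tables G d s' := by
  have hv5 := hv 5 (by decide)
  refine h.step (Ext.of_eq ha (hv 4 (by decide)) (hv 6 (by decide))) (hv 0 (by decide))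
    (hv 1 (by decide)) (hv 3 (by decide)) (by rw [ha]) (by rw [ha]) (by rw [ha]) hv5.ge ?_
  rw [hv5, ha]
  exact h.zero

/-- Execute `body` for all vertices 50 and all vertices 51 in the ball around the vertex 50. -/
def forPairs (body : Prog) : Prog :=
  .seq (.const 50 0) <| forUp 50 0 52 <| .seq (.load 54 9 50) <| .seq (.load 53 10 50) <|
    .seq (.load 55 11 50) <| forUp 53 55 56 <| .seq (.load 51 8 53) body

theorem Store.next_var_of_lt {s : Store} {i hi tmp y : ℕ} (hy : y < 26) (hi' : 26 ≤ i)
    (ht : 26 ≤ tmp) : (s.next i hi tmp).var y = s.var y := by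
  rw [next_var, if_neg (by omega), if_neg (by omega), if_neg (by omega)]

theorem Store.setVar_var_of_lt {s : Store} {x k y : ℕ} (hy : y < 26) (hx : 26 ≤ x) :
    (s.setVar x k).var y = s.var y := by
  rw [setVar_var, if_neg (by omega)]

/-- The vertices in the ball around `v` are exactly the possible partners of `v`, which leaves at
most nR pairs. The list `l` records the pairs done, so that `I` can say what has been achieved; by
`hI` it depends only on the arrays and the registers below 26, not on loop counters. Besides the
body, each pair costs 5 steps and each `v` at most 9. -/
theorem wp_forPairs {body : Prog} {I : List (Fin n × Fin n) → Store → Prop} {τ : ℕ} {s : Store}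
    (hv : ∀ y ∈ [0, 1, 3, 50, 53, 54, 55], body.keepsVar y = true)
    (ha : ∀ b ∈ [9, 10, 11], body.keepsArr b = true)
    (hI : ∀ l s s', s'.arr = s.arr → (∀ y < 26, s'.var y = s.var y) → I l s → I l s')
    (hs : Tables G d s) (h0 : I [] s)
    (step : ∀ l s v w, Tables G d s → I l s → mark G d v w ≠ 0 → (v, w) ∉ l → s.var 50 = v →
      s.var 51 = w → s.var 54 = ballRow n v → Wp body s fun s' t => Ext (ballRow n n) s s' ∧
        s.var 5 ≤ s'.var 5 ∧ (∀ i, s'.var 5 ≤ i → s'.arr 6 i = 0) ∧ I ((v, w) :: l) s' ∧ t ≤ τ) :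
    Wp (forPairs body) s fun s' t => Tables G d s' ∧
      (∃ l, (∀ v w : Fin n, (v, w) ∈ l ↔ mark G d v w ≠ 0) ∧ I l s') ∧
      t ≤ n * (maxBallSize G d * (τ + 14)) + 3 := by
  simp only [List.mem_cons, List.not_mem_nil, or_false, forall_eq_or_imp, forall_eq] at hv ha
  simp only [forPairs, wp_seq, wp_const]
  refine wp_forUp (fun k s' t => Tables G d s' ∧
      (∃ l, (∀ v w : Fin n, (v, w) ∈ l ↔ (v : ℕ) < k ∧ mark G d v w ≠ 0) ∧ I l s') ∧
      t ≤ k * (maxBallSize G d * (τ + 14))) (by decide) (by decide) (by decide) (by decide)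
    (by decide) ?_ ?_ ?_ ?_ ?_ ?_
  · simp [forUp, incr, Prog.keepsVar, hv]
  · simp [forUp, incr, Prog.keepsVar, hv]
  · simp
  · refine ⟨hs.congr rfl fun y hy => ?_, ⟨[], by simp, hI _ s _ rfl (fun y hy => ?_) h0⟩, by simp⟩
    all_goals
      rw [Store.setVar_var_of_lt hy (by decide), Store.setVar_var_of_lt hy (by decide)]
  · rintro k s1 t1 - hk hk' - ⟨hT, ⟨l, hl, hIl⟩, ht⟩
    simp only [setVar_var, Nat.reduceEqDiff, ↓reduceIte, hs.var0] at hk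
    obtain ⟨v, rfl⟩ : ∃ v : Fin n, k = v := ⟨⟨k, hk⟩, rfl⟩
    simp only [wp_seq, wp_load, setVar_var, Nat.reduceEqDiff, ↓reduceIte, setVar_arr, hk']
    have hB := hT.ball v
    have hc := sum_list hB.inj hB.mem fun _ => 1
    simp only [Finset.sum_const, smul_eq_mul, mul_one, Nat.card_Ico] at hc
    have hR := card_ballFin_le (G := G) (d := d) v
    have hR1 := one_le_maxBallSize (G := G) (d := d) v
    generalize hs2 : ((s1.setVar 54 _).setVar 53 _).setVar 55 _ = s2
    have hT2 : Tables G d s2 := hT.congr (by rw [← hs2]; rfl) fun y hy => by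
      rw [← hs2]
      simp only [Store.setVar_var_of_lt hy, Nat.reduceLeDiff]
    have hI2 : I l s2 := hI _ _ _ (by rw [← hs2]; rfl) (fun y hy => by
      rw [← hs2]
      simp only [Store.setVar_var_of_lt hy, Nat.reduceLeDiff]) hIl
    obtain ⟨v6, v50, v53, v54, v55⟩ : s2.var 6 = s1.var 6 ∧ s2.var 50 = v ∧
        s2.var 53 = s1.arr 10 v ∧ s2.var 54 = ballRow n v ∧ s2.var 55 = s1.arr 11 v := by
      rw [← hs2]
      simp [hk', hB.handle]
    have a8 : s2.arr 8 = s1.arr 8 := by rw [← hs2]; rfl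
    clear hs2
    refine wp_forUp (fun j s' t => Tables G d s' ∧ s1.arr 11 v ≤ s'.var 6 ∧
        (∀ i < s1.arr 11 v, s'.arr 8 i = s1.arr 8 i) ∧
        (∃ l, (∀ a b : Fin n, (a, b) ∈ l ↔ (a : ℕ) < v ∧ mark G d a b ≠ 0 ∨
          a = v ∧ ∃ i ∈ Set.Ico (s1.arr 10 v) j, s1.arr 8 i = b) ∧ I l s') ∧
        t ≤ (j - s1.arr 10 v) * (τ + 5)) (by decide) (by decide) (by decide) (by decide)
      (by decide) ?_ ?_ ?_ ?_ ?_ ?_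
    · simp [Prog.keepsVar, hv]
    · simp [Prog.keepsVar, hv]
    · rw [v53, v55]; exact hB.lo_le
    · rw [v53, v55]
      refine ⟨hT2.congr rfl fun y hy => Store.setVar_var_of_lt hy (by decide), ?_, ?_,
        ⟨l, fun a b => ?_, hI _ s2 _ rfl (fun y hy => Store.setVar_var_of_lt hy (by decide)) hI2⟩, ?_⟩
      · simpa [v6] using hB.hi_le
      · simp [a8]
      · rw [hl]
        simp
      · simp
    · rw [v53, v55]
      rintro j s3 t3 hj1 hj2 hj hF ⟨hT3, h6, h8, ⟨l', hl', hI'⟩, ht3⟩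
      rw [wp_seq, wp_load, hj]
      obtain ⟨w, hw, e⟩ := (hB.mem (s1.arr 8 j)).1 ⟨j, ⟨hj1, hj2⟩, rfl⟩
      have e' : s3.arr 8 j = w := (h8 j hj2).trans e
      rw [e']
      have hlt : ∀ y < 26, (s3.setVar 51 w).var y = s3.var y := fun y hy =>
        Store.setVar_var_of_lt hy (by decide)
      have hT4 : Tables G d (s3.setVar 51 w) := hT3.congr rfl hlt
      refine Wp.mono (Wp.frame (step l' _ v w hT4 (hI _ s3 _ rfl hlt hI') (mem_ballFin.1 hw)
        ?_ ?_ ?_ ?_)) ?_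
      · rw [hl']
        rintro (h | ⟨-, i, hi, h⟩)
        · exact lt_irrefl _ h.1
        · have := hB.inj ⟨hi.1, hi.2.trans hj2⟩ ⟨hj1, hj2⟩ (h.trans e.symm)
          exact hi.2.ne this
      · have := hF.var 50 (by simp [forUp, incr, Prog.keepsVar, hv])
        simpa [v50] using this
      · simp
      · have := hF.var 54 (by simp [forUp, incr, Prog.keepsVar, hv])
        simpa [v54] using this
      · rintro s5 t5 ⟨⟨hE, h5, hz, hI5, ht5⟩, hF5⟩
        have hT5 : Tables G d s5 := hT4.step hE (hF5.var _ hv.1) (hF5.var _ hv.2.1)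
          (hF5.var _ hv.2.2.1) (hF5.arr _ ha.1) (hF5.arr _ ha.2.1) (hF5.arr _ ha.2.2) h5 hz
        have hlt' : ∀ y < 26, (s5.next 53 55 56).var y = s5.var y := fun y hy =>
          Store.next_var_of_lt hy (by decide) (by decide)
        have htl := hE.tail_le
        have hq := hE.queue
        rw [hlt 6 (by decide)] at htl hq
        refine ⟨hT5.congr rfl hlt', ?_, ?_, ⟨_, ?_, hI _ s5 _ rfl hlt' hI5⟩, ?_⟩
        · rw [hlt' 6 (by decide)]
          exact h6.trans htl
        · intro i hi
          rw [next_arr, hq i (hi.trans_le h6), setVar_arr, h8 i hi]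
        · intro a b
          rw [List.mem_cons, hl', Prod.mk.injEq]
          constructor
          · rintro (⟨rfl, rfl⟩ | h | ⟨rfl, i, hi, h⟩)
            · exact Or.inr ⟨rfl, j, ⟨hj1, Nat.lt_succ_self _⟩, e⟩
            · exact Or.inl h
            · exact Or.inr ⟨rfl, i, ⟨hi.1, hi.2.trans (Nat.lt_succ_self _)⟩, h⟩
          · rintro (h | ⟨rfl, i, hi, h⟩)
            · exact Or.inr (Or.inl h)
            · rcases Nat.lt_succ_iff_lt_or_eq.1 hi.2 with hij | rfl
              · exact Or.inr (Or.inr ⟨rfl, i, ⟨hi.1, hij⟩, h⟩)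
              · exact Or.inl ⟨rfl, Fin.ext (h.symm.trans e)⟩
        · rw [Nat.succ_sub hj1, Nat.succ_mul]
          clear * - ht3 ht5
          omega
    · rintro s3 t3 ⟨hT3, h6, h8, ⟨l', hl', hI'⟩, ht3⟩ - -
      rw [v55] at hl' ht3
      have hlt' : ∀ y < 26, (s3.next 50 0 52).var y = s3.var y := fun y hy =>
        Store.next_var_of_lt hy (by decide) (by decide)
      refine ⟨hT3.congr rfl hlt', ⟨l', fun a b => ?_, hI _ s3 _ rfl hlt' hI'⟩, ?_⟩
      · rw [hl', hB.mem b, Nat.lt_succ_iff_lt_or_eq, or_and_right]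
        refine or_congr_right ?_
        constructor
        · rintro ⟨rfl, u, hu, e⟩
          obtain rfl := Fin.ext e
          exact ⟨rfl, mem_ballFin.1 hu⟩
        · rintro ⟨h, h'⟩
          obtain rfl := Fin.ext h
          exact ⟨rfl, b, mem_ballFin.2 h', rfl⟩
      · rw [hc] at ht3
        have h1 := ht3.trans (Nat.mul_le_mul_right (τ + 5) hR)
        rw [Nat.succ_mul]
        have h2 : maxBallSize G d * (τ + 14) = maxBallSize G d * (τ + 5) + 9 * maxBallSize G d := by
          ring
        rw [h2] at ht ⊢
        clear * - ht h1 hR1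
        omega
  · rintro s1 t1 ⟨hT, ⟨l, hl, hIl⟩, ht⟩ - -
    simp only [setVar_var, Nat.reduceEqDiff, ↓reduceIte, hs.var0] at hl ht
    refine ⟨hT, ⟨l, fun v w => ?_, hIl⟩, by omega⟩
    rw [hl]
    exact and_iff_right v.2

end Pairs
end LocalSep

namespace LocalSep

open SimpleGraph Relation

/-! ### Components of the punctured explorer neighbourhoods -/

section Labels

variable {V : Type*} {G : SimpleGraph V} {d : ℕ} {v w : V}

/-- The labels from 2 to `L` are given to components of the punctured explorer neighbourhood;
the copies labelled 0 have not been visited yet. -/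
structure Labelling (G : SimpleGraph V) (d : ℕ) (v w : V) (lab : Bool × V → ℕ) (L : ℕ) : Prop where
  one_le : 1 ≤ L
  range : ∀ p, IsCopy G d v w p → lab p ≠ 0 → 2 ≤ lab p ∧ lab p ≤ L
  eq_iff : ∀ p q, IsCopy G d v w p → IsCopy G d v w q → lab p ≠ 0 →
    (lab p = lab q ↔ ReflTransGen (CopyRel G d v w) p q)
  used : ∀ k, 2 ≤ k → k ≤ L → ∃ p, IsCopy G d v w p ∧ lab p = k

/-- Labels are constant on components, so the component of the unlabelled `p₀` has no labels yet and
the new label is used for it alone. -/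
theorem Labelling.extend {lab lab' : Bool × V → ℕ} {L : ℕ} (h : Labelling G d v w lab L)
    {p₀ : Bool × V} (hp : IsCopy G d v w p₀) (h0 : lab p₀ = 0)
    (hv : ∀ q, IsCopy G d v w q → ReflTransGen (CopyRel G d v w) p₀ q → lab' q = L + 1)
    (hn : ∀ q, IsCopy G d v w q → ¬ ReflTransGen (CopyRel G d v w) p₀ q → lab' q = lab q) :
    Labelling G d v w lab' (L + 1) := by
  have hz : ∀ q, IsCopy G d v w q → ReflTransGen (CopyRel G d v w) p₀ q → lab q = 0 := by
    intro q hq hr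
    by_contra hne
    exact hne (((h.eq_iff q p₀ hq hp hne).2 (copyRel_rtg_symm hr)).trans h0)
  have hle : ∀ q, IsCopy G d v w q → lab q ≤ L := by
    intro q hq
    by_cases hne : lab q = 0
    · omega
    · exact (h.range q hq hne).2
  have h1 := h.one_le
  refine ⟨by omega, fun p hp' hne => ?_, fun p q hp' hq hne => ?_, fun k hk hk' => ?_⟩
  · by_cases hr : ReflTransGen (CopyRel G d v w) p₀ p
    · rw [hv p hp' hr]
      omega
    · rw [hn p hp' hr] at hne ⊢
      have := h.range p hp' hne
      omega
  · by_cases hr : ReflTransGen (CopyRel G d v w) p₀ p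
    · rw [hv p hp' hr]
      by_cases hr' : ReflTransGen (CopyRel G d v w) p₀ q
      · rw [hv q hq hr']
        exact iff_of_true rfl ((copyRel_rtg_symm hr).trans hr')
      · rw [hn q hq hr']
        have := hle q hq
        exact iff_of_false (by omega) fun h => hr' (hr.trans h)
    · rw [hn p hp' hr] at hne ⊢
      by_cases hr' : ReflTransGen (CopyRel G d v w) p₀ q
      · rw [hv q hq hr']
        have := hle p hp'
        exact iff_of_false (by omega) fun h => hr (hr'.trans (copyRel_rtg_symm h))
      · rw [hn q hq hr']
        exact h.eq_iff p q hp' hq hne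
  · rcases hk'.eq_or_lt with rfl | hk'
    · exact ⟨p₀, hp, hv p₀ hp .refl⟩
    · obtain ⟨p, hp', e⟩ := h.used k hk (by omega)
      refine ⟨p, hp', ?_⟩
      rw [hn p hp', e]
      intro hr
      rw [hz p hp' hr] at e
      omega

/-- The components have the labels from 2 to `L`, so there are `L - 1` of them; the truncated `L -
2` is nonzero when there are at least two. -/
theorem Labelling.isLocalSeparator_iff {lab : Bool × V → ℕ} {L : ℕ} (h : Labelling G d v w lab L)
    (hne : v ≠ w) (hm : mark G d v w ≠ 0) (hall : ∀ p, IsCopy G d v w p → lab p ≠ 0) :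
    IsLocalSeparator G d v w ↔ L - 2 ≠ 0 := by
  rw [LocalSep.isLocalSeparator_iff]
  constructor
  · rintro ⟨-, -, p, q, hp, hq, hr⟩
    have h1 := h.range p hp (hall p hp)
    have h2 := h.range q hq (hall q hq)
    have h3 : lab p ≠ lab q := fun e => hr ((h.eq_iff p q hp hq (hall p hp)).1 e)
    omega
  · intro hL
    obtain ⟨p, hp, e⟩ := h.used 2 le_rfl (by omega)
    obtain ⟨q, hq, e'⟩ := h.used 3 (by omega) (by omega)
    refine ⟨hne, mem_ball_iff.1 (mark_ne_zero.1 hm), p, q, hp, hq, fun hr => ?_⟩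
    have := (h.eq_iff p q hp hq (hall p hp)).2 hr
    omega

end Labels

section Copies

variable {n : ℕ} {G : SimpleGraph (Fin n)} {d : ℕ}

/-- The number by which a copy is represented in the storage. -/
def code (p : Bool × Fin n) : ℕ := cond p.1 n 0 + p.2

theorem code_lt (p : Bool × Fin n) : code p < n + n := by
  obtain ⟨i, u⟩ := p
  cases i <;> simp only [code, cond_true, cond_false] <;> omega

theorem code_injective : Function.Injective (code (n := n)) := by
  rintro ⟨i, u⟩ ⟨j, x⟩ h
  cases i <;> cases j <;> simp only [code, cond_true, cond_false] at h
  · exact Prod.ext rfl (Fin.ext (by simpa using h))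
  · omega
  · omega
  · exact Prod.ext rfl (Fin.ext (by simpa using h))

/-- The ball of the side of a copy contains its vertex. -/
def IsValid (G : SimpleGraph (Fin n)) (d : ℕ) (v w : Fin n) (p : Bool × Fin n) : Prop :=
  mark G d (cond p.1 w v) p.2 ≠ 0

/-- The rows from `h` on represent the disjoint union of the balls around `v` and `w`, with links
between the two copies of a vertex that is close to both. -/
structure CopiesTab (G : SimpleGraph (Fin n)) (d : ℕ) (v w : Fin n) (h : ℕ) (s : Store) : Prop where
  row : ∀ p, IsValid G d v w p → s.arr 4 (h + code p) ≤ s.arr 5 (h + code p)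
  nb : ∀ p, IsValid G d v w p → ∀ y, Nb s h (code p) y ↔
    (∃ x, (ball G d (cond p.1 w v)).Adj p.2 x ∧ y = code (p.1, x)) ∨
      (Close G d v w p.2 ∧ y = code (!p.1, p.2))
  len : ∀ p, IsValid G d v w p → rowLen s h (code p) ≤ ballDegree G d (cond p.1 w v) p.2 + 1

/-- The table still contains the copies of `v` and `w`; between other copies, its edges are those of
`CopyRel`. -/
theorem CopiesTab.nb_valid {v w : Fin n} {h : ℕ} {s : Store} (hc : CopiesTab G d v w h s)
    {p : Bool × Fin n} (hp : IsValid G d v w p) {y : ℕ} (hy : Nb s h (code p) y) :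
    ∃ q, IsValid G d v w q ∧ y = code q ∧
      (p.2 ≠ v → p.2 ≠ w → q.2 ≠ v → q.2 ≠ w → CopyRel G d v w p q) := by
  rcases (hc.nb p hp y).1 hy with ⟨x, hx, rfl⟩ | ⟨hcl, rfl⟩
  · exact ⟨_, mark_ne_zero.2 hx.snd_mem, rfl, fun h1 h2 h3 h4 => ⟨⟨h1, h2, h3, h4⟩, Or.inl ⟨rfl, hx⟩⟩⟩
  · refine ⟨_, ?_, rfl, fun h1 h2 h3 h4 => ⟨⟨h1, h2, h3, h4⟩, Or.inr ⟨?_, rfl, hcl⟩⟩⟩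
    · obtain ⟨i, u⟩ := p
      cases i
      · exact mark_ne_zero.2 hcl.mem_ball_right
      · exact mark_ne_zero.2 hcl.mem_ball_left
    · simp

theorem CopiesTab.nb_of_copyRel {v w : Fin n} {h : ℕ} {s : Store} (hc : CopiesTab G d v w h s)
    {p q : Bool × Fin n} (hp : IsValid G d v w p) (hr : CopyRel G d v w p q) :
    Nb s h (code p) (code q) ∧ IsValid G d v w q := by
  have key : Nb s h (code p) (code q) := by
    rw [hc.nb p hp]
    obtain ⟨-, ⟨h1, h2⟩ | ⟨h1, h2, h3⟩⟩ := hr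
    · exact Or.inl ⟨q.2, h2, by rw [h1]⟩
    · refine Or.inr ⟨h3, congrArg code (Prod.ext ?_ h2.symm)⟩
      revert h1
      cases p.1 <;> cases q.1 <;> simp
  obtain ⟨q', hq', e, -⟩ := hc.nb_valid hp key
  exact ⟨key, code_injective e ▸ hq'⟩

/-- Writes one half of the graph of copies. The lists of the ball are copied in full, since their
edges already pass the distance test, and each gains at most one link. -/
theorem wp_buildBall {s : Store} (hT : Tables G d s) {a b : Fin n} (hm : mark G d a b ≠ 0)
    (h30 : s.var 30 = s.arr 10 a) (h31 : s.var 31 = s.arr 11 a) (h32 : s.var 32 = ballRow n a)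
    (h36 : s.var 36 = ballRow n a) (h37 : s.var 37 = ballRow n b) (h38 : s.var 38 = mark G d a b)
    (h35 : ballRow n n ≤ s.var 35) :
    Wp build s fun s' t => Ext (s.var 35) s s' ∧
      (∀ u ∈ ballFin G d a, s'.arr 4 (s.var 35 + s.var 33 + u) ≤ s'.arr 5 (s.var 35 + s.var 33 + u) ∧
        s'.arr 5 (s.var 35 + s.var 33 + u) ≤ s'.var 4 ∧
        (∀ y, Nb s' (s.var 35 + s.var 33) u y ↔
          (∃ x : Fin n, (ball G d a).Adj u x ∧ y = s.var 33 + x) ∨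
            (Close G d a b u ∧ y = s.var 34 + u)) ∧
        rowLen s' (s.var 35 + s.var 33) u ≤ ballDegree G d a u + 1) ∧
      (∀ i, (∀ u : Fin n, i ≠ s.var 35 + s.var 33 + u) →
        s'.arr 4 i = s.arr 4 i ∧ s'.arr 5 i = s.arr 5 i) ∧
      t ≤ 60 * maxBallSize G d + 2 := by
  have hB := hT.ball a
  have hB' := hT.ball b
  have hlt : ∀ u : Fin n, ballRow n a + u < s.var 35 := fun u => by
    have := ballRow_le a
    omega
  refine Wp.mono (Wp.frame (wp_build ?_ ?_ ?_)) ?_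
  · rw [h30, h31]; exact hB.lo_le
  · rw [h30, h31]; exact hB.inj
  · rw [h30, h31, h32]
    intro j hj
    obtain ⟨u, hu, e⟩ := (hB.mem _).1 ⟨j, hj, rfl⟩
    rw [e]
    exact ⟨hlt u, hB.row u hu⟩
  rintro s' t ⟨⟨hP, ht⟩, hF⟩
  rw [h30, h31, h32, sum_list hB.inj hB.mem fun u => rowLen s (ballRow n a) u + 1] at ht
  refine ⟨hP.ext hF, fun u hu => ?_, fun i hi => hP.out i fun j hj => ?_, ?_⟩
  · obtain ⟨j, hj, e⟩ := (hB.mem u).2 ⟨u, hu, rfl⟩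
    have hr := hP.row j (by rw [h30, h31]; exact hj)
    rw [e] at hr
    have hin : ∀ x : Fin n, (ball G d a).Adj u x →
        InBall s (s.var 36) (s.arr 6 (s.var 36 + u)) x := by
      intro x hx
      have h1 := (ball_adj_iff_mark (mem_ballFin.1 hu)).1 hx
      rw [InBall, h36, hT.var1, hB.val, hB.val]
      exact h1.2
    have hlink : IsLinked s (s.var 37) (s.arr 6 (s.var 36 + u)) (s.var 38) u ↔ Close G d a b u := by
      rw [close_iff_mark (mem_ballFin.1 hu) hm, IsLinked, h36, h37, h38, hT.var1, hB.val, hB'.val]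
    refine ⟨hr.le, hr.le_ptr, fun y => ?_, ?_⟩
    · rw [hr.nb, hlink]
      refine or_congr_left ?_
      constructor
      · rintro ⟨x, hx, -, rfl⟩
        rw [h32] at hx
        obtain ⟨x, hadj, rfl⟩ := (hB.nb u hu x).1 hx
        exact ⟨x, hadj, rfl⟩
      · rintro ⟨x, hx, rfl⟩
        exact ⟨x, by rw [h32]; exact (hB.nb u hu x).2 ⟨x, hx, rfl⟩, hin x hx, rfl⟩
    · refine hr.len.trans (add_le_add ?_ ?_)
      · rw [h32]
        refine le_trans (le_trans (Finset.sum_le_sum fun e _ => ite_le_one le_rfl zero_le_one) ?_)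
          (hB.len u hu)
        simp [rowLen]
      · exact ite_le_one le_rfl zero_le_one
  · obtain ⟨u, hu, e⟩ := (hB.mem _).1 ⟨j, by rw [← h30, ← h31]; exact hj, rfl⟩
    rw [e]
    exact hi u
  · have h1 : ∑ u ∈ ballFin G d a, (rowLen s (ballRow n a) u + 1) ≤ 2 * maxBallSize G d :=
      (Finset.sum_le_sum fun u hu => Nat.add_le_add_right (hB.len u hu) 1).trans (sum_ballDegree_le a)
    omega

/-- Write the graph of the copies in the balls around the vertices 50 and 51 to the rows from
register 5 on. -/
def copiesGraph : Prog :=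
  .seq (.load 59 9 51) <| .seq (.load 60 10 51) <| .seq (.load 61 11 51) <|
    .seq (.load 62 10 50) <| .seq (.load 63 11 50) <| .seq (.add 64 54 51) <|
    .seq (.load 38 6 64) <| .seq (.store 12 64 5) <| .seq (.copy 35 5) <| .seq (.copy 30 62) <|
    .seq (.copy 31 63) <| .seq (.copy 32 54) <| .seq (.const 33 0) <| .seq (.copy 34 0) <|
    .seq (.copy 36 54) <| .seq (.copy 37 59) <| .seq build <| .seq (.copy 30 60) <|
    .seq (.copy 31 61) <| .seq (.copy 32 59) <| .seq (.copy 33 0) <| .seq (.const 34 0) <|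
    .seq (.copy 36 59) <| .seq (.copy 37 54) build

set_option maxHeartbeats 400000 in
theorem wp_copiesGraph {s : Store} (hT : Tables G d s) {v w : Fin n} (hm : mark G d v w ≠ 0)
    (h50 : s.var 50 = v) (h51 : s.var 51 = w) (h54 : s.var 54 = ballRow n v) :
    Wp copiesGraph s fun s' t => CopiesTab G d v w (s.var 5) s' ∧ Ext (s.var 5) s s' ∧
      s'.arr 12 = Function.update (s.arr 12) (ballRow n v + w) (s.var 5) ∧
      s'.var 60 = s.arr 10 w ∧ s'.var 61 = s.arr 11 w ∧ s'.var 62 = s.arr 10 v ∧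
      s'.var 63 = s.arr 11 v ∧ s'.var 64 = ballRow n v + w ∧ t ≤ 120 * maxBallSize G d + 30 := by
  have hfree := hT.free
  simp only [copiesGraph, wp_seq, wp_copy, wp_const, wp_store, wp_add, wp_load, setVar_var,
    Nat.reduceEqDiff, ↓reduceIte, setVar_arr, setArr_var, h50, h51, h54,
    (hT.ball w).handle, (hT.ball v).val, hT.var0]
  generalize hs1 : Store.setVar _ 37 _ = s1
  have a : ∀ b ≠ 12, s1.arr b = s.arr b := fun b hb => by
    rw [← hs1]
    simp [hb]
  have a12 : s1.arr 12 = Function.update (s.arr 12) (ballRow n v + w) (s.var 5) := by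
    rw [← hs1]; simp
  have vv : ∀ y < 26, s1.var y = s.var y := fun y hy => by
    rw [← hs1]
    simp only [Store.setVar_var_of_lt hy, Nat.reduceLeDiff, setArr_var]
  obtain ⟨v30, v31, v32, v33, v34, v35, v36, v37, v38, v54, v59, v60, v61, v62, v63, v64⟩ :
      s1.var 30 = s.arr 10 v ∧ s1.var 31 = s.arr 11 v ∧ s1.var 32 = ballRow n v ∧
      s1.var 33 = 0 ∧ s1.var 34 = n ∧ s1.var 35 = s.var 5 ∧ s1.var 36 = ballRow n v ∧
      s1.var 37 = ballRow n w ∧ s1.var 38 = mark G d v w ∧ s1.var 54 = ballRow n v ∧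
      s1.var 59 = ballRow n w ∧ s1.var 60 = s.arr 10 w ∧ s1.var 61 = s.arr 11 w ∧
      s1.var 62 = s.arr 10 v ∧ s1.var 63 = s.arr 11 v ∧ s1.var 64 = ballRow n v + w := by
    rw [← hs1]
    simp [h54]
  clear hs1
  have hE1 : ∀ b, Ext b s s1 := fun b => by
    constructor <;> intros <;>
      simp only [vv 4 (by decide), vv 6 (by decide), a 1 (by decide), a 4 (by decide),
        a 5 (by decide), a 6 (by decide), a 8 (by decide), le_refl]
  have e9 := a 9 (by decide)
  have e10 := a 10 (by decide)
  have e11 := a 11 (by decide)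
  have hv5 := vv 5 (by decide)
  have hT1 : Tables G d s1 := hT.step (hE1 _) (vv 0 (by decide)) (vv 1 (by decide))
    (vv 3 (by decide)) e9 e10 e11 hv5.ge (by rw [hv5, a 6 (by decide)]; exact hT.zero)
  refine Wp.mono (Wp.frame (wp_buildBall hT1 hm (v30.trans (by rw [e10])) (v31.trans (by rw [e11]))
    v32 v36 v37 v38 (by rw [v35]; exact hfree))) ?_
  rintro s2 t2 ⟨⟨hE2, hr2, ho2, ht2⟩, hF2⟩
  rw [v35] at hE2 ho2
  rw [v33, v34, v35] at hr2
  rw [v33] at ho2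
  have f5 := (hF2.var 5 rfl).trans hv5
  have hT2 : Tables G d s2 := hT1.step ⟨hE2.ptr_le, hE2.tail_le, hE2.edges, hE2.queue,
    fun i hi => hE2.start i (hi.trans_le hfree), fun i hi => hE2.rowEnd i (hi.trans_le hfree),
    fun i hi => hE2.val i (hi.trans_le hfree)⟩ (hF2.var 0 rfl) (hF2.var 1 rfl) (hF2.var 3 rfl)
    (hF2.arr 9 rfl) (hF2.arr 10 rfl) (hF2.arr 11 rfl) (hF2.var 5 rfl).ge
    (by rw [hF2.var 5 rfl, hF2.arr 6 rfl]; exact hT1.zero)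
  have g12 := (hF2.arr 12 rfl).trans a12
  have g10 := (hF2.arr 10 rfl).trans e10
  have g11 := (hF2.arr 11 rfl).trans e11
  have k54 := (hF2.var 54 rfl).trans v54
  have k59 := (hF2.var 59 rfl).trans v59
  have k60 := (hF2.var 60 rfl).trans v60
  have k61 := (hF2.var 61 rfl).trans v61
  have k62 := (hF2.var 62 rfl).trans v62
  have k63 := (hF2.var 63 rfl).trans v63
  have k64 := (hF2.var 64 rfl).trans v64
  have k35 := (hF2.var 35 rfl).trans v35
  have k38 := (hF2.var 38 rfl).trans v38
  simp only [k54, k59, k60, k61, hT2.var0]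
  generalize hs3 : Store.setVar _ 37 _ = s3
  have b : s3.arr = s2.arr := by rw [← hs3]; rfl
  have vv3 : ∀ y < 26, s3.var y = s2.var y := fun y hy => by
    rw [← hs3]
    simp only [Store.setVar_var_of_lt hy, Nat.reduceLeDiff]
  obtain ⟨w30, w31, w32, w33, w34, w35, w36, w37, w38, w60, w61, w62, w63, w64⟩ :
      s3.var 30 = s.arr 10 w ∧ s3.var 31 = s.arr 11 w ∧ s3.var 32 = ballRow n w ∧
      s3.var 33 = n ∧ s3.var 34 = 0 ∧ s3.var 35 = s.var 5 ∧ s3.var 36 = ballRow n w ∧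
      s3.var 37 = ballRow n v ∧ s3.var 38 = mark G d v w ∧ s3.var 60 = s.arr 10 w ∧
      s3.var 61 = s.arr 11 w ∧
      s3.var 62 = s.arr 10 v ∧ s3.var 63 = s.arr 11 v ∧ s3.var 64 = ballRow n v + w := by
    rw [← hs3]
    simp [k60, k61, k62, k63, k64, k35, k38]
  clear hs3
  refine Wp.mono (Wp.frame (wp_buildBall (hT2.congr b vv3) (a := w) (b := v)
    (by rwa [mark_comm]) (w30.trans (by rw [b, g10])) (w31.trans (by rw [b, g11]))
    w32 w36 w37 (w38.trans (mark_comm _ _)) (by rw [w35]; exact hfree))) ?_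
  rintro s4 t4 ⟨⟨hE4, hr4, ho4, ht4⟩, hF4⟩
  rw [w35, w33] at ho4
  rw [w33, w34, w35] at hr4
  rw [w35] at hE4
  have hE34 : Ext (s.var 5) s2 s4 :=
    (Ext.of_eq b (vv3 4 (by decide)) (vv3 6 (by decide))).trans hE4
  have hE : Ext (s.var 5) s s4 := (hE1 _).trans (hE2.trans hE34)
  -- The second call writes only to rows shifted by `n`, so the half for the first ball survives.
  have keep : ∀ u : Fin n, s4.arr 4 (s.var 5 + 0 + u) = s2.arr 4 (s.var 5 + 0 + u) ∧
      s4.arr 5 (s.var 5 + 0 + u) = s2.arr 5 (s.var 5 + 0 + u) := fun u => by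
    have := ho4 (s.var 5 + 0 + u) fun x => by omega
    rwa [b] at this
  refine ⟨⟨?_, ?_, ?_⟩, hE, ?_, ?_, ?_, ?_, ?_, ?_, ?_⟩
  · rintro ⟨_ | _, u⟩ hp
    · have h1 := hr2 u (mem_ballFin.2 hp)
      rw [code, cond_false, ← Nat.add_assoc, (keep u).1, (keep u).2]
      exact h1.1
    · rw [code, cond_true, ← Nat.add_assoc]
      exact (hr4 u (mem_ballFin.2 hp)).1
  · rintro ⟨_ | _, u⟩ hp y
    · obtain ⟨-, h1, h2, -⟩ := hr2 u (mem_ballFin.2 hp)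
      have h3 := nb_congr (g := s.var 5) (g' := s.var 5) (u := 0 + u) (u' := 0 + u) (s := s2)
        (s' := s4) (by rw [← Nat.add_assoc]; exact (keep u).1)
        (by rw [← Nat.add_assoc]; exact (keep u).2) (by rw [← Nat.add_assoc]; exact h1) hE34.edges y
      have h4 : Nb s2 (s.var 5) (0 + u) y ↔ Nb s2 (s.var 5 + 0) u y := by
        rw [Nat.zero_add, Nat.add_zero]
      rw [code, cond_false, h3, h4]
      exact h2 y
    · obtain ⟨-, -, h2, -⟩ := hr4 u (mem_ballFin.2 hp)
      have h3 : Nb s4 (s.var 5) (n + u) y ↔ Nb s4 (s.var 5 + n) u y := by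
        rw [Nb, Nb, Nat.add_assoc]
      rw [code, cond_true, h3, h2]
      exact or_congr_right (and_congr_left fun _ => ⟨Close.swap, Close.swap⟩)
  · rintro ⟨_ | _, u⟩ hp
    · have h1 := (hr2 u (mem_ballFin.2 hp)).2.2.2
      rw [rowLen, code, cond_false, ← Nat.add_assoc, (keep u).1, (keep u).2]
      exact h1
    · have h1 := (hr4 u (mem_ballFin.2 hp)).2.2.2
      rw [rowLen, code, cond_true, ← Nat.add_assoc]
      exact h1
  · rw [hF4.arr 12 rfl, b, g12]
  · rw [hF4.var 60 rfl, w60]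
  · rw [hF4.var 61 rfl, w61]
  · rw [hF4.var 62 rfl, w62]
  · rw [hF4.var 63 rfl, w63]
  · rw [hF4.var 64 rfl, w64]
  · clear * - ht2 ht4
    ring_nf at ht2 ht4 ⊢
    omega

end Copies
end LocalSep

namespace LocalSep

open SimpleGraph Relation

section Label

variable {n : ℕ} {G : SimpleGraph (Fin n)} {d : ℕ}

theorem CopiesTab.congr {v w : Fin n} {h : ℕ} {s s' : Store} (hc : CopiesTab G d v w h s)
    (h1 : s'.arr 1 = s.arr 1) (h4 : s'.arr 4 = s.arr 4) (h5 : s'.arr 5 = s.arr 5) :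
    CopiesTab G d v w h s' where
  row := by rw [h4, h5]; exact hc.row
  nb p hp y := by rw [Nb, h1, h4, h5]; exact hc.nb p hp y
  len p hp := by rw [rowLen, h4, h5]; exact hc.len p hp

theorem pot_congr {s s' : Store} {g h W : ℕ} (h4 : s'.arr 4 = s.arr 4) (h5 : s'.arr 5 = s.arr 5)
    (h6 : s'.arr 6 = s.arr 6) : pot s' g h W = pot s g h W := by
  simp only [pot, rowLen, h4, h5, h6]

theorem BfsPost.keep {s s' : Store} {U : ℕ → Prop} {W : ℕ} (h : BfsPost s U W s') {x : ℕ}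
    (hx : s.arr 6 (s.var 11 + x) ≠ 0) : s'.arr 6 (s.var 11 + x) = s.arr 6 (s.var 11 + x) := by
  refine h.unmarked x ?_
  rintro j hj rfl
  exact hx (h.mem j hj).2.1

/-- A stage of the computation of the components of the punctured explorer neighbourhood. -/
structure Labelled (G : SimpleGraph (Fin n)) (d : ℕ) (v w : Fin n) (s : Store) : Prop where
  var10 : s.var 10 = s.var 5
  var11 : s.var 11 = s.var 5
  var14 : s.var 14 = 0
  var15 : s.var 15 = 8 * n + 8
  tab : CopiesTab G d v w (s.var 5) s
  valid : ∀ x, s.arr 6 (s.var 5 + x) ≠ 0 → ∃ p, IsValid G d v w p ∧ code p = x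
  pre : ∀ p, p.2 = v ∨ p.2 = w → s.arr 6 (s.var 5 + code p) ≠ 0
  lab : Labelling G d v w (fun p => s.arr 6 (s.var 5 + code p)) (s.var 13)

theorem Labelled.congr {v w : Fin n} {s s' : Store} (h : Labelled G d v w s)
    (ha : s'.arr = s.arr) (hv : ∀ y < 26, s'.var y = s.var y) : Labelled G d v w s' := by
  have h5 := hv 5 (by decide)
  refine ⟨?_, ?_, ?_, ?_, ?_, ?_, ?_, ?_⟩
  · rw [h5, hv 10 (by decide), h.var10]
  · rw [h5, hv 11 (by decide), h.var11]
  · rw [hv 14 (by decide), h.var14]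
  · rw [hv 15 (by decide), h.var15]
  · rw [h5]; exact h.tab.congr (by rw [ha]) (by rw [ha]) (by rw [ha])
  · rw [h5, ha]; exact h.valid
  · rw [h5, ha]; exact h.pre
  · rw [h5, ha, hv 13 (by decide)]; exact h.lab

/-- A search with increment 0 marks all it reaches with the new label. The copies of `v` and `w` and
all earlier components are marked already and block it, so it finds exactly the component of `p₀`.
-/
theorem Labelled.bfs {v w : Fin n} {s s₁ s' : Store} (h : Labelled G d v w s)
    (ha : s₁.arr = s.arr) (hv : ∀ y < 26, y ≠ 13 → s₁.var y = s.var y)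
    (h13 : s₁.var 13 = s.var 13 + 1) (hL : s.var 13 < 2 * n + 2) {p₀ : Bool × Fin n}
    (hp : IsValid G d v w p₀) (h12 : s.var 12 = code p₀)
    (h0 : s.arr 6 (s.var 5 + code p₀) = 0)
    (hb : BfsPost s₁ (fun x => ∃ p, IsValid G d v w p ∧ code p = x) (n + n) s')
    (hF : Frame bfs s₁ s') : Labelled G d v w s' := by
  have e5 := hv 5 (by decide) (by decide)
  have e11 : s₁.var 11 = s.var 5 := by rw [hv 11 (by decide) (by decide), h.var11]
  have e10 : s₁.var 10 = s.var 5 := by rw [hv 10 (by decide) (by decide), h.var10]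
  have e12 : s₁.var 12 = code p₀ := by rw [hv 12 (by decide) (by decide), h12]
  have e14 : s₁.var 14 = 0 := by rw [hv 14 (by decide) (by decide), h.var14]
  have e15 : s₁.var 15 = 8 * n + 8 := by rw [hv 15 (by decide) (by decide), h.var15]
  have f5 : s'.var 5 = s.var 5 := (hF.var 5 rfl).trans e5
  have htab : CopiesTab G d v w (s.var 5) s₁ :=
    h.tab.congr (by rw [ha]) (by rw [ha]) (by rw [ha])
  have hkeep : ∀ x, s.arr 6 (s.var 5 + x) ≠ 0 → s'.arr 6 (s.var 5 + x) = s.arr 6 (s.var 5 + x) := by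
    intro x hx
    have := hb.keep (x := x) (by rwa [e11, ha])
    rwa [e11, ha] at this
  have hmem := hb.mem
  have hpar := hb.par
  have hcl := hb.closed
  have hsrc := hb.src
  have hunm := hb.unmarked
  rw [e11, ha] at hmem hunm
  rw [e11, h13, e12] at hsrc
  rw [e10, e11, e14] at hpar
  rw [e10, e11, e14, e15, ha] at hcl
  have hmk : ∀ x, s.arr 6 (s.var 5 + x) = 0 →
      ((∃ j ∈ Set.Ico (s₁.var 6) (s'.var 6), s'.arr 8 j = x) ↔ s'.arr 6 (s.var 5 + x) ≠ 0) := by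
    intro x hx
    have := hb.marked (x := x) (by rwa [e11, ha])
    rwa [e11] at this
  have hpre : ∀ p : Bool × Fin n, s.arr 6 (s.var 5 + code p) = 0 → p.2 ≠ v ∧ p.2 ≠ w := by
    intro p hp
    by_contra hc
    exact h.pre p (by tauto) hp
  have hcopy : ∀ p, IsValid G d v w p → s.arr 6 (s.var 5 + code p) = 0 → IsCopy G d v w p :=
    fun p hp h0 => ⟨mark_ne_zero.1 hp, hpre p h0⟩
  have hvalid : ∀ p, IsCopy G d v w p → IsValid G d v w p := fun p hp => mark_ne_zero.2 hp.1
  -- Newly reached copies were unmarked, hence are not copies of `v` or `w`, so every tree edge is a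
  -- step of `CopyRel`.
  have hreach : ∀ j, s₁.var 6 ≤ j → j < s'.var 6 → ∀ q, s'.arr 8 j = code q →
      s'.arr 6 (s.var 5 + code q) = s.var 13 + 1 ∧ ReflTransGen (CopyRel G d v w) p₀ q := by
    intro j
    induction j using Nat.strong_induction_on with
    | _ j ih =>
      intro hj1 hj2 q hq
      rcases hj1.eq_or_lt with rfl | hj1
      · obtain rfl := code_injective (hsrc.1.symm.trans hq)
        exact ⟨hsrc.2, .refl⟩
      · obtain ⟨i, hi, hij, -, hn, hval, -⟩ := hpar j ⟨hj1, hj2⟩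
        obtain ⟨⟨p, hp1, hp2⟩, hp3, -⟩ := hmem i hi
        obtain ⟨-, hq3, -⟩ := hmem j ⟨hj1.le, hj2⟩
        obtain ⟨h1, h2⟩ := ih i hij hi.1 hi.2 p hp2.symm
        rw [hq] at hq3 hn hval
        rw [← hp2] at hp3 hn hval
        refine ⟨by rw [hval, h1, Nat.add_zero], h2.tail ?_⟩
        obtain ⟨q', -, e, hr⟩ := htab.nb_valid hp1 hn
        obtain rfl := code_injective e
        exact hr (hpre _ hp3).1 (hpre _ hp3).2 (hpre _ hq3).1 (hpre _ hq3).2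
  have hp0 := hcopy p₀ hp h0
  -- Labels are at most `2 * n + 2`, so twice a label stays below the limit `8 * n + 8` and every
  -- visited copy is expanded.
  have hvis : ∀ q, IsCopy G d v w q → ReflTransGen (CopyRel G d v w) p₀ q →
      s'.arr 6 (s.var 5 + code q) = s.var 13 + 1 := by
    intro q hq hr
    have hz : ∀ q, IsCopy G d v w q → ReflTransGen (CopyRel G d v w) p₀ q →
        s.arr 6 (s.var 5 + code q) = 0 := by
      intro q hq hr
      by_contra hne
      exact hne (((h.lab.eq_iff q p₀ hq hp0 hne).2 (copyRel_rtg_symm hr)).trans h0)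
    have hqn : IsCopy G d v w q ∧ s'.arr 6 (s.var 5 + code q) ≠ 0 := by
      induction hr with
      | refl =>
        refine ⟨hp0, ?_⟩
        rw [hsrc.2]
        omega
      | @tail a b hab hr ih =>
        have hav : IsValid G d v w a := by
          have := hr.symm
          exact (htab.nb_of_copyRel (hvalid b hq) this).2
        have hac : IsCopy G d v w a := ⟨mark_ne_zero.1 hav, hr.1.1, hr.1.2.1⟩
        obtain ⟨-, hne⟩ := ih hac
        obtain ⟨j, hj, e⟩ := (hmk _ (hz a hac hab)).2 hne
        have h1 := hcl j hj
        rw [e, (hreach j hj.1 hj.2 a e).1] at h1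
        obtain ⟨hnb, -⟩ := htab.nb_of_copyRel (hvalid a hac) hr
        exact ⟨hq, (h1 (by omega) _ hnb).1⟩
    obtain ⟨j, hj, e⟩ := (hmk _ (hz q hq hr)).2 hqn.2
    exact (hreach j hj.1 hj.2 q e).1
  refine ⟨?_, ?_, ?_, ?_, ?_, ?_, ?_, ?_⟩
  · rw [f5, hF.var 10 rfl, e10]
  · rw [f5, hF.var 11 rfl, e11]
  · rw [hF.var 14 rfl, e14]
  · rw [hF.var 15 rfl, e15]
  · rw [f5]
    exact htab.congr (hF.arr 1 rfl) (hF.arr 4 rfl) (hF.arr 5 rfl)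
  · intro x hx
    rw [f5] at hx
    by_cases hx0 : s.arr 6 (s.var 5 + x) = 0
    · obtain ⟨j, hj, rfl⟩ := (hmk x hx0).2 hx
      exact (hmem j hj).1
    · exact h.valid x hx0
  · intro p hp
    rw [f5, hkeep _ (h.pre p hp)]
    exact h.pre p hp
  · rw [hF.var 13 rfl, h13, f5]
    refine h.lab.extend hp0 h0 hvis fun q hq hr => ?_
    refine hunm _ ?_
    intro j hj e
    exact hr (hreach j hj.1 hj.2 q e).2

/-- Label the component of a copy, unless it has been labelled before. -/
def labelStep : Prog :=
  .seq (.load 12 8 30) <| .seq (.add 12 12 33) <| .seq (.add 66 5 12) <| .seq (.load 66 6 66) <|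
    .cond 66 .skip (.seq (incr 13) bfs)

theorem wp_labelStep {s : Store} {v w : Fin n} (h : Labelled G d v w s)
    (hL : s.var 13 < 2 * n + 2) {p : Bool × Fin n} (hp : IsValid G d v w p)
    (hq : s.arr 8 (s.var 30) + s.var 33 = code p) :
    Wp labelStep s fun s' t => Labelled G d v w s' ∧ Ext (s.var 5) s s' ∧
      (∀ x, s.arr 6 (s.var 5 + x) ≠ 0 → s'.arr 6 (s.var 5 + x) ≠ 0) ∧
      s'.arr 6 (s.var 5 + code p) ≠ 0 ∧ s'.var 13 ≤ s.var 13 + 1 ∧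
      t + 20 * pot s (s.var 5) (s.var 5) (n + n) ≤
        20 * pot s' (s.var 5) (s.var 5) (n + n) + 40 := by
  simp only [labelStep, wp_seq, wp_load, wp_add, wp_cond, wp_skip, wp_incr, setVar_var,
    Nat.reduceEqDiff, ↓reduceIte, setVar_arr, hq]
  refine ⟨fun hne => ?_, fun h0 => ?_⟩
  · generalize hs1 : Store.setVar _ 66 _ = s1
    have a : s1.arr = s.arr := by rw [← hs1]; rfl
    have vv : ∀ y < 26, y ≠ 12 → s1.var y = s.var y := fun y hy hy' => by
      rw [← hs1]
      simp only [Store.setVar_var_of_lt hy, Nat.reduceLeDiff]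
      simp [hy']
    clear hs1
    have e5 := vv 5 (by decide) (by decide)
    have e13 := vv 13 (by decide) (by decide)
    refine ⟨⟨?_, ?_, ?_, ?_, ?_, ?_, ?_, ?_⟩,
      Ext.of_eq a (vv 4 (by decide) (by decide)) (vv 6 (by decide) (by decide)), ?_, ?_, ?_, ?_⟩
    · rw [e5, vv 10 (by decide) (by decide), h.var10]
    · rw [e5, vv 11 (by decide) (by decide), h.var11]
    · rw [vv 14 (by decide) (by decide), h.var14]
    · rw [vv 15 (by decide) (by decide), h.var15]
    · rw [e5]; exact h.tab.congr (by rw [a]) (by rw [a]) (by rw [a])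
    · rw [e5, a]; exact h.valid
    · rw [e5, a]; exact h.pre
    · rw [e5, a, e13]; exact h.lab
    · exact fun x hx => hx
    · exact hne
    · exact Nat.le_succ _
    · rw [pot_congr (s' := s1) (s := s) (by rw [a]) (by rw [a]) (by rw [a])]
      omega
  · generalize hs1 : Store.setVar _ 13 _ = s1
    have a : s1.arr = s.arr := by rw [← hs1]; rfl
    have vv : ∀ y < 26, y ≠ 12 → y ≠ 13 → s1.var y = s.var y := fun y hy hy' hy'' => by
      rw [← hs1]
      simp only [setVar_var, hy', hy'', show y ≠ 26 by omega, show y ≠ 66 by omega, ↓reduceIte]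
    have e12 : s1.var 12 = code p := by rw [← hs1]; simp
    have e13 : s1.var 13 = s.var 13 + 1 := by rw [← hs1]; simp
    clear hs1
    have e5 := vv 5 (by decide) (by decide) (by decide)
    have e10 : s1.var 10 = s.var 5 := by rw [vv 10 (by decide) (by decide) (by decide), h.var10]
    have e11 : s1.var 11 = s.var 5 := by rw [vv 11 (by decide) (by decide) (by decide), h.var11]
    have htab : CopiesTab G d v w (s.var 5) s1 := h.tab.congr (by rw [a]) (by rw [a]) (by rw [a])
    have hmid : Labelled G d v w (s.setVar 12 (code p)) := by
      refine ⟨h.var10, h.var11, h.var14, h.var15, h.tab.congr rfl rfl rfl, h.valid, h.pre, h.lab⟩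
    refine Wp.mono (Wp.frame (wp_bfs (U := fun x => ∃ p, IsValid G d v w p ∧ code p = x)
      (W := n + n) ?_ ?_ ?_ ?_ ?_ ?_)) ?_
    · rintro u ⟨p, -, rfl⟩
      exact code_lt p
    · rw [e10]
      rintro u x ⟨p, hp, rfl⟩ hx
      obtain ⟨q, hq, rfl, -⟩ := htab.nb_valid hp hx
      exact ⟨q, hq, rfl⟩
    · rw [e10]
      rintro u ⟨p, hp, rfl⟩
      exact htab.row p hp
    · exact ⟨p, hp, e12.symm⟩
    · rw [e11, e12, a]; exact h0
    · rw [e13]; omega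
    rintro s' t ⟨⟨hb, ht⟩, hF⟩
    rw [e10, e11, pot_congr (s' := s1) (s := s) (by rw [a]) (by rw [a]) (by rw [a])] at ht
    have hkeep : ∀ x, s.arr 6 (s.var 5 + x) ≠ 0 → s'.arr 6 (s.var 5 + x) ≠ 0 := by
      intro x hx
      have := hb.keep (x := x) (by rwa [e11, a])
      rw [e11, a] at this
      rwa [this]
    have hlab : Labelled G d v w s' := by
      refine hmid.bfs (s₁ := s1) a (fun y hy hy' => ?_) (by simpa using e13) (by simpa using hL) hp
        (by simp) (by simpa using h0) hb hF
      by_cases h12 : y = 12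
      · subst h12
        simp [e12]
      · rw [vv y hy h12 hy']
        simp [h12]
    refine ⟨hlab, ?_, hkeep, ?_, ?_, ?_⟩
    · have := hb.ext hF
      rw [e11] at this
      exact (Ext.of_eq a (vv 4 (by decide) (by decide) (by decide))
        (vv 6 (by decide) (by decide) (by decide))).trans this
    · have := hb.src.2
      rw [e11, e12, e13] at this
      rw [this]
      omega
    · rw [hF.var 13 rfl, e13]
    · generalize pot s' _ _ _ = x1 at *
      generalize pot s _ _ _ = x2 at *
      clear * - ht
      omega

/-- Label the components of the copies in one of the balls. -/
def labelLoop : Prog := forUp 30 31 45 labelStep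

/-- The searches share one row, so their times telescope to the total potential. A ball has at most
`n` vertices and hence causes at most `n` new labels. -/
theorem wp_labelLoop {s : Store} {v w : Fin n} (h : Labelled G d v w s) (i : Bool)
    (hB : BallTab G d s (cond i w v)) (h30 : s.var 30 = s.arr 10 (cond i w v : Fin n)) (h31 : s.var 31 = s.arr 11 (cond i w v : Fin n))
    (h33 : s.var 33 = cond i n 0) (hL : s.var 13 ≤ n + 1) :
    Wp labelLoop s fun s' t => Labelled G d v w s' ∧ Ext (s.var 5) s s' ∧
      (∀ x, s.arr 6 (s.var 5 + x) ≠ 0 → s'.arr 6 (s.var 5 + x) ≠ 0) ∧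
      (∀ u, IsValid G d v w (i, u) → s'.arr 6 (s.var 5 + code (i, u)) ≠ 0) ∧
      s'.var 13 ≤ s.var 13 + n ∧
      t + 20 * pot s (s.var 5) (s.var 5) (n + n) ≤
        20 * pot s' (s.var 5) (s.var 5) (n + n) + 44 * maxBallSize G d + 2 := by
  have hc := sum_list hB.inj hB.mem fun _ => 1
  simp only [Finset.sum_const, smul_eq_mul, mul_one, Nat.card_Ico] at hc
  have hcn : (ballFin G d (cond i w v)).card ≤ n := (Finset.card_le_univ _).trans (by simp)
  have hcR := card_ballFin_le (G := G) (d := d) (cond i w v)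
  refine wp_forUp (fun k s' t => Labelled G d v w s' ∧ Ext (s.var 5) s s' ∧
      (∀ x, s.arr 6 (s.var 5 + x) ≠ 0 → s'.arr 6 (s.var 5 + x) ≠ 0) ∧
      (∀ j ∈ Set.Ico (s.var 30) k, s'.arr 6 (s.var 5 + (s.arr 8 j + s.var 33)) ≠ 0) ∧
      s'.var 13 ≤ s.var 13 + (k - s.var 30) ∧
      t + 20 * pot s (s.var 5) (s.var 5) (n + n) ≤
        20 * pot s' (s.var 5) (s.var 5) (n + n) + 44 * (k - s.var 30)) (by decide) (by decide)
    (by decide) (by decide) (by decide) rfl rfl ?_ ?_ ?_ ?_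
  · rw [h30, h31]; exact hB.lo_le
  · have hlt : ∀ y < 26, (s.setVar 45 (s.var 31 - s.var 30)).var y = s.var y := fun y hy =>
      Store.setVar_var_of_lt hy (by decide)
    refine ⟨h.congr rfl hlt, Ext.of_eq rfl (hlt 4 (by decide)) (hlt 6 (by decide)), fun x hx => hx,
      fun j hj => absurd hj.1 (not_le.2 hj.2), ?_, ?_⟩
    · rw [hlt 13 (by decide)]
      exact Nat.le_add_right _ _
    · rw [pot_congr (s' := s.setVar 45 (s.var 31 - s.var 30)) (s := s) rfl rfl rfl]
      omega
  · rintro k s1 t1 hk1 hk2 hk hF ⟨hl, hE, hkeep, hdone, h13, ht⟩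
    have f5 : s1.var 5 = s.var 5 := hF.var 5 rfl
    have f33 : s1.var 33 = s.var 33 := hF.var 33 rfl
    obtain ⟨u, hu, e⟩ := (hB.mem (s.arr 8 k)).1 ⟨k, by rw [← h30, ← h31]; exact ⟨hk1, hk2⟩, rfl⟩
    have e8 : s1.arr 8 k = s.arr 8 k := hE.queue k (hk2.trans_le (by rw [h31]; exact hB.hi_le))
    have ec : s.arr 8 k + s.var 33 = code (i, u) := by
      rw [e, h33, code, Nat.add_comm]
    refine Wp.mono (wp_labelStep hl ?_ (p := (i, u)) (mem_ballFin.1 hu) ?_) ?_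
    · rw [← hc, ← h30, ← h31] at hcn
      clear * - h13 hL hcn hk1 hk2
      omega
    · rw [hk, e8, f33, ec]
    rintro s2 t2 ⟨hl2, hE2, hkeep2, hnew, h13', ht2⟩
    rw [f5] at hE2 hkeep2 hnew ht2
    have hlt : ∀ y < 26, (s2.next 30 31 45).var y = s2.var y := fun y hy =>
      Store.next_var_of_lt hy (by decide) (by decide)
    refine ⟨hl2.congr rfl hlt, (hE.trans hE2).trans
      (Ext.of_eq rfl (hlt 4 (by decide)) (hlt 6 (by decide))), fun x hx => hkeep2 x (hkeep x hx),
      fun j hj => ?_, ?_, ?_⟩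
    · rcases Nat.lt_succ_iff_lt_or_eq.1 hj.2 with hjk | rfl
      · exact hkeep2 _ (hdone j ⟨hj.1, hjk⟩)
      · rw [ec]; exact hnew
    · rw [hlt 13 (by decide)]
      clear * - h13 h13' hk1
      omega
    · rw [pot_congr (s' := s2.next 30 31 45) (s := s2) rfl rfl rfl]
      generalize pot s2 _ _ _ = x2 at *
      generalize pot s1 _ _ _ = x1 at *
      generalize pot s _ _ _ = x0 at *
      clear * - ht ht2 hk1
      omega
  · rintro s1 t1 ⟨hl, hE, hkeep, hdone, h13, ht⟩ - hF
    have hd : s.var 31 - s.var 30 = (ballFin G d (cond i w v)).card := by rw [h30, h31, hc]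
    rw [hd] at h13 ht
    refine ⟨hl, hE, hkeep, fun u hu => ?_, ?_, ?_⟩
    · obtain ⟨j, hj, e⟩ := (hB.mem u).2 ⟨u, mem_ballFin.2 hu, rfl⟩
      have := hdone j (by rw [h30, h31]; exact hj)
      rwa [e, h33, Nat.add_comm (u : ℕ)] at this
    · exact h13.trans (Nat.add_le_add_left hcn _)
    · generalize pot s1 _ _ _ = x1 at *
      generalize pot s _ _ _ = x0 at *
      clear * - ht hcR
      omega

end Label
end LocalSep

namespace LocalSep

open SimpleGraph Relation

section Separators

variable {n : ℕ} {G : SimpleGraph (Fin n)} {d : ℕ}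

theorem Labelling.init {V : Type*} {G : SimpleGraph V} {v w : V} {lab : Bool × V → ℕ}
    (h : ∀ p, IsCopy G d v w p → lab p = 0) : Labelling G d v w lab 1 where
  one_le := le_rfl
  range p hp hne := absurd (h p hp) hne
  eq_iff p _ hp _ hne := absurd (h p hp) hne
  used k hk hk' := by omega

/-- In each ball, the degrees plus one sum to at most 2R; one more per vertex for the possible link
adds at most R. Two balls give 6R. -/
theorem CopiesTab.pot_le {v w : Fin n} {h : ℕ} {s : Store} (hc : CopiesTab G d v w h s)
    (hv : ∀ x, s.arr 6 (h + x) ≠ 0 → ∃ p, IsValid G d v w p ∧ code p = x) :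
    pot s h h (n + n) ≤ 6 * maxBallSize G d := by
  classical
  refine (LocalSep.pot_le ((Finset.univ.filter (IsValid G d v w)).image code) fun x _ hx => ?_).trans
    ?_
  · obtain ⟨p, hp, rfl⟩ := hv x hx
    exact Finset.mem_image_of_mem _ (by simpa using hp)
  rw [Finset.sum_image fun a _ b _ e => code_injective e]
  have key : ∀ c : Fin n, ∑ u ∈ ballFin G d c, (ballDegree G d c u + 1 + 1) ≤ 3 * maxBallSize G d := by
    intro c
    have h1 := sum_ballDegree_le (G := G) (d := d) c
    have h2 := card_ballFin_le (G := G) (d := d) c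
    rw [Finset.sum_add_distrib, Finset.sum_const, smul_eq_mul, mul_one]
    omega
  have hfil : ∀ i, Finset.univ.filter (fun u : Fin n => IsValid G d v w (i, u)) =
      ballFin G d (cond i w v) := by
    intro i
    ext u
    rw [mem_ballFin, Finset.mem_filter]
    exact and_iff_right (Finset.mem_univ _)
  calc ∑ p ∈ Finset.univ.filter (IsValid G d v w), (rowLen s h (code p) + 1)
      ≤ ∑ p ∈ Finset.univ.filter (IsValid G d v w),
          (ballDegree G d (cond p.1 w v) p.2 + 1 + 1) :=
        Finset.sum_le_sum fun p hp => Nat.add_le_add_right (hc.len p (by simpa using hp)) 1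
    _ = ∑ u ∈ ballFin G d w, (ballDegree G d w u + 1 + 1) +
          ∑ u ∈ ballFin G d v, (ballDegree G d v u + 1 + 1) := by
        rw [Finset.sum_filter, Fintype.sum_prod_type, Fintype.sum_bool, ← Finset.sum_filter,
          ← Finset.sum_filter, hfil, hfil]
        rfl
    _ ≤ 6 * maxBallSize G d := by
        have := key v
        have := key w
        omega

/-- Mark the copies of the vertices 50 and 51 in the rows from register 5 on, and set the parameters
for the labelling of the components. -/
def premark : Prog :=
  .seq (.const 65 1) <| .seq (.add 66 5 50) <| .seq (.store 6 66 65) <| .seq (.add 66 66 0) <|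
    .seq (.store 6 66 65) <| .seq (.add 66 5 51) <| .seq (.store 6 66 65) <|
    .seq (.add 66 66 0) <| .seq (.store 6 66 65) <| .seq (.copy 10 5) <| .seq (.copy 11 5) <|
    .seq (.const 14 0) <| .seq (.const 15 8) <| .seq (.add 66 3 3) <| .seq (.add 66 66 66) <|
    .seq (.add 15 15 66) (.const 13 1)

/-- Marking both copies of `v` and of `w` with 1 deletes them for the searches; components are
labelled from 2 on. -/
theorem wp_premark {s : Store} (hT : Tables G d s) {v w : Fin n} (hm : mark G d v w ≠ 0)
    (h50 : s.var 50 = v) (h51 : s.var 51 = w) (hc : CopiesTab G d v w (s.var 5) s) :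
    Wp premark s fun s' t => Labelled G d v w s' ∧ s'.var 13 = 1 ∧ Ext (s.var 5) s s' ∧
      (∀ i, s.var 5 + (n + n) ≤ i → s'.arr 6 i = 0) ∧ t ≤ 17 := by
  simp only [premark, wp_seq, wp_copy, wp_const, wp_store, wp_add, setVar_var, Nat.reduceEqDiff,
    ↓reduceIte, setVar_arr, setArr_arr, setArr_var, h50, h51, hT.var0, hT.var3]
  generalize hs1 : Store.setVar _ 13 _ = s'
  have a : ∀ b ≠ 6, s'.arr b = s.arr b := fun b hb => by
    rw [← hs1]
    simp [hb]
  have hA : s'.arr 6 = Function.update (Function.update (Function.update (Function.update (s.arr 6)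
      (s.var 5 + v) 1) (s.var 5 + v + n) 1) (s.var 5 + w) 1) (s.var 5 + w + n) 1 := by
    rw [← hs1]; simp
  obtain ⟨v4, v5, v6, v10, v11, v13, v14, v15⟩ : s'.var 4 = s.var 4 ∧ s'.var 5 = s.var 5 ∧
      s'.var 6 = s.var 6 ∧ s'.var 10 = s.var 5 ∧ s'.var 11 = s.var 5 ∧ s'.var 13 = 1 ∧
      s'.var 14 = 0 ∧ s'.var 15 = 8 + (n + n + (n + n) + (n + n + (n + n))) := by
    rw [← hs1]
    simp
  clear hs1
  have hz := hT.zero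
  have hA' : ∀ x, s'.arr 6 (s.var 5 + x) =
      if x = w + n ∨ x = w ∨ x = v + n ∨ x = v then 1 else 0 := by
    intro x
    have := hz (s.var 5 + x) (Nat.le_add_right _ _)
    rw [hA]
    simp only [Function.update_apply]
    clear * - this
    split_ifs <;> omega
  have hcode : ∀ p : Bool × Fin n, (code p = w + n ∨ code p = w ∨ code p = v + n ∨ code p = v) ↔
      p.2 = v ∨ p.2 = w := by
    rintro ⟨_ | _, u⟩ <;> simp only [code, cond_true, cond_false, Fin.ext_iff] <;> omega
  have hw1 : mark G d w v ≠ 0 := by rwa [mark_comm]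
  have hs : ∀ u : Fin n, mark G d u u ≠ 0 := fun u => by rw [mark_self]; exact one_ne_zero
  refine ⟨⟨?_, ?_, ?_, ?_, ?_, ?_, ?_, ?_⟩, trivial, ?_, ?_, by decide⟩
  · rw [v10, v5]
  · rw [v11, v5]
  · rw [v14]
  · rw [v15]; ring
  · rw [v5]
    exact hc.congr (a 1 (by decide)) (a 4 (by decide)) (a 5 (by decide))
  · intro x hx
    rw [v5, hA'] at hx
    by_cases h1 : x = w + n ∨ x = w ∨ x = v + n ∨ x = v
    · rcases h1 with rfl | rfl | rfl | rfl
      · exact ⟨(true, w), hs w, Nat.add_comm _ _⟩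
      · exact ⟨(false, w), hm, Nat.zero_add _⟩
      · exact ⟨(true, v), hw1, Nat.add_comm _ _⟩
      · exact ⟨(false, v), hs v, Nat.zero_add _⟩
    · rw [if_neg h1] at hx
      exact absurd rfl hx
  · intro p hp
    rw [v5, hA', if_pos ((hcode p).2 hp)]
    exact one_ne_zero
  · rw [v13]
    refine Labelling.init fun p hp => ?_
    simp only [v5]
    rw [hA', if_neg]
    rw [hcode]
    exact not_or.2 hp.2
  · constructor <;> intros <;> try simp only [v4, v6, a 1 (by decide), a 4 (by decide),
        a 5 (by decide), a 8 (by decide), le_refl]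
    rename_i i hi
    rw [hA]
    simp only [Function.update_apply]
    clear * - hi
    split_ifs <;> omega
  · intro i hi
    have := hz i (by omega)
    simp only [Function.update_apply]
    clear * - this hi
    split_ifs <;> omega

/-- Compute the components of the punctured explorer neighbourhood of the vertices 50 and 51. -/
def components : Prog :=
  .seq copiesGraph <| .seq premark <| .seq (.copy 30 62) <| .seq (.copy 31 63) <|
    .seq (.const 33 0) <| .seq labelLoop <| .seq (.copy 30 60) <| .seq (.copy 31 61) <|
    .seq (.copy 33 0) <| .seq labelLoop <| .seq (.const 66 2) <| .seq (.sub 66 13 66) <|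
    .seq (.store 13 64 66) (.add 5 5 3)

-- The cost is linear in R: the graph of copies has size O(R), and the searches together pay for its
-- potential only once.
set_option maxHeartbeats 400000 in
theorem wp_components {s : Store} (hT : Tables G d s) {v w : Fin n} (hvw : v ≠ w)
    (hm : mark G d v w ≠ 0) (h50 : s.var 50 = v) (h51 : s.var 51 = w)
    (h54 : s.var 54 = ballRow n v) :
    Wp components s fun s' t => Ext (s.var 5) s s' ∧ s'.var 5 = s.var 5 + (n + n) ∧
      (∀ i, s.var 5 + (n + n) ≤ i → s'.arr 6 i = 0) ∧
      s'.arr 12 = Function.update (s.arr 12) (ballRow n v + w) (s.var 5) ∧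
      (∃ k, s'.arr 13 = Function.update (s.arr 13) (ballRow n v + w) k ∧
        (k ≠ 0 ↔ IsLocalSeparator G d v w)) ∧
      (∃ L, Labelling G d v w (fun p => s'.arr 6 (s.var 5 + code p)) L) ∧
      (∀ p, IsCopy G d v w p → s'.arr 6 (s.var 5 + code p) ≠ 0) ∧
      t ≤ 500 * maxBallSize G d := by
  have hfree := hT.free
  have hR := one_le_maxBallSize (G := G) (d := d) v
  simp only [components, wp_seq]
  refine Wp.mono (Wp.frame (wp_copiesGraph hT hm h50 h51 h54)) ?_
  rintro s1 t1 ⟨⟨hc, hE1, a12, v60, v61, v62, v63, v64, ht1⟩, hF1⟩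
  have v5 : s1.var 5 = s.var 5 := hF1.var 5 rfl
  have hT1 : Tables G d s1 := hT.step (hE1.mono hfree) (hF1.var 0 rfl) (hF1.var 1 rfl)
    (hF1.var 3 rfl) (hF1.arr 9 rfl) (hF1.arr 10 rfl) (hF1.arr 11 rfl) v5.ge
    (by rw [v5, hF1.arr 6 rfl]; exact hT.zero)
  rw [← v5] at hc
  refine Wp.mono (Wp.frame (wp_premark hT1 hm ((hF1.var 50 rfl).trans h50)
    ((hF1.var 51 rfl).trans h51) hc)) ?_
  rintro s2 t2 ⟨⟨hl2, w13, hE2, hz2, ht2⟩, hF2⟩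
  rw [v5] at hE2 hz2
  have w5 := (hF2.var 5 rfl).trans v5
  have w60 := (hF2.var 60 rfl).trans v60
  have w61 := (hF2.var 61 rfl).trans v61
  have w62 := (hF2.var 62 rfl).trans v62
  have w63 := (hF2.var 63 rfl).trans v63
  have w0 : s2.var 0 = n := (hF2.var 0 rfl).trans hT1.var0
  have e10 : s2.arr 10 = s.arr 10 := (hF2.arr 10 rfl).trans (hF1.arr 10 rfl)
  have e11 : s2.arr 11 = s.arr 11 := (hF2.arr 11 rfl).trans (hF1.arr 11 rfl)
  have hE12 := hE1.trans hE2
  have hBx : ∀ {s' : Store}, Ext (s.var 5) s s' → s'.arr 9 = s.arr 9 → s'.arr 10 = s.arr 10 →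
      s'.arr 11 = s.arr 11 → ∀ c, BallTab G d s' c := by
    intro s' hE h9 h10 h11 c
    have := ballRow_le c
    exact (hT.ball c).ext hE (by omega) (by rw [h9]) (by rw [h10]) (by rw [h11])
  have hB2 := hBx hE12 ((hF2.arr 9 rfl).trans (hF1.arr 9 rfl)) e10 e11
  simp only [wp_copy, wp_const, setVar_var, Nat.reduceEqDiff, ↓reduceIte, w62, w63]
  generalize hs3 : Store.setVar _ 33 _ = s3
  have b3 : s3.arr = s2.arr := by rw [← hs3]; rfl
  have vv3 : ∀ y < 26, s3.var y = s2.var y := fun y hy => by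
    rw [← hs3]
    simp only [Store.setVar_var_of_lt hy, Nat.reduceLeDiff]
  obtain ⟨x30, x31, x33, x60, x61, x64⟩ : s3.var 30 = s.arr 10 v ∧ s3.var 31 = s.arr 11 v ∧
      s3.var 33 = 0 ∧ s3.var 60 = s.arr 10 w ∧ s3.var 61 = s.arr 11 w ∧
      s3.var 64 = ballRow n v + w := by
    rw [← hs3]
    simp [w60, w61, (hF2.var 64 rfl).trans v64]
  clear hs3
  have x5 := (vv3 5 (by decide)).trans w5
  have x13 := (vv3 13 (by decide)).trans w13
  have hE3 : Ext (s.var 5) s s3 :=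
    hE12.trans (Ext.of_eq b3 (vv3 4 (by decide)) (vv3 6 (by decide)))
  refine Wp.mono (Wp.frame (wp_labelLoop (hl2.congr b3 vv3) false
    (hBx hE3 (by rw [b3]; exact (hF2.arr 9 rfl).trans (hF1.arr 9 rfl)) (by rw [b3, e10])
      (by rw [b3, e11]) v) (by rw [x30, b3, e10]; rfl) (by rw [x31, b3, e11]; rfl) x33
    (by rw [x13]; omega))) ?_
  rintro s4 t4 ⟨⟨hl4, hE4, hk4, hd4, y13, ht4⟩, hF4⟩
  rw [x5] at hE4 hk4 hd4 ht4
  have hE4' := hE3.trans hE4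
  have y0 : s4.var 0 = n := (hF4.var 0 rfl).trans ((vv3 0 (by decide)).trans w0)
  have y60 := (hF4.var 60 rfl).trans x60
  have y61 := (hF4.var 61 rfl).trans x61
  have e9' : s4.arr 9 = s.arr 9 :=
    (hF4.arr 9 rfl).trans ((congrFun b3 9).trans ((hF2.arr 9 rfl).trans (hF1.arr 9 rfl)))
  have e10' : s4.arr 10 = s.arr 10 := (hF4.arr 10 rfl).trans ((congrFun b3 10).trans e10)
  have e11' : s4.arr 11 = s.arr 11 := (hF4.arr 11 rfl).trans ((congrFun b3 11).trans e11)
  simp only [y60, y61, y0]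
  generalize hs5 : Store.setVar _ 33 _ = s5
  have b5 : s5.arr = s4.arr := by rw [← hs5]; rfl
  have vv5 : ∀ y < 26, s5.var y = s4.var y := fun y hy => by
    rw [← hs5]
    simp only [Store.setVar_var_of_lt hy, Nat.reduceLeDiff]
  obtain ⟨z30, z31, z33, z64⟩ : s5.var 30 = s.arr 10 w ∧ s5.var 31 = s.arr 11 w ∧
      s5.var 33 = n ∧ s5.var 64 = ballRow n v + w := by
    rw [← hs5]
    simp [(hF4.var 64 rfl).trans x64]
  clear hs5
  have z5 : s5.var 5 = s.var 5 := (vv5 5 (by decide)).trans ((hF4.var 5 rfl).trans x5)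
  have z13 := vv5 13 (by decide)
  have hE5 : Ext (s.var 5) s s5 :=
    hE4'.trans (Ext.of_eq b5 (vv5 4 (by decide)) (vv5 6 (by decide)))
  refine Wp.mono (Wp.frame (wp_labelLoop (hl4.congr b5 vv5) true
    (hBx hE5 (by rw [b5, e9']) (by rw [b5, e10']) (by rw [b5, e11']) w)
    (by rw [z30, b5, e10']; rfl) (by rw [z31, b5, e11']; rfl) z33
    (by rw [z13]; rw [x13] at y13; omega))) ?_
  rintro s6 t6 ⟨⟨hl6, hE6, hk6, hd6, -, ht6⟩, hF6⟩
  rw [z5] at hE6 hk6 hd6 ht6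
  have f5 : s6.var 5 = s.var 5 := (hF6.var 5 rfl).trans z5
  have f3 : s6.var 3 = n + n := (hF6.var 3 rfl).trans ((vv5 3 (by decide)).trans
    ((hF4.var 3 rfl).trans ((vv3 3 (by decide)).trans ((hF2.var 3 rfl).trans hT1.var3))))
  have f64 := (hF6.var 64 rfl).trans z64
  have f12 : s6.arr 12 = Function.update (s.arr 12) (ballRow n v + w) (s.var 5) :=
    (hF6.arr 12 rfl).trans ((congrFun b5 12).trans ((hF4.arr 12 rfl).trans
      ((congrFun b3 12).trans ((hF2.arr 12 rfl).trans a12))))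
  have f13 : s6.arr 13 = s.arr 13 :=
    (hF6.arr 13 rfl).trans ((congrFun b5 13).trans ((hF4.arr 13 rfl).trans
      ((congrFun b3 13).trans ((hF2.arr 13 rfl).trans (hF1.arr 13 rfl)))))
  have hE := hE5.trans hE6
  have hpot := hl6.tab.pot_le hl6.valid
  have hlab := hl6.lab
  have hval := hl6.valid
  rw [f5] at hpot hlab hval
  -- The first loop labels the left copies, the second labels the right ones and keeps what is
  -- labelled.
  have hall : ∀ p, IsCopy G d v w p → s6.arr 6 (s.var 5 + code p) ≠ 0 := by
    rintro ⟨_ | _, u⟩ hp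
    · refine hk6 _ ?_
      rw [b5]
      exact hd4 u (mark_ne_zero.2 hp.1)
    · exact hd6 u (mark_ne_zero.2 hp.1)
  have hz : ∀ i, s.var 5 + (n + n) ≤ i → s6.arr 6 i = 0 := by
    intro i hi
    by_contra hne
    obtain ⟨p, -, hp⟩ := hval (i - s.var 5) (by rwa [Nat.add_sub_of_le (by omega)])
    have := code_lt p
    omega
  rw [pot_congr (s' := s5) (s := s4) (by rw [b5]) (by rw [b5]) (by rw [b5])] at ht6
  have htime : t1 + t2 + t4 + t6 ≤ 400 * maxBallSize G d + 60 := by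
    generalize pot s6 _ _ _ = q6 at *
    generalize pot s4 _ _ _ = q4 at *
    generalize pot s3 _ _ _ = q3 at *
    clear * - ht1 ht2 ht4 ht6 hpot
    omega
  clear ht1 ht2 ht4 ht6
  simp only [wp_sub, wp_store, wp_add, setVar_var, Nat.reduceEqDiff, ↓reduceIte, setVar_arr,
    setArr_arr, setArr_var, f5, f3, f64, f12, f13]
  refine ⟨?_, trivial, hz, trivial, ⟨_, rfl, (hlab.isLocalSeparator_iff hvw hm hall).symm⟩,
    ⟨_, hlab⟩, hall, ?_⟩
  · refine hE.trans ?_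
    constructor <;> intros <;> simp
  · clear * - htime hR
    ring_nf at htime ⊢
    omega

/-- Compute the components unless the vertices 50 and 51 are equal. -/
def sepStep : Prog :=
  .seq (.sub 57 50 51) <| .seq (.sub 58 51 50) <| .seq (.add 57 57 58) <|
    .cond 57 components .skip

/-- The labels of the components of the punctured explorer neighbourhood of `v` and `w` are in the
storage. -/
structure LabelEntry (G : SimpleGraph (Fin n)) (d : ℕ) (s : Store) (v w : Fin n) : Prop where
  le : ballRow n n ≤ s.arr 12 (ballRow n v + w)
  le_free : s.arr 12 (ballRow n v + w) + (n + n) ≤ s.var 5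
  lab : ∃ L, Labelling G d v w (fun p => s.arr 6 (s.arr 12 (ballRow n v + w) + code p)) L
  ne_zero : ∀ p, IsCopy G d v w p → s.arr 6 (s.arr 12 (ballRow n v + w) + code p) ≠ 0

theorem LabelEntry.ext {s s' : Store} {v w : Fin n} (h : LabelEntry G d s v w)
    (hE : Ext (s.var 5) s s') (h12 : s'.arr 12 (ballRow n v + w) = s.arr 12 (ballRow n v + w))
    (h5 : s.var 5 ≤ s'.var 5) : LabelEntry G d s' v w := by
  have h1 := h.le_free
  have e : ∀ p : Bool × Fin n, s'.arr 6 (s.arr 12 (ballRow n v + w) + code p) =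
      s.arr 6 (s.arr 12 (ballRow n v + w) + code p) := fun p => hE.val _ (by
    have := code_lt p
    omega)
  refine ⟨?_, ?_, ?_, ?_⟩
  · rw [h12]; exact h.le
  · rw [h12]; omega
  · rw [h12]; simp only [e]; exact h.lab
  · rw [h12]; simp only [e]; exact h.ne_zero

/-- Makes `ballRow n v + w` usable as an index for tables of pairs. -/
theorem ballRow_add_inj {v w v' w' : Fin n} (h : ballRow n v + w = ballRow n v' + w') :
    v = v' ∧ w = w' := by
  rcases lt_trichotomy (v : ℕ) v' with hlt | he | hlt
  · have := ballRow_lt (n := n) hlt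
    omega
  · rw [he] at h
    exact ⟨Fin.ext he, Fin.ext (by omega)⟩
  · have := ballRow_lt (n := n) hlt
    omega

/-- The separators and the labels of components have been determined for the pairs in `l`. -/
structure SepTab (G : SimpleGraph (Fin n)) (d : ℕ) (l : List (Fin n × Fin n)) (s : Store) : Prop where
  sep : ∀ v w : Fin n, s.arr 13 (ballRow n v + w) ≠ 0 ↔ (v, w) ∈ l ∧ IsLocalSeparator G d v w
  entry : ∀ v w, (v, w) ∈ l → v ≠ w → LabelEntry G d s v w

/-- Compute the components for all pairs of vertices at small distance. -/
def sepPhase : Prog := forPairs sepStep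

/-- Entries of array 13 that are never written remain 0, so pairs at large distance count as
non-separators without being visited. -/
theorem wp_sepPhase {s : Store} (hT : Tables G d s) (h13 : ∀ i, s.arr 13 i = 0) :
    Wp sepPhase s fun s' t => Tables G d s' ∧
      (∃ l, (∀ v w, (v, w) ∈ l ↔ mark G d v w ≠ 0) ∧ SepTab G d l s') ∧
      t ≤ n * (maxBallSize G d * (505 * maxBallSize G d + 14)) + 3 := by
  refine wp_forPairs (by decide) (by decide) ?_ hT ⟨by simp [h13], by simp⟩ ?_
  · intro l s s' ha hv h
    refine ⟨by rw [ha]; exact h.sep, fun v w hvw hne => (h.entry v w hvw hne).ext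
      (Ext.of_eq ha (hv 4 (by decide)) (hv 6 (by decide))) (by rw [ha]) (hv 5 (by decide)).ge⟩
  · intro l s v w hT hI hm hnot h50 h51 h54
    have hR := one_le_maxBallSize (G := G) (d := d) v
    simp only [sepStep, wp_seq, wp_sub, wp_add, wp_cond, wp_skip, setVar_var, Nat.reduceEqDiff,
      ↓reduceIte, h50, h51]
    generalize hs1 : Store.setVar _ 57 _ = s1
    have b1 : s1.arr = s.arr := by rw [← hs1]; rfl
    have vv1 : ∀ y < 57, s1.var y = s.var y := fun y hy => by
      rw [← hs1]
      simp only [setVar_var, hy.ne, (hy.trans (by decide : 57 < 58)).ne, ↓reduceIte]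
    clear hs1
    have hE1 : ∀ b, Ext b s s1 := fun b =>
      Ext.of_eq b1 (vv1 4 (by decide)) (vv1 6 (by decide))
    have hT1 : Tables G d s1 := hT.congr b1 fun y hy => vv1 y (hy.trans (by decide))
    have v5 := vv1 5 (by decide)
    have hfree := hT.free
    constructor
    · intro hne
      have hvw : v ≠ w := by
        rintro rfl
        omega
      refine Wp.mono (Wp.frame (wp_components hT1 hvw hm ((vv1 50 (by decide)).trans h50)
        ((vv1 51 (by decide)).trans h51) ((vv1 54 (by decide)).trans h54))) ?_
      rintro s2 t2 ⟨⟨hE, h5, hz, h12, ⟨k, h13, hk⟩, hL, hall, ht⟩, hF⟩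
      rw [v5] at hE h5 hz h12 hL hall
      rw [b1] at h12 h13
      refine ⟨((hE1 _).trans hE).mono hfree, by omega, by rwa [h5], ⟨fun a b => ?_, fun a b hab hne' => ?_⟩, ?_⟩
      · rw [h13, List.mem_cons, Prod.mk.injEq]
        by_cases hab : a = v ∧ b = w
        · obtain ⟨rfl, rfl⟩ := hab
          rw [Function.update_self, hk]
          simp
        · rw [Function.update_of_ne fun e => hab (ballRow_add_inj e), hI.sep]
          simp [hab]
      · rw [List.mem_cons, Prod.mk.injEq] at hab
        by_cases hab' : a = v ∧ b = w
        · obtain ⟨rfl, rfl⟩ := hab'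
          refine ⟨?_, ?_, ?_, ?_⟩ <;> rw [h12, Function.update_self]
          · exact hfree
          · exact h5.ge
          · exact hL
          · exact hall
        · refine (hI.entry a b (hab.resolve_left hab') hne').ext ((hE1 _).trans hE) ?_ (by omega)
          rw [h12, Function.update_of_ne fun e => hab' (ballRow_add_inj e)]
      · clear * - ht hR
        omega
    · intro he
      have hvw : v = w := Fin.ext (by omega)
      refine ⟨hE1 _, le_rfl, ?_, ⟨fun a b => ?_, fun a b hab hne => ?_⟩, ?_⟩
      · rw [b1]; exact hT.zero
      · rw [b1, hI.sep, List.mem_cons, Prod.mk.injEq]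
        constructor
        · exact fun h => ⟨Or.inr h.1, h.2⟩
        · rintro ⟨⟨rfl, rfl⟩ | h, h'⟩
          · exact absurd hvw h'.1
          · exact ⟨h, h'⟩
      · rw [List.mem_cons, Prod.mk.injEq] at hab
        have hab' : (a, b) ∈ l := hab.resolve_left fun h => hne (h.1.trans (hvw.trans h.2.symm))
        exact (hI.entry a b hab' hne).ext (hE1 _) (by rw [b1]) v5.ge
      · clear * - hR
        omega

end Separators
end LocalSep

namespace LocalSep

open SimpleGraph Relation

/-! ### Search trees and the crossing test -/

section Tree

variable {n : ℕ} {G : SimpleGraph (Fin n)} {d : ℕ}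

/-- The predecessors stored in a row `f`. -/
def parent (f : ℕ → ℕ) (u : Fin n) : Fin n := if h : f u < n then ⟨f u, h⟩ else u

theorem parent_eq {f : ℕ → ℕ} {u x : Fin n} (h : f u = x) : parent f u = x := by
  rw [parent, dif_pos (h ▸ x.2)]
  exact Fin.ext h

/-- Marks grow by one per predecessor and the queue has at most `n` entries, so the search below
never reaches its limit. -/
theorem BfsPost.val_le {s s' : Store} {U : ℕ → Prop} {W : ℕ} (h : BfsPost s U W s')
    (hU : ∀ u, U u → u < n) (h13 : s.var 13 = 1) (h14 : s.var 14 = 1) {j : ℕ}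
    (hj : j ∈ Set.Ico (s.var 6) (s'.var 6)) : s'.arr 6 (s.var 11 + s'.arr 8 j) ≤ n := by
  have hcard : s'.var 6 - s.var 6 ≤ n := by
    have h1 := Finset.card_le_card_of_injOn (s := Finset.Ico (s.var 6) (s'.var 6))
      (t := Finset.range n) (s'.arr 8)
      (fun j hj => by
        simp only [Finset.coe_Ico] at hj
        simpa using hU _ (h.mem j hj).1) (by rw [Finset.coe_Ico]; exact h.inj)
    simpa using h1
  have key : ∀ j, s.var 6 ≤ j → j < s'.var 6 →
      s'.arr 6 (s.var 11 + s'.arr 8 j) ≤ j - s.var 6 + 1 := by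
    intro j
    induction j using Nat.strong_induction_on with
    | _ j ih =>
      intro h1 h2
      rcases h1.eq_or_lt with rfl | h1
      · rw [h.src.1, h.src.2, h13]
        exact Nat.le_add_left _ _
      · obtain ⟨i, hi, hij, -, -, hv, -⟩ := h.par j ⟨h1, h2⟩
        have := ih i hij hi.1 hi.2
        rw [hv, h14]
        have := hi.1
        omega
  have := key j hj.1 hj.2
  have h1 := hj.1
  have h2 := hj.2
  omega

/-- The mark set on `w` beforehand keeps it out of the queue, and the limit `8 * n + 8` exceeds all
that is needed. The conditions on a tree never consult the mark of `w` itself. -/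
theorem BfsPost.isTree {s s' : Store} {v w : Fin n}
    (h : BfsPost s (fun x => ∃ u ∈ ballFin G d v, (u : ℕ) = x) n s') (h12 : s.var 12 = v)
    (h13 : s.var 13 = 1) (h14 : s.var 14 = 1) (h15 : s.var 15 = 8 * n + 8)
    (h0 : ∀ u : Fin n, u ≠ w → s.arr 6 (s.var 11 + u) = 0) (hw : s.arr 6 (s.var 11 + w) ≠ 0)
    (hnb : ∀ u ∈ ballFin G d v, ∀ y, Nb s (s.var 10) u y ↔
      ∃ x : Fin n, (ball G d v).Adj u x ∧ y = x) :
    IsTree G d v w (fun u => s'.arr 6 (s.var 11 + u))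
        (parent fun x => s'.arr 7 (s.var 11 + x)) ∧
      ∀ u : Fin n, u ≠ v → u ≠ w → s'.arr 6 (s.var 11 + u) ≠ 0 →
        s'.arr 7 (s.var 11 + u) = (parent (fun x => s'.arr 7 (s.var 11 + x)) u : Fin n) := by
  have hsrc := h.src
  rw [h12, h13] at hsrc
  have hpar : ∀ x : Fin n, x ≠ v → x ≠ w → s'.arr 6 (s.var 11 + x) ≠ 0 →
      ∃ u : Fin n, s'.arr 7 (s.var 11 + x) = u ∧ u ≠ w ∧ s'.arr 6 (s.var 11 + u) ≠ 0 ∧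
        (ball G d v).Adj u x ∧ s'.arr 6 (s.var 11 + x) = s'.arr 6 (s.var 11 + u) + 1 := by
    intro x hxv hxw hx
    obtain ⟨j, hj, e⟩ := (h.marked (h0 x hxw)).2 hx
    have hj' : s.var 6 < j := by
      refine lt_of_le_of_ne hj.1 ?_
      rintro rfl
      exact hxv (Fin.ext (e.symm.trans hsrc.1))
    obtain ⟨i, hi, -, h1, h2, h3, -⟩ := h.par j ⟨hj', hj.2⟩
    obtain ⟨⟨u, hu, hui⟩, hu0, hu1⟩ := h.mem i hi
    rw [← hui] at h1 h2 h3 hu0 hu1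
    rw [e] at h1 h2 h3
    obtain ⟨x', hx', e'⟩ := (hnb u hu x).1 h2
    obtain rfl := Fin.ext e'
    refine ⟨u, h1, ?_, hu1, hx', by rw [h3, h14]⟩
    rintro rfl
    exact hw hu0
  refine ⟨⟨hsrc.2, fun x hxv hxw hx => ?_, fun u x huw hxw hu hadj => ?_⟩, fun u huv huw hu => ?_⟩
  · obtain ⟨u, h1, h2⟩ := hpar x hxv hxw hx
    rw [parent_eq h1]
    exact h2
  · obtain ⟨j, hj, e⟩ := (h.marked (h0 u huw)).2 hu
    have h1 := h.val_le (n := n) (fun u hu => by obtain ⟨u, -, rfl⟩ := hu; exact u.2) h13 h14 hj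
    have h2 := h.closed j hj
    rw [e] at h1 h2
    rw [h14, h15] at h2
    have hub : u ∈ ballFin G d v := mem_ballFin.2 (mark_ne_zero.2 hadj.fst_mem)
    obtain ⟨h3, h4⟩ := h2 (by omega) x ((hnb u hub x).2 ⟨x, hadj, rfl⟩)
    exact ⟨h3, h4 (h0 x hxw)⟩
  · obtain ⟨x, h1, -⟩ := hpar u huv huw hu
    rw [parent_eq h1]
    exact h1

/-- Improve the best neighbour by the one at position 70. -/
def bestStep : Prog :=
  .seq (.load 72 1 70) <| .seq (.add 73 5 72) <| .seq (.load 73 6 73) <|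
    .cond 73 (.seq (.add 74 62 72) <| .seq (.load 74 6 74) <| .seq (.sub 75 74 65) <|
      .seq (.sub 74 65 74) <| .seq (.add 75 75 74) <|
      .cond 75 (.seq (.sub 75 69 73) <|
        .cond 75 (.seq (.copy 69 73) (.copy 66 72)) .skip) .skip) .skip

/-- Find the neighbour of the vertex 51 of least value whose label is not that in register 65. -/
def findBest : Prog :=
  .seq (.add 72 54 51) <| .seq (.load 70 4 72) <| .seq (.load 71 5 72) <| .seq (.copy 66 50) <|
    .seq (.const 69 1) <| .seq (.add 69 69 1) <| forUp 70 71 76 bestStep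

theorem wp_findBest {s : Store} {v w : Fin n} (h1 : s.var 1 = d) (h50 : s.var 50 = v)
    (h51 : s.var 51 = w)
    (hle : s.arr 4 (s.var 54 + w) ≤ s.arr 5 (s.var 54 + w))
    (hnb : ∀ y, Nb s (s.var 54) w y ↔ ∃ x : Fin n, (ball G d v).Adj w x ∧ y = x) :
    Wp findBest s fun s' t => (∃ a : Fin n, s'.var 66 = a ∧
      IsBest G d v w (fun x => s.arr 6 (s.var 5 + x)) (fun x => s.arr 6 (s.var 62 + x))
        (s.var 65) (s'.var 69) a) ∧ t ≤ 20 * rowLen s (s.var 54) w + 10 := by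
  simp only [findBest, wp_seq, wp_load, wp_add, wp_copy, wp_const, setVar_var, Nat.reduceEqDiff,
    ↓reduceIte, setVar_arr, h50, h51, h1]
  refine wp_forUp (fun k s' t => (∃ a : Fin n, s'.var 66 = a ∧ s'.var 69 ≤ d + 1 ∧
      (s'.var 69 ≤ d → (ball G d v).Adj w a ∧ s.arr 6 (s.var 5 + a) = s'.var 69 ∧ s'.var 69 ≠ 0 ∧
        s.arr 6 (s.var 62 + a) ≠ s.var 65) ∧
      ∀ e, s.arr 4 (s.var 54 + w) ≤ e → e < k → s.arr 6 (s.var 5 + s.arr 1 e) ≠ 0 →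
        s.arr 6 (s.var 62 + s.arr 1 e) ≠ s.var 65 → s'.var 69 ≤ s.arr 6 (s.var 5 + s.arr 1 e)) ∧
      t ≤ 20 * (k - s.arr 4 (s.var 54 + w))) (by decide) (by decide) (by decide) (by decide)
    (by decide) rfl rfl ?_ ?_ ?_ ?_
  all_goals simp only [setVar_var, Nat.reduceEqDiff, ↓reduceIte]
  · exact hle
  -- The value `d + 1` stands for infinity: nothing is claimed about the vertex `v` stored with it.
  · refine ⟨⟨v, rfl, by omega, fun h => by omega, fun e h1 h2 => by omega⟩, Nat.zero_le _⟩
  · rintro k s' t hk1 hk2 hk hF ⟨⟨a, ha, hd, hb, hmin⟩, ht⟩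
    have f1 := hF.arr 1 rfl
    have f6 := hF.arr 6 rfl
    have f5 := hF.var 5 rfl
    have f62 := hF.var 62 rfl
    have f65 := hF.var 65 rfl
    simp only [setVar_var, Nat.reduceEqDiff, ↓reduceIte, setVar_arr] at f1 f6 f5 f62 f65
    obtain ⟨x, hx, ex⟩ := (hnb _).1 ⟨k, hk1, hk2, rfl⟩
    simp only [bestStep, wp_seq, wp_load, wp_add, wp_copy, wp_sub, wp_cond, wp_skip, setVar_var,
      Nat.reduceEqDiff, ↓reduceIte, setVar_arr, next_var, hk, f1, f6, f5, f62, f65, ex, ha]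
    have htime : ∀ c ≤ 16, t + c + 4 ≤ 20 * (k + 1 - s.arr 4 (s.var 54 + w)) := by
      clear * - ht hk1
      omega
    have hsucc : ∀ m, (s.arr 6 (s.var 5 + x) ≠ 0 → s.arr 6 (s.var 62 + x) ≠ s.var 65 →
        m ≤ s.arr 6 (s.var 5 + x)) → m ≤ s'.var 69 →
        ∀ e, s.arr 4 (s.var 54 + w) ≤ e → e < k + 1 → s.arr 6 (s.var 5 + s.arr 1 e) ≠ 0 →
        s.arr 6 (s.var 62 + s.arr 1 e) ≠ s.var 65 → m ≤ s.arr 6 (s.var 5 + s.arr 1 e) := by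
      intro m hm1 hm2 e he1 he2 he3 he4
      rcases Nat.lt_succ_iff_lt_or_eq.1 he2 with he2 | rfl
      · exact hm2.trans (hmin e he1 he2 he3 he4)
      · rw [ex] at he3 he4 ⊢
        exact hm1 he3 he4
    refine ⟨fun hv => ⟨fun hl => ⟨fun hlt => ?_, fun hge => ?_⟩, fun hl => ?_⟩, fun hv => ?_⟩
    · refine ⟨⟨x, rfl, by omega, fun _ => ⟨hx, rfl, hv, by omega⟩,
        hsucc _ (fun _ _ => le_rfl) (by omega)⟩, htime _ (by decide)⟩
    · exact ⟨⟨a, rfl, hd, hb, hsucc _ (fun _ _ => by omega) le_rfl⟩, htime _ (by decide)⟩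
    · exact ⟨⟨a, rfl, hd, hb, hsucc _ (fun _ h => absurd (by omega) h) le_rfl⟩,
        htime _ (by decide)⟩
    · exact ⟨⟨a, rfl, hd, hb, hsucc _ (fun h => absurd hv h) le_rfl⟩, htime _ (by decide)⟩
  · rintro s' t ⟨⟨a, ha, hd, hb, hmin⟩, ht⟩ - -
    refine ⟨⟨a, ha, hd, hb, fun x hx h2 h3 => ?_⟩, ?_⟩
    · obtain ⟨e, he1, he2, e'⟩ := (hnb x).2 ⟨x, hx, rfl⟩
      have := hmin e he1 he2
      rw [e'] at this
      exact this h2 h3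
    · rw [rowLen]
      clear * - ht
      omega

/-- According to the tables, `y₀` and `y₁` form a separator that separates `v` from `w`. -/
def Hit (s : Store) (v w y₀ y₁ : Fin n) : Prop :=
  s.arr 13 (ballRow n y₀ + y₁) ≠ 0 ∧
    s.arr 6 (s.arr 12 (ballRow n y₀ + y₁) + v) ≠ s.arr 6 (s.arr 12 (ballRow n y₀ + y₁) + w)

/-- Set register 59 if the vertices 76 and 77 form a separator separating the vertices 50 and 51. -/
def pairTest : Prog :=
  .seq (.load 78 9 76) <| .seq (.add 78 78 77) <| .seq (.load 79 13 78) <|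
    .cond 79 (.seq (.load 79 12 78) <| .seq (.add 80 79 50) <| .seq (.load 80 6 80) <|
      .seq (.add 81 79 51) <| .seq (.load 81 6 81) <| .seq (.sub 82 80 81) <|
      .seq (.sub 83 81 80) <| .seq (.add 82 82 83) <| .cond 82 (.const 59 1) .skip) .skip

theorem wp_pairTest {s : Store} {v w y₀ y₁ : Fin n} (h50 : s.var 50 = v) (h51 : s.var 51 = w)
    (h76 : s.var 76 = y₀) (h77 : s.var 77 = y₁) (h9 : s.arr 9 y₀ = ballRow n y₀) :
    Wp pairTest s fun s' t => (s'.var 59 ≠ 0 ↔ s.var 59 ≠ 0 ∨ Hit s v w y₀ y₁) ∧ t ≤ 20 := by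
  simp only [pairTest, wp_seq, wp_load, wp_add, wp_const, wp_sub, wp_cond, wp_skip, setVar_var,
    Nat.reduceEqDiff, ↓reduceIte, setVar_arr, h50, h51, h76, h77, h9]
  refine ⟨fun h1 => ⟨fun h2 => ⟨?_, by decide⟩, fun h2 => ⟨?_, by decide⟩⟩,
    fun h1 => ⟨?_, by decide⟩⟩
  · exact iff_of_true one_ne_zero (Or.inr ⟨h1, by omega⟩)
  · exact (or_iff_left fun h => h.2 (by omega)).symm
  · exact (or_iff_left fun h => h.1 h1).symm

/-- Test all pairs of vertices on the two tree paths. -/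
def crossLoop : Prog :=
  .seq (.const 65 1) <| .seq (.sub 71 68 65) <| .seq (.sub 73 69 65) <| .seq (.copy 76 67) <|
    .seq (.const 70 0) <| forUp 70 71 74 <| .seq (.copy 77 66) <| .seq (.const 72 0) <|
      .seq (forUp 72 73 75 (.seq pairTest (.seq (.add 78 5 77) (.load 77 7 78)))) <|
        .seq (.add 78 5 76) (.load 76 7 78)

/-- The sequences `y₀` and `y₁` are the tree paths, obtained by following predecessors; every pair
is tested in constant time. -/
theorem wp_crossLoop {s : Store} {v w : Fin n} {y₀ y₁ : ℕ → Fin n} (h50 : s.var 50 = v)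
    (h51 : s.var 51 = w) (h9 : ∀ u : Fin n, s.arr 9 u = ballRow n u) (h67 : s.var 67 = y₀ 0)
    (h66 : s.var 66 = y₁ 0) (hy₀ : ∀ i < s.var 68 - 1, s.arr 7 (s.var 5 + y₀ i) = y₀ (i + 1))
    (hy₁ : ∀ i < s.var 69 - 1, s.arr 7 (s.var 5 + y₁ i) = y₁ (i + 1)) :
    Wp crossLoop s fun s' t => (s'.var 59 ≠ 0 ↔ s.var 59 ≠ 0 ∨
      ∃ i < s.var 68 - 1, ∃ j < s.var 69 - 1, Hit s v w (y₀ i) (y₁ j)) ∧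
      t ≤ (s.var 68 - 1) * ((s.var 69 - 1) * 30 + 20) + 10 := by
  simp only [crossLoop, wp_seq, wp_copy, wp_const, wp_sub, setVar_var, Nat.reduceEqDiff, ↓reduceIte]
  refine wp_forUp (fun k s' t => s'.var 76 = y₀ k ∧ (s'.var 59 ≠ 0 ↔ s.var 59 ≠ 0 ∨
      ∃ i < k, ∃ j < s.var 69 - 1, Hit s v w (y₀ i) (y₁ j)) ∧
      t ≤ k * ((s.var 69 - 1) * 30 + 20)) (by decide) (by decide) (by decide) (by decide)
    (by decide) rfl rfl ?_ ?_ ?_ ?_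
  all_goals simp only [setVar_var, Nat.reduceEqDiff, ↓reduceIte]
  · exact Nat.zero_le _
  · exact ⟨h67, by simp, Nat.zero_le _⟩
  · rintro k s1 t1 - hk2 hk hF ⟨h76, h59, ht⟩
    have f66 := (hF.var 66 rfl)
    have f5 := (hF.var 5 rfl)
    have f50 := (hF.var 50 rfl)
    have f51 := (hF.var 51 rfl)
    have f73 := (hF.var 73 rfl)
    simp only [setVar_var, Nat.reduceEqDiff, ↓reduceIte] at f66 f5 f50 f51 f73
    have b6 : s1.arr 6 = s.arr 6 := hF.arr 6 rfl
    have b7 : s1.arr 7 = s.arr 7 := hF.arr 7 rfl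
    have b9 : s1.arr 9 = s.arr 9 := hF.arr 9 rfl
    have b12 : s1.arr 12 = s.arr 12 := hF.arr 12 rfl
    have b13 : s1.arr 13 = s.arr 13 := hF.arr 13 rfl
    simp only [wp_seq, wp_copy, wp_const]
    refine Wp.mono (Wp.frame (wp_forUp (fun j s' t => s'.var 77 = y₁ j ∧
      (s'.var 59 ≠ 0 ↔ s1.var 59 ≠ 0 ∨ ∃ i < j, Hit s v w (y₀ k) (y₁ i)) ∧
      t ≤ j * 30) (Q := fun s' t => (s'.var 59 ≠ 0 ↔ s1.var 59 ≠ 0 ∨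
        ∃ i < s.var 69 - 1, Hit s v w (y₀ k) (y₁ i)) ∧ t ≤ (s.var 69 - 1) * 30 + 2) (by decide)
      (by decide) (by decide) (by decide) (by decide) rfl rfl ?_ ?_ ?_ ?_)) ?_
    rotate_right
    all_goals try simp only [setVar_var, Nat.reduceEqDiff, ↓reduceIte]
    · rintro s2 t2 ⟨⟨h59', ht2⟩, hF2⟩
      have g76 := hF2.var 76 rfl
      have g5 := hF2.var 5 rfl
      have g7 := hF2.arr 7 rfl
      simp only [setVar_var, Nat.reduceEqDiff, ↓reduceIte, setVar_arr] at g76 g5 g7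
      simp only [wp_add, wp_load, setVar_var, next_var, setVar_arr, Nat.reduceEqDiff, ↓reduceIte,
        g76, g5, g7, f5, h76, b7]
      refine ⟨hy₀ k hk2, ?_, ?_⟩
      · rw [h59', h59, or_assoc]
        refine or_congr_right ?_
        constructor
        · rintro (⟨i, hi, h⟩ | h)
          · exact ⟨i, hi.trans (Nat.lt_succ_self _), h⟩
          · exact ⟨k, Nat.lt_succ_self _, h⟩
        · rintro ⟨i, hi, h⟩
          rcases Nat.lt_succ_iff_lt_or_eq.1 hi with hi | rfl
          · exact Or.inl ⟨i, hi, h⟩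
          · exact Or.inr h
      · rw [Nat.succ_mul]
        clear * - ht ht2
        omega
    · exact Nat.zero_le _
    · exact ⟨f66.trans h66, by simp, Nat.zero_le _⟩
    · rintro j s2 t2 - hj2 hj hF2 ⟨h77, h59', ht2⟩
      rw [f73] at hj2
      have g76 := hF2.var 76 rfl
      have g5 := hF2.var 5 rfl
      have g50 := hF2.var 50 rfl
      have g51 := hF2.var 51 rfl
      simp only [setVar_var, Nat.reduceEqDiff, ↓reduceIte] at g76 g5 g50 g51
      have c6 : s2.arr 6 = s.arr 6 := (hF2.arr 6 rfl).trans b6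
      have c7 : s2.arr 7 = s.arr 7 := (hF2.arr 7 rfl).trans b7
      have c9 : s2.arr 9 = s.arr 9 := (hF2.arr 9 rfl).trans b9
      have c12 : s2.arr 12 = s.arr 12 := (hF2.arr 12 rfl).trans b12
      have c13 : s2.arr 13 = s.arr 13 := (hF2.arr 13 rfl).trans b13
      have hit : Hit s2 v w (y₀ k) (y₁ j) ↔ Hit s v w (y₀ k) (y₁ j) := by
        simp only [Hit, c6, c12, c13]
      rw [wp_seq]
      refine Wp.mono (Wp.frame (wp_pairTest (g50.trans (f50.trans h50)) (g51.trans (f51.trans h51))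
        (g76.trans h76) h77 (by rw [c9, h9]))) ?_
      rintro s3 t3 ⟨⟨k59, ht3⟩, hF3⟩
      have k77 := hF3.var 77 rfl
      have k5 := hF3.var 5 rfl
      have k7 := hF3.arr 7 rfl
      simp only [wp_seq, wp_add, wp_load, setVar_var, next_var, setVar_arr, Nat.reduceEqDiff, ↓reduceIte,
        k77, k5, k7, g5, f5, c7, h77]
      refine ⟨hy₁ j hj2, ?_, ?_⟩
      · rw [k59, h59', hit, or_assoc]
        refine or_congr_right ?_
        constructor
        · rintro (⟨i, hi, h⟩ | h)
          · exact ⟨i, hi.trans (Nat.lt_succ_self _), h⟩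
          · exact ⟨j, Nat.lt_succ_self _, h⟩
        · rintro ⟨i, hi, h⟩
          rcases Nat.lt_succ_iff_lt_or_eq.1 hi with hi | rfl
          · exact Or.inl ⟨i, hi, h⟩
          · exact Or.inr h
      · rw [Nat.succ_mul]
        clear * - ht2 ht3
        omega
    · rintro s2 t2 ⟨-, h59', ht2⟩ - -
      rw [f73] at h59' ht2
      exact ⟨h59', by omega⟩
  · rintro s1 t1 ⟨-, h59, ht⟩ - -
    exact ⟨h59, by omega⟩

end Tree
end LocalSep

namespace LocalSep

open SimpleGraph Relation

section Crossing

variable {n : ℕ} {G : SimpleGraph (Fin n)} {d : ℕ}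

/-- Search the ball around the vertex 50 without the vertex 51. -/
def treeSearch : Prog :=
  .seq (.const 65 1) <| .seq (.add 66 5 51) <| .seq (.store 6 66 65) <| .seq (.copy 10 54) <|
    .seq (.copy 11 5) <| .seq (.copy 12 50) <| .seq (.const 13 1) <| .seq (.const 14 1) <|
    .seq (.const 15 8) <| .seq (.add 66 3 3) <| .seq (.add 66 66 66) <| .seq (.add 15 15 66) bfs

/-- The lists of the tabulated ball are used, so the potential is at most twice the maximum ball
size. -/
theorem wp_treeSearch {s : Store} (hT : Tables G d s) {v w : Fin n} (hvw : v ≠ w)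
    (hm : mark G d v w ≠ 0) (h50 : s.var 50 = v) (h51 : s.var 51 = w)
    (h54 : s.var 54 = ballRow n v) :
    Wp treeSearch s fun s' t => Ext (s.var 5) s s' ∧
      (∀ i, s.var 5 + (n + n) ≤ i → s'.arr 6 i = 0) ∧
      (∃ par, IsTree G d v w (fun u => s'.arr 6 (s.var 5 + u)) par ∧
        ∀ u : Fin n, u ≠ v → u ≠ w → s'.arr 6 (s.var 5 + u) ≠ 0 →
          s'.arr 7 (s.var 5 + u) = par u) ∧
      t ≤ 40 * maxBallSize G d + 40 := by
  have hfree := hT.free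
  have hle := ballRow_le v
  simp only [treeSearch, wp_seq, wp_copy, wp_const, wp_store, wp_add, setVar_var,
    Nat.reduceEqDiff, ↓reduceIte, setArr_var, h50, h51, h54, hT.var3]
  generalize hs1 : Store.setVar _ 15 _ = s1
  have a : ∀ b ≠ 6, s1.arr b = s.arr b := fun b hb => by
    rw [← hs1]
    simp [hb]
  have a6 : s1.arr 6 = Function.update (s.arr 6) (s.var 5 + w) 1 := by
    rw [← hs1]; simp
  obtain ⟨v4, v5, v6, v10, v11, v12, v13, v14, v15⟩ : s1.var 4 = s.var 4 ∧ s1.var 5 = s.var 5 ∧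
      s1.var 6 = s.var 6 ∧ s1.var 10 = ballRow n v ∧ s1.var 11 = s.var 5 ∧ s1.var 12 = v ∧
      s1.var 13 = 1 ∧ s1.var 14 = 1 ∧
      s1.var 15 = 8 + (n + n + (n + n) + (n + n + (n + n))) := by
    rw [← hs1]
    simp
  clear hs1
  have hE1 : Ext (s.var 5) s s1 := by
    constructor <;> intros <;> try simp only [v4, v6, a 1 (by decide), a 4 (by decide),
        a 5 (by decide), a 8 (by decide), le_refl]
    rename_i i hi
    rw [a6, Function.update_of_ne (by omega)]
  have hB : BallTab G d s1 v := (hT.ball v).ext hE1 (by omega) (by rw [a 9 (by decide)])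
    (by rw [a 10 (by decide)]) (by rw [a 11 (by decide)])
  have hz : ∀ x : ℕ, x ≠ w → s1.arr 6 (s.var 5 + x) = 0 := by
    intro x hx
    rw [a6, Function.update_of_ne (by omega)]
    exact hT.zero _ (Nat.le_add_right _ _)
  have hvb : v ∈ ballFin G d v := mem_ballFin.2 (by rw [mark_self]; exact one_ne_zero)
  refine Wp.mono (Wp.frame (wp_bfs (U := fun x => ∃ u ∈ ballFin G d v, (u : ℕ) = x) (W := n)
    ?_ ?_ ?_ ?_ ?_ ?_)) ?_
  · rintro _ ⟨u, -, rfl⟩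
    exact u.2
  · rw [v10]
    rintro _ x ⟨u, hu, rfl⟩ hx
    obtain ⟨y, hy, rfl⟩ := (hB.nb u hu x).1 hx
    exact ⟨y, mem_ballFin.2 (mark_ne_zero.2 hy.snd_mem), rfl⟩
  · rw [v10]
    rintro _ ⟨u, hu, rfl⟩
    exact (hB.row u hu).1
  · exact ⟨v, hvb, v12.symm⟩
  · rw [v11, v12]
    exact hz v fun h => hvw (Fin.ext h)
  · rw [v13]; exact one_ne_zero
  rintro s' t ⟨⟨hb, ht⟩, hF⟩
  rw [v10, v11] at ht
  have hpot : pot s' (ballRow n v) (s.var 5) n ≤ 2 * maxBallSize G d := by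
    refine le_trans (pot_le ((ballFin G d v).map Fin.valEmbedding) fun x hx hne => ?_) ?_
    · rw [Finset.mem_map]
      by_cases hxw : x = w
      · exact ⟨w, mem_ballFin.2 hm, hxw.symm⟩
      · obtain ⟨j, hj, rfl⟩ := (hb.marked (x := x) (by rw [v11]; exact hz x hxw)).2
          (by rwa [v11])
        exact (hb.mem j hj).1
    · rw [Finset.sum_map]
      refine le_trans (Finset.sum_le_sum fun u hu => ?_) (sum_ballDegree_le v)
      have := hB.len u hu
      rw [rowLen] at this ⊢
      rw [hF.arr 4 rfl, hF.arr 5 rfl]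
      exact Nat.add_le_add_right this 1
  have htree := hb.isTree v12 v13 v14 (by rw [v15]; ring) (w := w)
    (fun u hu => by rw [v11]; exact hz u fun h => hu (Fin.ext h))
    (by rw [v11, a6, Function.update_self]; exact one_ne_zero) (by rw [v10]; exact hB.nb)
  rw [v11] at htree
  refine ⟨hE1.trans (v11 ▸ hb.ext hF), fun i hi => ?_, ⟨_, htree.1, htree.2⟩, ?_⟩
  · rw [(hb.out i (Or.inr (by rw [v11]; omega))).1, a6, Function.update_of_ne (by omega)]
    exact hT.zero i (by omega)
  · generalize pot s' _ _ _ = p at *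
    clear * - ht hpot
    ring_nf
    omega

theorem LabelEntry.isLabel {s : Store} {v w : Fin n} (h : LabelEntry G d s v w) :
    IsLabel G d v w fun x => s.arr 6 (s.arr 12 (ballRow n v + w) + x) := by
  obtain ⟨L, hL⟩ := h.lab
  have e : ∀ x : Fin n, s.arr 6 (s.arr 12 (ballRow n v + w) + x) =
      s.arr 6 (s.arr 12 (ballRow n v + w) + code (false, x)) := fun x => by
    rw [code, cond_false, Nat.zero_add]
  refine ⟨fun a ha hav haw => ?_, fun a ha hav haw b hb hbv hbw => ?_⟩
  · simp only [e]
    exact h.ne_zero (false, a) ⟨ha, hav, haw⟩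
  · simp only [e]
    exact hL.eq_iff (false, a) (false, b) ⟨ha, hav, haw⟩ ⟨hb, hbv, hbw⟩
      (h.ne_zero (false, a) ⟨ha, hav, haw⟩)

/-- Separators have small distance, so the tables have an entry for them. On the alternating cycle
`v` and `w` are close to the other pair, and the labels of their left copies decide separation. -/
theorem SepTab.hit_iff {s : Store} {l : List (Fin n × Fin n)} (h : SepTab G d l s)
    (hl : ∀ v w, (v, w) ∈ l ↔ mark G d v w ≠ 0) {v w y₀ y₁ : Fin n}
    (halt : AlternatingCycle G d v w y₀ y₁) :
    Hit s v w y₀ y₁ ↔ IsLocalSeparator G d y₀ y₁ ∧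
      ¬ ReflTransGen (CopyRel G d y₀ y₁) (false, v) (false, w) := by
  obtain ⟨p, q, -, -, -, -, h0v, h0w, -, h1v, h1w⟩ := id halt
  have hm : IsLocalSeparator G d y₀ y₁ → (y₀, y₁) ∈ l := fun hs => by
    rw [hl, mark_ne_zero, mem_ball_iff]
    exact (isLocalSeparator_iff.1 hs).2.1
  rw [Hit, h.sep]
  constructor
  · rintro ⟨⟨h1, h2⟩, h3⟩
    refine ⟨h2, fun hr => h3 ?_⟩
    exact ((h.entry _ _ h1 h2.1).isLabel.2 v halt.symm.close.mem_ball_left h0v.symm h1v.symm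
      w halt.symm.flip.close.mem_ball_left h0w.symm h1w.symm).2 hr
  · rintro ⟨h2, h3⟩
    refine ⟨⟨hm h2, h2⟩, fun hr => h3 ?_⟩
    exact ((h.entry _ _ (hm h2) h2.1).isLabel.2 v halt.symm.close.mem_ball_left h0v.symm h1v.symm
      w halt.symm.flip.close.mem_ball_left h0w.symm h1w.symm).1 hr

/-- Decide whether the separator of the vertices 50 and 51 is crossed. -/
def crossSearch : Prog :=
  .seq (.load 62 12 64) <| .seq (.const 65 0) <| .seq findBest <| .seq (.copy 67 66) <|
    .seq (.copy 68 69) <| .seq (.add 65 62 67) <| .seq (.load 65 6 65) <| .seq findBest <|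
    .seq (.const 65 1) <| .seq (.add 65 65 1) <| .seq (.add 74 68 69) <| .seq (.sub 65 65 74) <|
    .cond 65 crossLoop .skip

/-- Implements `isTotallyNested_iff`. The two scans of the list of `w` cost O(R), and the test of
pairs O(d²). -/
theorem wp_crossSearch {s : Store} {l : List (Fin n × Fin n)} (h : SepTab G d l s)
    (hl : ∀ v w, (v, w) ∈ l ↔ mark G d v w ≠ 0) (hB : ∀ v, BallTab G d s v) {v w : Fin n}
    (hsep : IsLocalSeparator G d v w) (hna : ¬ G.Adj v w) {par : Fin n → Fin n}
    (htree : IsTree G d v w (fun u => s.arr 6 (s.var 5 + u)) par)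
    (hpar : ∀ u : Fin n, u ≠ v → u ≠ w → s.arr 6 (s.var 5 + u) ≠ 0 →
      s.arr 7 (s.var 5 + u) = par u) (h1 : s.var 1 = d) (h50 : s.var 50 = v) (h51 : s.var 51 = w)
    (h54 : s.var 54 = ballRow n v) (h59 : s.var 59 = 0) (h64 : s.var 64 = ballRow n v + w) :
    Wp crossSearch s fun s' t => (s'.var 59 ≠ 0 ↔ ¬ IsTotallyNested G d v w) ∧
      t ≤ 80 * maxBallSize G d + 50 * (d * d) + 70 := by
  have hmem : w ∈ ballFin G d v := by
    rw [mem_ballFin, mark_ne_zero, mem_ball_iff]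
    exact (isLocalSeparator_iff.1 hsep).2.1
  have hlen : rowLen s (ballRow n v) w ≤ 2 * maxBallSize G d :=
    ((hB v).len w hmem).trans (ballDegree_le v w hmem)
  have hlab := (h.entry v w ((hl v w).2 (mem_ballFin.1 hmem)) hsep.1).isLabel
  have hrow := (hB v).row w hmem
  have hnb := (hB v).nb w hmem
  simp only [crossSearch, wp_seq, wp_load, wp_const, h64]
  refine Wp.mono (Wp.frame (wp_findBest (d := d) (G := G) (v := v) (w := w) ?_ ?_ ?_ ?_ ?_)) ?_
  all_goals try simp only [setVar_var, setVar_arr, Nat.reduceEqDiff, ↓reduceIte, h54]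
  · exact h1
  · exact h50
  · exact h51
  · exact hrow.1
  · exact hnb
  rintro s1 t1 ⟨⟨⟨a₀, e66, hb₀⟩, ht1⟩, hF1⟩
  have f1 := hF1.var 1 rfl
  have f5 := hF1.var 5 rfl
  have f50 := hF1.var 50 rfl
  have f51 := hF1.var 51 rfl
  have f54 := hF1.var 54 rfl
  have f59 := hF1.var 59 rfl
  have f62 := hF1.var 62 rfl
  have b : ∀ k, findBest.keepsArr k = true → s1.arr k = s.arr k := fun k hk => hF1.arr k hk
  have b6 := b 6 rfl
  simp only [setVar_var, Nat.reduceEqDiff, ↓reduceIte, h1, h50, h51, h54, h59] at f1 f5 f50 f51 f54 f59 f62 hb₀ ht1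
  replace ht1 : t1 ≤ 20 * rowLen s (ballRow n v) w + 10 := ht1
  simp only [wp_add, wp_copy, setVar_var, setVar_arr, Nat.reduceEqDiff, ↓reduceIte, e66, f62, b6]
  clear hF1
  refine Wp.mono (Wp.frame (wp_findBest (d := d) (G := G) (v := v) (w := w) ?_ ?_ ?_ ?_ ?_)) ?_
  all_goals try simp only [setVar_var, setVar_arr, Nat.reduceEqDiff, ↓reduceIte, f54, b 4 rfl, b 5 rfl]
  · exact f1
  · exact f50
  · exact f51
  · exact hrow.1
  · intro y
    rw [← hnb y]
    simp only [Nb, setVar_arr, b 1 rfl, b 4 rfl, b 5 rfl]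
  rintro s2 t2 ⟨⟨⟨a₁, e66', hb₁⟩, ht2⟩, hF2⟩
  have g1 := hF2.var 1 rfl
  have g5 := hF2.var 5 rfl
  have g50 := hF2.var 50 rfl
  have g51 := hF2.var 51 rfl
  have g59 := hF2.var 59 rfl
  have g67 := hF2.var 67 rfl
  have g68 := hF2.var 68 rfl
  have c : ∀ k, findBest.keepsArr k = true → s2.arr k = s.arr k := fun k hk =>
    (hF2.arr k hk).trans (b k hk)
  simp only [setVar_var, Nat.reduceEqDiff, ↓reduceIte, f1, f5, f50, f51, f59,
    f62, b6] at g1 g5 g50 g51 g59 g67 g68 hb₁ ht2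
  replace ht2 : t2 ≤ 20 * rowLen s (ballRow n v) w + 10 := by
    have e : rowLen s (ballRow n v) w = rowLen s1 (ballRow n v) w := by
      simp only [rowLen, b 4 rfl, b 5 rfl]
    rw [e]
    exact ht2
  clear hF2
  -- This covers failed scans: a missing neighbour has value `d + 1`, so the length condition fails
  -- and there is no crossing.
  have hiff := isTotallyNested_iff hsep hna htree hlab hb₀ hb₁
  simp only [wp_sub, wp_cond, wp_skip, setVar_var, Nat.reduceEqDiff,
    ↓reduceIte, g1, g68]
  refine ⟨fun hlt => ?_, fun hge => ⟨?_, ?_⟩⟩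
  -- Register 65 holds `1 + d - (m₀ + m₁)`, which is nonzero if and only if the cycle has length at
  -- most `d`.
  · have hm : s1.var 69 + s2.var 69 ≤ d := by omega
    obtain ⟨hadj₀, hv₀, h0₀, -⟩ := hb₀.2.1 (by omega)
    obtain ⟨hadj₁, hv₁, h0₁, -⟩ := hb₁.2.1 (by omega)
    change s.arr 6 (s.var 5 + a₀) = s1.var 69 at hv₀
    change s.arr 6 (s.var 5 + a₁) = s2.var 69 at hv₁
    have chain₀ := htree.chain (k := s1.var 69 - 1) (a := a₀) ((ball G d v).adj_sub hadj₀).ne'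
      (by omega)
    have chain₁ := htree.chain (k := s2.var 69 - 1) (a := a₁) ((ball G d v).adj_sub hadj₁).ne'
      (by omega)
    have hstep : ∀ (a : Fin n) (k : ℕ), (∀ i < k, par^[i] a ≠ v ∧ par^[i] a ≠ w ∧
        s.arr 6 (s.var 5 + (par^[i] a : Fin n)) = k + 1 - i ∧
          ReflTransGen (CopyRel G d v w) (false, par^[i] a) (false, a)) →
        ∀ i < k, s.arr 7 (s.var 5 + (par^[i] a : Fin n)) = (par^[i + 1] a : Fin n) := by
      intro a k hc i hi
      obtain ⟨c1, c2, c3, -⟩ := hc i hi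
      rw [Function.iterate_succ_apply']
      exact hpar _ c1 c2 (by omega)
    refine Wp.mono (wp_crossLoop (v := v) (w := w) (y₀ := fun i => par^[i] a₀)
      (y₁ := fun i => par^[i] a₁) ?_ ?_ ?_ ?_ ?_ ?_ ?_) ?_
    all_goals try simp only [setVar_var, setVar_arr, Nat.reduceEqDiff, ↓reduceIte, g50, g51, g5,
      g67, g68, e66', c 7 rfl, c 9 rfl]
    · exact fun u => (hB u).handle
    · rfl
    · rfl
    · exact hstep a₀ _ chain₀
    · exact hstep a₁ _ chain₁
    · rintro s3 t3 ⟨k59, ht3⟩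
      simp only [g59] at k59 ht3
      have hhit : ∀ i < s1.var 69 - 1, ∀ j < s2.var 69 - 1,
          (s2.arr 13 (ballRow n (par^[i] a₀ : Fin n) + (par^[j] a₁ : Fin n)) ≠ 0 ∧
            s2.arr 6 (s2.arr 12 (ballRow n (par^[i] a₀ : Fin n) + (par^[j] a₁ : Fin n)) + v) ≠
            s2.arr 6 (s2.arr 12 (ballRow n (par^[i] a₀ : Fin n) + (par^[j] a₁ : Fin n)) + w)) ↔
          (IsLocalSeparator G d (par^[i] a₀) (par^[j] a₁) ∧
            ¬ ReflTransGen (CopyRel G d (par^[i] a₀) (par^[j] a₁)) (false, v) (false, w)) := by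
        intro i hi j hj
        rw [c 13 rfl, c 6 rfl, c 12 rfl]
        exact h.hit_iff hl (alternatingCycle_of_tree hsep.1 hna htree hlab hb₀ hb₁ hm hi hj).1
      constructor
      · rw [k59, hiff, not_not, IsCrossedOnTree, and_iff_right hm, or_iff_right (fun h => h rfl)]
        refine exists_congr fun i => and_congr_right fun hi => exists_congr fun j =>
          and_congr_right fun hj => hhit i hi j hj
      · have h3 : (s1.var 69 - 1) * ((s2.var 69 - 1) * 30 + 20) ≤ d * (d * 50) := by
          refine Nat.mul_le_mul (by omega) ?_
          have : 1 ≤ d := by omega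
          omega
        have h4 : d * (d * 50) = 50 * (d * d) := by ring
        rw [h4] at h3
        generalize (s1.var 69 - 1) * ((s2.var 69 - 1) * 30 + 20) = x at *
        generalize d * d = y at *
        clear * - ht1 ht2 ht3 h3 hlen
        ring_nf at ht1 ht2 ht3 h3 hlen ⊢
        omega
  · rw [hiff, not_not, IsCrossedOnTree, g59]
    refine iff_of_false (fun h => h rfl) fun h => ?_
    have := h.1
    omega
  · generalize d * d = y at *
    clear * - ht1 ht2 hlen
    ring_nf at ht1 ht2 hlen ⊢
    omega

end Crossing
end LocalSep

namespace LocalSep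

open SimpleGraph Relation

/-! ### Listing the totally nested separators -/

section Output

variable {n : ℕ} {G : SimpleGraph (Fin n)} {d : ℕ}

theorem SepTab.ext {l : List (Fin n × Fin n)} {s s' : Store} (h : SepTab G d l s)
    (hE : Ext (s.var 5) s s') (h12 : s'.arr 12 = s.arr 12) (h13 : s'.arr 13 = s.arr 13)
    (h5 : s.var 5 ≤ s'.var 5) : SepTab G d l s' :=
  ⟨by rw [h13]; exact h.sep, fun v w hl hvw => (h.entry v w hl hvw).ext hE (by rw [h12]) h5⟩

theorem IsLocalSeparator.mark_ne_zero {V : Type*} {G : SimpleGraph V} {v w : V}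
    (h : IsLocalSeparator G d v w) : mark G d v w ≠ 0 := by
  rw [LocalSep.mark_ne_zero, mem_ball_iff]
  exact (isLocalSeparator_iff.1 h).2.1

/-- Distinct vertices have mark at least 2, with equality for adjacent ones, so one truncated
subtraction tests adjacency. -/
theorem mark_sub_two_ne_zero {V : Type*} {G : SimpleGraph V} {v w : V} (hd : 2 ≤ d) (hvw : v ≠ w)
    (h : mark G d v w ≠ 0) : mark G d v w - 2 ≠ 0 ↔ ¬ G.Adj v w := by
  rw [← mark_eq_two_iff hd]
  have : mark G d v w ≠ 1 := by
    intro h1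
    have := edist_of_mark h
    rw [h1] at this
    rw [Nat.sub_self, Nat.cast_zero] at this
    exact hvw (edist_eq_zero_iff.1 this)
  omega

/-- Decide whether the separator of the vertices 50 and 51 is crossed. -/
def crossTest : Prog :=
  .cond 66 (.seq treeSearch (.seq crossSearch (.add 5 5 3))) .skip

/-- For adjacent vertices the search is skipped, as nothing crosses them. Otherwise register 5 moves
past the rows of the search tree, so that the next search finds unmarked rows. -/
theorem wp_crossTest {s : Store} {l : List (Fin n × Fin n)} (hd : 2 ≤ d) (hT : Tables G d s)
    (h : SepTab G d l s) (hl : ∀ v w, (v, w) ∈ l ↔ mark G d v w ≠ 0) {v w : Fin n}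
    (hsep : IsLocalSeparator G d v w) (h50 : s.var 50 = v) (h51 : s.var 51 = w)
    (h54 : s.var 54 = ballRow n v) (h59 : s.var 59 = 0) (h64 : s.var 64 = ballRow n v + w)
    (h66 : s.var 66 = mark G d v w - 2) :
    Wp crossTest s fun s' t => Ext (ballRow n n) s s' ∧ s.var 5 ≤ s'.var 5 ∧
      (∀ i, s'.var 5 ≤ i → s'.arr 6 i = 0) ∧ SepTab G d l s' ∧
      (s'.var 59 ≠ 0 ↔ ¬ IsTotallyNested G d v w) ∧
      t ≤ 120 * maxBallSize G d + 50 * (d * d) + 120 := by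
  have hiff := mark_sub_two_ne_zero hd hsep.1 hsep.mark_ne_zero
  have hfree := hT.free
  simp only [crossTest, wp_cond, wp_seq, wp_skip, wp_add]
  rw [h66]
  constructor
  · intro hne
    have hna := hiff.1 hne
    refine Wp.mono (Wp.frame (wp_treeSearch hT hsep.1 hsep.mark_ne_zero h50 h51 h54)) ?_
    rintro s1 t1 ⟨⟨hE1, hz1, ⟨par, htree, hpar⟩, ht1⟩, hF1⟩
    have v5 : s1.var 5 = s.var 5 := hF1.var 5 rfl
    have hsep1 := h.ext hE1 (hF1.arr 12 rfl) (hF1.arr 13 rfl) v5.ge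
    have hB : ∀ c, BallTab G d s1 c := fun c => by
      have := ballRow_le c
      exact (hT.ball c).ext hE1 (by omega) (by rw [hF1.arr 9 rfl]) (by rw [hF1.arr 10 rfl])
        (by rw [hF1.arr 11 rfl])
    rw [← v5] at htree hpar
    refine Wp.mono (Wp.frame (wp_crossSearch hsep1 hl hB hsep hna htree hpar
      ((hF1.var 1 rfl).trans hT.var1) ((hF1.var 50 rfl).trans h50) ((hF1.var 51 rfl).trans h51)
      ((hF1.var 54 rfl).trans h54) ((hF1.var 59 rfl).trans h59) ((hF1.var 64 rfl).trans h64))) ?_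
    rintro s2 t2 ⟨⟨h2, ht2⟩, hF2⟩
    have w5 : s2.var 5 = s.var 5 := (hF2.var 5 rfl).trans v5
    have w3 : s2.var 3 = n + n := (hF2.var 3 rfl).trans ((hF1.var 3 rfl).trans hT.var3)
    have a : ∀ k, crossSearch.keepsArr k = true → s2.arr k = s1.arr k := fun k hk => hF2.arr k hk
    have hE2 : Ext (s.var 5) s (s2.setVar 5 (s2.var 5 + s2.var 3)) := by
      refine hE1.trans ?_
      constructor <;> intros <;> simp only [setVar_var, Nat.reduceEqDiff, ↓reduceIte, setVar_arr,
        hF2.var 4 rfl, hF2.var 6 rfl, a 1 rfl, a 4 rfl, a 5 rfl, a 6 rfl, a 8 rfl, le_refl]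
    refine ⟨hE2.mono hfree, ?_, ?_, h.ext hE2 ?_ ?_ ?_, ?_, ?_⟩
    · simp [w5]
    · simp only [setVar_var, ↓reduceIte, setVar_arr, w5, w3, a 6 rfl]
      exact hz1
    · exact (a 12 rfl).trans (hF1.arr 12 rfl)
    · exact (a 13 rfl).trans (hF1.arr 13 rfl)
    · simp [w5]
    · simpa using h2
    · clear * - ht1 ht2
      ring_nf at ht1 ht2 ⊢
      omega
  · intro he
    have hadj : G.Adj v w := by
      by_contra hc
      exact hiff.2 hc he
    refine ⟨Ext.of_eq rfl rfl rfl, le_rfl, hT.zero, h, ?_, by clear * -; omega⟩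
    rw [h59]
    exact iff_of_false (fun h => h rfl) (not_not.2 (isTotallyNested_of_adj hsep hadj))

/-- Append the vertices 50 and 51 to the output if they form a totally nested separator and the
first one is smaller. -/
def nestedStep : Prog :=
  .seq (.sub 57 51 50) <| .cond 57 (.seq (.add 64 54 51) <| .seq (.load 66 13 64) <|
    .cond 66 (.seq (.const 59 0) <| .seq (.load 66 6 64) <| .seq (.const 65 2) <|
      .seq (.sub 66 66 65) <| .seq crossTest <|
      .cond 59 .skip (.seq (.store 2 2 50) <| .seq (.store 3 2 51) (incr 2))) .skip) .skip

/-- The storage holds the totally nested separators with the smaller vertex first among the pairs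
in `done`. -/
def HoldsNested (G : SimpleGraph (Fin n)) (d : ℕ) (done : List (Fin n × Fin n)) (s : Store) :
    Prop :=
  ∃ l, HoldsPairs s l ∧ l.Nodup ∧
    ∀ a b, (a, b) ∈ l ↔ (a, b) ∈ done ∧ a < b ∧ IsTotallyNested G d a b

theorem HoldsNested.congr {done : List (Fin n × Fin n)} {s s' : Store}
    (h : HoldsNested G d done s) (hv : s'.var 2 = s.var 2) (h2 : s'.arr 2 = s.arr 2)
    (h3 : s'.arr 3 = s.arr 3) : HoldsNested G d done s' := by
  obtain ⟨l, hl, h⟩ := h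
  exact ⟨l, ⟨hv.trans hl.1, by rw [h2, h3]; exact hl.2⟩, h⟩

theorem HoldsNested.cons_of_not {done : List (Fin n × Fin n)} {s : Store} {v w : Fin n}
    (h : HoldsNested G d done s) (hvw : ¬ (v < w ∧ IsTotallyNested G d v w)) :
    HoldsNested G d ((v, w) :: done) s := by
  obtain ⟨l, hl, hn, h⟩ := h
  refine ⟨l, hl, hn, fun a b => ?_⟩
  rw [h, List.mem_cons, Prod.mk.injEq]
  refine and_congr_left fun h' => (or_iff_right ?_).symm
  rintro ⟨rfl, rfl⟩
  exact hvw h'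

theorem HoldsNested.cons {done : List (Fin n × Fin n)} {s s' : Store} {v w : Fin n}
    (h : HoldsNested G d done s) (hnot : (v, w) ∉ done) (hvw : v < w)
    (hnest : IsTotallyNested G d v w) (hv : s'.var 2 = s.var 2 + 1)
    (h2 : s'.arr 2 = Function.update (s.arr 2) (s.var 2) v)
    (h3 : s'.arr 3 = Function.update (s.arr 3) (s.var 2) w) :
    HoldsNested G d ((v, w) :: done) s' := by
  obtain ⟨l, hl, hn, h⟩ := h
  refine ⟨l ++ [(v, w)], ⟨by rw [hv, hl.1, List.length_append]; rfl, fun i hi => ?_⟩, ?_,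
    fun a b => ?_⟩
  · rw [List.length_append, List.length_singleton] at hi
    rw [h2, h3, hl.1]
    rcases Nat.lt_succ_iff_lt_or_eq.1 hi with hi | rfl
    · rw [Function.update_of_ne hi.ne, Function.update_of_ne hi.ne, List.getElem_append_left hi]
      exact hl.2 i hi
    · simp
  · refine List.nodup_append'.2 ⟨hn, List.nodup_singleton _, ?_⟩
    rw [List.disjoint_singleton, h]
    exact fun h => hnot h.1
  · rw [List.mem_append, h, List.mem_singleton, List.mem_cons, Prod.mk.injEq, or_comm, or_and_right]
    refine or_congr_left (iff_self_and.2 ?_)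
    rintro ⟨rfl, rfl⟩
    exact ⟨hvw, hnest⟩

/-- Both orders of a pair are visited; only the increasing one is tested and possibly output, which
prevents duplicates. -/
theorem wp_nestedStep (hd : 2 ≤ d) {s : Store} {l done : List (Fin n × Fin n)}
    (hT : Tables G d s) (h : SepTab G d l s) (hl : ∀ v w, (v, w) ∈ l ↔ mark G d v w ≠ 0)
    (ho : HoldsNested G d done s) {v w : Fin n} (hm : mark G d v w ≠ 0) (hnot : (v, w) ∉ done)
    (h50 : s.var 50 = v) (h51 : s.var 51 = w) (h54 : s.var 54 = ballRow n v) :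
    Wp nestedStep s fun s' t => Ext (ballRow n n) s s' ∧ s.var 5 ≤ s'.var 5 ∧
      (∀ i, s'.var 5 ≤ i → s'.arr 6 i = 0) ∧
      (SepTab G d l s' ∧ HoldsNested G d ((v, w) :: done) s') ∧
      t ≤ 120 * maxBallSize G d + 50 * (d * d) + 140 := by
  have hs := h.sep v w
  rw [hl, and_iff_right hm] at hs
  have hval := (hT.ball v).val w
  simp only [nestedStep, wp_seq, wp_sub, wp_add, wp_load, wp_const, wp_cond, setVar_var,
    Nat.reduceEqDiff, ↓reduceIte, setVar_arr, h50, h51, h54, hval]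
  have halts : ∀ s' : Store, s'.arr = s.arr → (∀ y < 26, s'.var y = s.var y) → ∀ t ≤ 10,
      ¬ (v < w ∧ IsTotallyNested G d v w) → Wp .skip s' fun s' t' => Ext (ballRow n n) s s' ∧
        s.var 5 ≤ s'.var 5 ∧ (∀ i, s'.var 5 ≤ i → s'.arr 6 i = 0) ∧
        (SepTab G d l s' ∧ HoldsNested G d ((v, w) :: done) s') ∧
        t + t' ≤ 120 * maxBallSize G d + 50 * (d * d) + 140 := by
    intro s' ha hv t ht hn
    rw [wp_skip]
    have hE : ∀ b, Ext b s s' := fun b => Ext.of_eq ha (hv 4 (by decide)) (hv 6 (by decide))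
    have hv5 := hv 5 (by decide)
    refine ⟨hE _, hv5.ge, ?_, ⟨h.ext (hE _) (by rw [ha]) (by rw [ha]) hv5.ge,
      (ho.cons_of_not hn).congr (hv 2 (by decide)) (by rw [ha]) (by rw [ha])⟩, ?_⟩
    · rw [hv5, ha]; exact hT.zero
    · clear * - ht
      omega
  constructor
  · intro hlt
    have hvw : v < w := by
      rw [Fin.lt_def]
      clear * - hlt
      omega
    constructor
    · intro hne
      have hsep := hs.1 hne
      generalize hs1 : Store.setVar _ 66 (mark G d v w - 2) = s1
      have b1 : s1.arr = s.arr := by rw [← hs1]; rfl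
      have vv1 : ∀ y < 57, s1.var y = s.var y := fun y hy => by
        rw [← hs1]
        simp only [setVar_var]
        rw [if_neg (by omega), if_neg (by omega), if_neg (by omega), if_neg (by omega),
          if_neg (by omega), if_neg (by omega), if_neg (by omega)]
      obtain ⟨v59, v64, v66⟩ : s1.var 59 = 0 ∧ s1.var 64 = ballRow n v + w ∧
          s1.var 66 = mark G d v w - 2 := by
        rw [← hs1]
        simp
      clear hs1
      have hT1 : Tables G d s1 := hT.congr b1 fun y hy => vv1 y (hy.trans (by decide))
      have hE1 : ∀ b, Ext b s s1 := fun b =>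
        Ext.of_eq b1 (vv1 4 (by decide)) (vv1 6 (by decide))
      have v5 := vv1 5 (by decide)
      refine Wp.mono (Wp.frame (wp_crossTest hd hT1
        (h.ext (hE1 _) (by rw [b1]) (by rw [b1]) v5.ge) hl hsep
        ((vv1 50 (by decide)).trans h50) ((vv1 51 (by decide)).trans h51)
        ((vv1 54 (by decide)).trans h54) v59 v64 v66)) ?_
      rintro s2 t2 ⟨⟨hE2, w5, hz, hS, h59, ht⟩, hF⟩
      rw [v5] at w5
      have w2 : s2.var 2 = s.var 2 := (hF.var 2 rfl).trans (vv1 2 (by decide))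
      have w50 : s2.var 50 = v := (hF.var 50 rfl).trans ((vv1 50 (by decide)).trans h50)
      have w51 : s2.var 51 = w := (hF.var 51 rfl).trans ((vv1 51 (by decide)).trans h51)
      have c2 : s2.arr 2 = s.arr 2 := (hF.arr 2 rfl).trans (by rw [b1])
      have c3 : s2.arr 3 = s.arr 3 := (hF.arr 3 rfl).trans (by rw [b1])
      have ho2 := ho.congr w2 c2 c3
      have hE := (hE1 _).trans hE2
      constructor
      · intro hne
        rw [wp_skip]
        refine ⟨hE, w5, hz, ⟨hS, ho2.cons_of_not fun h => h59.1 hne h.2⟩, ?_⟩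
        clear * - ht
        generalize d * d = y at *
        omega
      · intro he
        have hnest : IsTotallyNested G d v w := by
          by_contra hc
          exact h59.2 hc he
        simp only [wp_store, wp_incr, setVar_var, setArr_var, Nat.reduceEqDiff, ↓reduceIte, w50,
          w51]
        have hE3 : ∀ b, Ext b s2 ((((s2.setArr 2 (s2.var 2) v).setArr 3 (s2.var 2) w).setVar 26
            1).setVar 2 (s2.var 2 + 1)) := by
          intro b
          constructor <;> intros <;> simp
        refine ⟨hE.trans (hE3 _), ?_, ?_, ⟨hS.ext (hE3 _) ?_ ?_ ?_,
          ho2.cons hnot hvw hnest ?_ ?_ ?_⟩, ?_⟩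
        · simpa using w5
        · simpa using hz
        · simp
        · simp
        · simp
        · simp
        · simp
        · simp
        · clear * - ht
          generalize d * d = y at *
          ring_nf at ht ⊢
          omega
    · intro he
      refine Wp.mono (halts (((s.setVar 57 _).setVar 64 _).setVar 66 _) rfl (fun y hy => ?_) 5 (by decide)
        fun hc => hs.2 hc.2.1 he) ?_
      · simp only [Store.setVar_var_of_lt hy, Nat.reduceLeDiff]
      · rintro s' t ⟨h1, h2, h3, h4, ht⟩
        refine ⟨h1, h2, h3, h4, ?_⟩
        clear * - ht
        generalize d * d = y at *
        ring_nf at ht ⊢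
        omega
  · intro he
    refine Wp.mono (halts (s.setVar 57 _) rfl (fun y hy => ?_) 5 (by decide) fun hc => ?_) ?_
    · exact Store.setVar_var_of_lt hy (by decide)
    · have := Fin.lt_def.1 hc.1
      clear * - this he
      omega
    · rintro s' t ⟨h1, h2, h3, h4, ht⟩
      refine ⟨h1, h2, h3, h4, ?_⟩
      clear * - ht
      generalize d * d = y at *
      ring_nf at ht ⊢
      omega

/-- Output the totally nested separators. -/
def nestedPhase : Prog := forPairs nestedStep

theorem wp_nestedPhase (hd : 2 ≤ d) {s : Store} {l : List (Fin n × Fin n)} (hT : Tables G d s)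
    (h : SepTab G d l s) (hl : ∀ v w, (v, w) ∈ l ↔ mark G d v w ≠ 0) (h2 : s.var 2 = 0) :
    Wp nestedPhase s fun s' t =>
      (∃ l, HoldsPairs s' l ∧ l.Nodup ∧ ∀ a b, (a, b) ∈ l ↔ a < b ∧ IsTotallyNested G d a b) ∧
      t ≤ n * (maxBallSize G d * (120 * maxBallSize G d + 50 * (d * d) + 140 + 14)) + 3 := by
  refine Wp.mono (wp_forPairs (I := fun done s => SepTab G d l s ∧ HoldsNested G d done s)
    (τ := 120 * maxBallSize G d + 50 * (d * d) + 140) (by decide) (by decide) ?_ hT ⟨h, [], ⟨h2, by simp⟩, List.nodup_nil, by simp⟩ ?_) ?_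
  · rintro done s s' ha hv ⟨h1, h2⟩
    exact ⟨h1.ext (Ext.of_eq ha (hv 4 (by decide)) (hv 6 (by decide))) (by rw [ha]) (by rw [ha])
      (hv 5 (by decide)).ge, h2.congr (hv 2 (by decide)) (by rw [ha]) (by rw [ha])⟩
  · rintro done s v w hT ⟨h1, h2⟩ hm hnot h50 h51 h54
    exact wp_nestedStep hd hT h1 hl h2 hm hnot h50 h51 h54
  · rintro s' t ⟨-, ⟨done, hdone, -, l', h1, h2, h3⟩, ht⟩
    refine ⟨⟨l', h1, h2, fun a b => ?_⟩, ht⟩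
    rw [h3, hdone]
    exact and_iff_right_of_imp fun h => h.2.1.mark_ne_zero

end Output
end LocalSep

namespace LocalSep

open SimpleGraph

/-! ### The whole program and its running time -/

section Main

variable {n : ℕ} {G : SimpleGraph (Fin n)} {d : ℕ}

/-- The program that outputs the totally nested separators. -/
def findNested : Prog :=
  .seq (.const 40 1) <| .seq (.sub 40 1 40) <|
    .cond 40 (.seq loadGraph <| .seq ballPhase <| .seq sepPhase nestedPhase) .skip

theorem IsLocalSeparator.two_le {V : Type*} {G : SimpleGraph V} {v w : V}
    (h : IsLocalSeparator G d v w) : 2 ≤ d := by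
  have := h.2.1.pos_dist_of_ne h.1
  have := h.2.2.1
  omega

theorem ballRow_zero (n : ℕ) : ballRow n 0 = n + n := by
  unfold ballRow
  omega

/-- Here `m` is the larger of d² and R, so it bounds `R` and `y`; additive constants are absorbed
because `R` and `n` are at least 1. -/
theorem time_le {R n y m : ℕ} (hR : 1 ≤ R) (hn : 1 ≤ n) (hy : y ≤ m) (hm : R ≤ m) :
    20 * n + 304 * (R * R * n) + n * (R * (505 * R + 14)) +
      n * (R * (120 * R + 50 * y + 140 + 14)) + 40 ≤ 1300 * (m * R * n) := by
  have h1 : R * R * n ≤ m * R * n := by gcongr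
  have h2 : n ≤ m * R * n := Nat.le_mul_of_pos_left _ (Nat.mul_pos (hR.trans hm) hR)
  have h3 : n * (R * (505 * R + 14)) ≤ 519 * (m * R * n) := by
    calc n * (R * (505 * R + 14)) ≤ n * (R * (519 * m)) := by gcongr; omega
      _ = 519 * (m * R * n) := by ring
  have h4 : n * (R * (120 * R + 50 * y + 140 + 14)) ≤ 324 * (m * R * n) := by
    calc n * (R * (120 * R + 50 * y + 140 + 14)) ≤ n * (R * (324 * m)) := by gcongr; omega
      _ = 324 * (m * R * n) := by ring
  omega

theorem wp_findNested (hn : 0 < n) {nbrs : Fin n → List (Fin n)} (hnb : IsAdjacencyList G nbrs) :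
    Wp findNested (inputStore nbrs d) fun s t =>
      (∃ l, HoldsPairs s l ∧ l.Nodup ∧ ∀ a b, (a, b) ∈ l ↔ a < b ∧ IsTotallyNested G d a b) ∧
      t ≤ 1300 * (max (d ^ 2) (maxBallSize G d) * maxBallSize G d * n) := by
  have hR := one_le_maxBallSize (G := G) (d := d) ⟨0, hn⟩
  have htime := time_le hR hn (y := d * d) (m := max (d ^ 2) (maxBallSize G d))
    (by rw [← sq]; exact le_max_left _ _) (le_max_right _ _)
  have i1 : (inputStore nbrs d).var 1 = d := rfl
  simp only [findNested, wp_seq, wp_const, wp_sub, wp_cond, wp_skip, setVar_var, Nat.reduceEqDiff,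
    ↓reduceIte, i1]
  constructor
  · intro h
    have hd : 2 ≤ d := by omega
    generalize hs1 : Store.setVar _ 40 (d - 1) = s1
    have b1 : s1.arr = (inputStore nbrs d).arr := by rw [← hs1]; rfl
    obtain ⟨v0, v1, v2⟩ : s1.var 0 = n ∧ s1.var 1 = d ∧ s1.var 2 = 0 := by
      rw [← hs1]
      simp [inputStore]
    clear hs1
    have z : ∀ k, 2 ≤ k → ∀ i, s1.arr k i = 0 := by
      intro k hk i
      rw [b1, inputStore]
      simp only
      rw [if_neg (by omega), if_neg (by omega)]
    refine Wp.mono (Wp.frame (wp_loadGraph s1)) ?_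
    rintro s2 t2 ⟨⟨w3, w4, w5, h45, ht2⟩, hF2⟩
    rw [v0] at w3 w4 w5 h45 ht2
    rw [b1] at w4 h45
    have hg : GraphTab G s2 := graphTab_of_load hnb ((hF2.arr 1 rfl).trans (by rw [b1])) w4 h45
    have hready : BallsReady G d 0 s2 :=
      { var0 := (hF2.var 0 rfl).trans v0
        var1 := (hF2.var 1 rfl).trans v1
        var3 := w3
        var5 := by rw [w5, ballRow_zero]
        graph := hg
        ball := fun v hv => absurd hv (Nat.not_lt_zero _)
        zero := fun i _ => by rw [hF2.arr 6 rfl]; exact z 6 (by decide) i }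
    refine Wp.mono (Wp.frame (wp_ballPhase hd hready)) ?_
    rintro s3 t3 ⟨⟨hT, ht3⟩, hF3⟩
    refine Wp.mono (Wp.frame (wp_sepPhase hT.tables fun i => ?_)) ?_
    · rw [hF3.arr 13 rfl, hF2.arr 13 rfl]
      exact z 13 (by decide) i
    rintro s4 t4 ⟨⟨hT4, ⟨l, hl, hS⟩, ht4⟩, hF4⟩
    refine Wp.mono (wp_nestedPhase hd hT4 hS hl ?_) ?_
    · exact (hF4.var 2 rfl).trans ((hF3.var 2 rfl).trans ((hF2.var 2 rfl).trans v2))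
    rintro s5 t5 ⟨hres, ht5⟩
    refine ⟨hres, le_trans ?_ htime⟩
    clear * - ht2 ht3 ht4 ht5
    generalize maxBallSize G d = R at *
    generalize n * (R * (120 * R + 50 * (d * d) + 140 + 14)) = x₁ at *
    generalize n * (R * (505 * R + 14)) = x₂ at *
    generalize R * R * n = x₃ at *
    have e : 1 + (1 + (t2 + (t3 + (t4 + t5))) + 1) = t2 + t3 + t4 + t5 + 3 := by ring
    omega
  -- For `d < 2` distinct vertices are too far apart to form a separator, and the initial storage
  -- already represents the empty list.
  · intro h
    refine ⟨⟨[], ⟨rfl, by simp⟩, List.nodup_nil, fun a b => ?_⟩, ?_⟩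
    · refine iff_of_false List.not_mem_nil fun hab => ?_
      have := hab.2.1.two_le
      omega
    · refine le_trans ?_ htime
      clear * -
      omega

end Main
end LocalSep

/-- There is one program that, on every finite graph `G` with at least one vertex and for every
`d`, outputs the list of all totally nested `d`-local 2-separators of `G` (each of them once, as a
pair with smaller vertex first) within `O(max(d ^ 2, R) * R * n)` steps. -/
theorem mainTheorem2 :
    ∃ (P : LocalSep.Prog) (C : ℕ),
      ∀ (n : ℕ) (_ : 0 < n) (G : SimpleGraph (Fin n)) (nbrs : Fin n → List (Fin n))
        (_ : LocalSep.IsAdjacencyList G nbrs) (d : ℕ),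
        ∃ (s : LocalSep.Store) (t : ℕ) (l : List (Fin n × Fin n)),
          LocalSep.Run P (LocalSep.inputStore nbrs d) s t ∧
          t ≤ C * (max (d ^ 2) (LocalSep.maxBallSize G d) * LocalSep.maxBallSize G d * n) ∧
          LocalSep.HoldsPairs s l ∧ l.Nodup ∧
          ∀ a b : Fin n, (a, b) ∈ l ↔ a < b ∧ LocalSep.IsTotallyNested G d a b := by
  refine ⟨LocalSep.findNested, 1300, fun n hn G nbrs hnb d => ?_⟩
  obtain ⟨s, t, hr, ⟨l, h⟩, ht⟩ := LocalSep.wp_findNested (d := d) hn hnb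
  exact ⟨s, t, l, hr, ht, h⟩
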